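/- Let $F$ be an imaginary quadratic field with ring of integers $\mathcal O$ and a fixed complex embedding $F\subset\mathbb C$, and let $N$ be a natural number. For $x\in\mathcal O^N$ put $q(x)=xx^*$. For a positive definite Hermitian $N\times N$ matrix $A$ let $m(A)=\inf\{x^*Ax : x\in\mathcal O^N\setminus\{0\}\}$ and let $M(A)$ be the set of nonzero $x \in \mathcal O^N$ with $x^*Ax=m(A)$; $A$ is perfect if $m(A)=1$ and the real span of $\{q(v): v\in M(A)\}$ is the space of all Hermitian $N\times N$ matrices. Let $C_N^*$ be the space of nonzero positive semidefinite Hermitian $N\times N$ matrices whose kernel is spanned by vectors in $F^N$, with the topology induced from the space of Hermitian matrices, and let $\pi\colon C_N^*\to X_N^*=\mathbb R_{>0}\backslash C_N^*$ be the quotient by positive homotheties; the quotient topology is called the usual topology of $X_N^*$. For $A$ perfect let $\sigma(A)\subset X_N^*$ be the image under $\pi$ of the set of nonzero matrices $\sum_{v\in M(A)}\lambda_vq(v)$ with all $\lambda_v\ge 0$. The closed cells of $X_N^*$ are the sets $\sigma(A)$, for $A$ perfect, and their nonempty finite intersections; $X^*_N$ is endowed with the CW topology, i.e. the weak topology with respect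 to these closed cells, each carrying its usual topology. For a proper $F$-subspace $V\subsetneq F^N$ ($V=0$ is allowed) let $C(V)$ be the set of $A\in C_N^*$ whose kernel is the complex span of $V$ in $\mathbb C^N$, let $\overline{C(V)}$ be its closure in $C_N^*$, and put $X(V)=\pi(C(V))$ and $\overline{X(V)}=\pi(\overline{C(V)})$. Then $X_N^*$ with the CW topology is a (Hausdorff) CW-complex whose closed cells are exactly the closed cells described above, and for every proper subspace $V\subsetneq F^N$: (1) $\overline{X(V)}$ is a subcomplex of $X_N^*$; (2) $\overline{X(V)}$, with the CW topology, is contractible; (3) on $X(V)$ the topology induced by the CW topology of $X_N^*$ coincides with the one induced by the usual topology. -/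

import Mathlib

namespace VoronoiHermitian

open scoped ComplexOrder NumberField

noncomputable section

variable {F : Type*} [Field F] (φ : F →+* ℂ) (N : ℕ)

/-- The embedding of `F ^ N` into `ℂ ^ N` induced by the complex embedding `φ`. -/
def emb (x : Fin N → F) : Fin N → ℂ := fun i => φ (x i)

/-- The embedding of the lattice `𝓞 ^ N` into `ℂ ^ N`. -/
def embInt (x : Fin N → 𝓞 F) : Fin N → ℂ := emb φ N (fun i => (x i : F))

/-- The subspace of `ℂ ^ N` generated by the image of an `F`-subspace `V` of `F ^ N`,
i.e. the image of `V ⊗[ℚ] ℝ = V ⊗[F] ℂ` in `ℂ ^ N`. -/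
def complexSpan (V : Submodule F (Fin N → F)) : Submodule ℂ (Fin N → ℂ) :=
  Submodule.span ℂ (emb φ N '' (V : Set (Fin N → F)))

/-- The outer product `q x = x x^*`, for `x ∈ 𝓞 ^ N`. -/
def q (x : Fin N → 𝓞 F) : Matrix (Fin N) (Fin N) ℂ :=
  Matrix.vecMulVec (embInt φ N x) (star (embInt φ N x))

/-- The value `A[x] = x^* A x` at a lattice vector (a real number when `A` is Hermitian). -/
def formValue (A : Matrix (Fin N) (Fin N) ℂ) (x : Fin N → 𝓞 F) : ℝ :=
  (star (embInt φ N x) ⬝ᵥ A.mulVec (embInt φ N x)).re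

/-- The minimum `m(A)`: the infimum of `A[x]` over nonzero lattice vectors `x`. -/
def minimum (A : Matrix (Fin N) (Fin N) ℂ) : ℝ :=
  sInf (formValue φ N A '' {x | x ≠ 0})

/-- The set `M(A)` of minimal vectors of `A`. -/
def minimalVectors (A : Matrix (Fin N) (Fin N) ℂ) : Set (Fin N → 𝓞 F) :=
  {v | v ≠ 0 ∧ formValue φ N A v = minimum φ N A}

/-- Perfect Hermitian forms over `F`, normalized by `m(A) = 1`: positive definite forms such that
the matrices `q v`, for `v` minimal, span the real vector space of Hermitian matrices. -/
def IsPerfect (A : Matrix (Fin N) (Fin N) ℂ) : Prop :=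
  A.PosDef ∧ minimum φ N A = 1 ∧
    (Submodule.span ℝ (q φ N '' minimalVectors φ N A) : Set (Matrix (Fin N) (Fin N) ℂ)) =
      {B | B.IsHermitian}

/-- `A` has `F`-rational kernel: the kernel is spanned by vectors in (the image of) `F ^ N`. -/
def HasRationalKernel (A : Matrix (Fin N) (Fin N) ℂ) : Prop :=
  ∃ S : Set (Fin N → F), LinearMap.ker A.mulVecLin = Submodule.span ℂ (emb φ N '' S)

/-- The space `C^*_N` of nonzero positive semidefinite Hermitian matrices with `F`-rational kernel,
with the topology induced by the usual one on matrices. -/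
abbrev CStar : Type :=
  {A : Matrix (Fin N) (Fin N) ℂ // A.PosSemidef ∧ A ≠ 0 ∧ HasRationalKernel φ N A}

/-- Equivalence under positive real homotheties. -/
def homothety : Setoid (CStar φ N) where
  r A B := ∃ t : ℝ, 0 < t ∧ B.1 = t • A.1
  iseqv :=
    { refl := fun A => ⟨1, one_pos, (one_smul ℝ A.1).symm⟩
      symm := by
        rintro A B ⟨t, ht, h⟩
        exact ⟨t⁻¹, inv_pos.mpr ht, by rw [h, smul_smul, inv_mul_cancel₀ ht.ne', one_smul]⟩
      trans := by
        rintro A B C ⟨t, ht, h⟩ ⟨s, hs, h'⟩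
        exact ⟨s * t, mul_pos hs ht, by rw [h', h, smul_smul]⟩ }

/-- The quotient `X^*_N` of `C^*_N` by positive homotheties. -/
def XStar : Type := Quotient (homothety φ N)

/-- The projection `π : C^*_N → X^*_N`. -/
def proj (A : CStar φ N) : XStar φ N := Quotient.mk (homothety φ N) A

/-- The usual topology of `X^*_N`: the quotient of the topology induced from matrices. -/
abbrev usualTopology : TopologicalSpace (XStar φ N) :=
  TopologicalSpace.coinduced (proj φ N) inferInstance

/-- The perfect cone of a set `M` of lattice vectors: the nonzero matrices which are combinations
of the `q v`, `v ∈ M`, with nonnegative real coefficients. -/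
def perfectCone (M : Set (Fin N → 𝓞 F)) : Set (Matrix (Fin N) (Fin N) ℂ) :=
  {B | B ≠ 0 ∧ ∃ c : (Fin N → 𝓞 F) →₀ ℝ,
    (∀ v, 0 ≤ c v) ∧ (c.support : Set (Fin N → 𝓞 F)) ⊆ M ∧ B = c.sum fun v r => r • q φ N v}

/-- `σ(A) ⊆ X^*_N`: the image of the perfect cone of the set of minimal vectors of `A`. -/
def sigma (A : Matrix (Fin N) (Fin N) ℂ) : Set (XStar φ N) :=
  proj φ N '' {B | B.1 ∈ perfectCone φ N (minimalVectors φ N A)}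

/-- The closed cells of `X^*_N`: the sets `σ(A)`, `A` perfect, and their nonempty (finite)
intersections. -/
def closedCells : Set (Set (XStar φ N)) :=
  {τ | τ.Nonempty ∧ ∃ S : Set (Matrix (Fin N) (Fin N) ℂ), S.Finite ∧ S.Nonempty ∧
    (∀ A ∈ S, IsPerfect φ N A) ∧ τ = ⋂ A ∈ S, sigma φ N A}

/-- The CW topology of `X^*_N`: the weak topology with respect to the closed cells, where each
closed cell carries its usual topology. A set is closed iff its intersection with each closed cell
`τ` is closed in `τ`. -/
abbrev cwTopology : TopologicalSpace (XStar φ N) :=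
  ⨆ τ : closedCells φ N,
    TopologicalSpace.coinduced (Subtype.val : τ.1 → XStar φ N)
      (TopologicalSpace.induced Subtype.val (usualTopology φ N))

/-- `X^*_N` is endowed with the CW topology. -/
instance instTopologicalSpaceXStar : TopologicalSpace (XStar φ N) := cwTopology φ N

variable {N}

/-- `C(V)`: the elements of `C^*_N` with kernel the complex span of `V`. -/
def coneStratum (V : Submodule F (Fin N → F)) : Set (CStar φ N) :=
  {A | LinearMap.ker A.1.mulVecLin = complexSpan φ N V}

/-- `X(V) = π(C(V))`. -/
def stratum (V : Submodule F (Fin N → F)) : Set (XStar φ N) :=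
  proj φ N '' coneStratum φ V

/-- The image under `π` of the closure of `C(V)` in `C^*_N`, for the usual topology. -/
def closedStratum (V : Submodule F (Fin N → F)) : Set (XStar φ N) :=
  proj φ N '' closure (coneStratum φ V)

end

end VoronoiHermitian

/-! The combinatorics is that of the polyhedron `ryshkov` of Hermitian forms that are at least 1 on
nonzero lattice vectors. Dirichlet approximation shows that its points are positive definite
(`posDef_of_mem_ryshkov`), so only finitely many of its inequalities matter near each of them;
perfect forms play the role of its vertices. For A in it, every B in the cone on the q(v), v a
contact vector of A, is a matrix whose trace pairing is minimized over the polyhedron at A; if A'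
achieves the same value, B lies in the cone on the common contacts (`mem_coneHull_inter`). So
perfect cones meet along faces, and a finite intersection of them is the cone of the average form
(`exists_barycenter`).

The cones cover everything (`exists_isPerfect_mem_coneHull`). Let B have rational kernel V, let P be
the projection onto the orthogonal complement of V, and D an integral form with kernel that
complement. Replacing A by PAP + D preserves the pairing with B and makes the trace bounded in terms
of it, so the minimum is attained. Hahn-Banach puts B in the cone of the minimizer, and moving
through larger and larger contact sets ends at a perfect form.

Infinitely many perfect cones may meet at a boundary point, so the weak topology needs a finiteness
statement (`exists_finite_cover`). The values of perfect forms at one lattice vector form a locally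
finite set; by a Dickson-type argument their value vectors on a finite set T have finitely many
minimal elements, and the corresponding perfect cones already cover the cone on T.

Slices by trace 1 turn cells into polytopes, hence balls, and each point is in the relative interior
of exactly one cell, the smallest one containing it; this gives the CW structure. A closed stratum
is given by the condition that the kernel contains V, which passes to minimal cells, so it is a
subcomplex. It contracts along segments: those issued from one cell stay in a rational polyhedral
cone, hence in finitely many cells, where weak and usual continuity agree. On a stratum the trace
bound for PAP + D is locally uniform, so finitely many cells suffice near each point and the two
topologies coincide. -/

namespace VoronoiHermitian

open scoped ComplexOrder NumberField Matrix Topology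

noncomputable section

/-- The arithmetic properties of the ring of integers of an imaginary quadratic field, seen as a
subring of `ℂ`, on which the theory of perfect Hermitian forms rests: it is discrete, cocompact, and
stable under complex conjugation. -/
structure IsImaginaryLattice {F : Type*} [Field F] (φ : F →+* ℂ) : Prop where
  finite_le : ∀ C : ℝ, {x : 𝓞 F | ‖φ x‖ ≤ C}.Finite
  cobounded : ∃ C : ℝ, ∀ z : ℂ, ∃ x : 𝓞 F, ‖z - φ x‖ ≤ C
  conj : ∀ x : 𝓞 F, ∃ y : 𝓞 F, φ y = star (φ x)

/-! ### Integers of an imaginary quadratic field as a lattice in the complex plane -/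

section Field

variable {F : Type*} [Field F] [NumberField F]

/-- There is a single infinite place, so a bound on one embedding bounds all conjugates. -/
theorem finite_norm_le (hdeg : Module.finrank ℚ F = 2) (himag : NumberField.IsTotallyComplex F)
    (φ : F →+* ℂ) (C : ℝ) : {x : 𝓞 F | ‖φ x‖ ≤ C}.Finite := by
  have hcard : Fintype.card (NumberField.InfinitePlace F) = 1 := by
    have h1 := NumberField.IsTotallyComplex.finrank (K := F)
    have h2 := NumberField.IsTotallyComplex.nrRealPlaces_eq_zero (K := F)
    have h3 := NumberField.InfinitePlace.card_eq_nrRealPlaces_add_nrComplexPlaces F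
    omega
  have hsub : ∀ ψ : F →+* ℂ, ∀ x, ‖ψ x‖ = ‖φ x‖ := by
    intro ψ x
    have := (Fintype.card_le_one_iff.mp hcard.le) (NumberField.InfinitePlace.mk ψ)
      (NumberField.InfinitePlace.mk φ)
    rw [← NumberField.InfinitePlace.apply, ← NumberField.InfinitePlace.apply, this]
  have h := NumberField.Embeddings.finite_of_norm_le F ℂ C
  refine Set.Finite.of_finite_image (f := fun x : 𝓞 F => (x : F)) (h.subset ?_)
    (fun x _ y _ hxy => NumberField.RingOfIntegers.ext hxy)
  rintro _ ⟨x, hx, rfl⟩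
  exact ⟨x.isIntegral_coe, fun ψ => by rw [hsub ψ]; exact hx⟩

/-- A quadratic extension is normal, and the complex conjugate is another root of the same minimal
polynomial. -/
theorem exists_conj (hdeg : Module.finrank ℚ F = 2) (φ : F →+* ℂ) (x : 𝓞 F) :
    ∃ y : 𝓞 F, φ y = star (φ x) := by
  have : Algebra.IsQuadraticExtension ℚ F := ⟨hdeg⟩
  have hn : Normal ℚ F := inferInstance
  let σ : F →ₐ[ℚ] ℂ := φ.toRatAlgHom
  let τ : F →ₐ[ℚ] ℂ := ((starRingEnd ℂ).comp φ).toRatAlgHom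
  have hroot : (minpoly ℚ (x : F)).aeval (star (φ x)) = 0 := by
    change (minpoly ℚ (x : F)).aeval (τ x) = 0
    rw [Polynomial.aeval_algHom_apply, minpoly.aeval, map_zero]
  have hs := hn.splits (x : F)
  have h0 : (minpoly ℚ (x : F)).map (algebraMap ℚ F) ≠ 0 :=
    Polynomial.map_ne_zero (minpoly.ne_zero (hn.isIntegral _))
  obtain ⟨y, hy⟩ : ∃ y : F, φ y = star (φ x) := by
    have := hs.mem_range_of_isRoot (i := φ) h0 (x := star (φ x)) (by
      rw [Polynomial.IsRoot, Polynomial.eval_map, Polynomial.eval₂_map,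
        Subsingleton.elim (φ.comp (algebraMap ℚ F)) (algebraMap ℚ ℂ)]
      exact hroot)
    exact this
  have hint : IsIntegral ℤ (φ y) := by
    rw [hy]
    exact (x.isIntegral_coe.map φ.toIntAlgHom).map (starRingEnd ℂ).toIntAlgHom
  exact ⟨⟨y, (isIntegral_algHom_iff φ.toIntAlgHom φ.injective).1 hint⟩, hy⟩

theorem exists_norm_sub_le (himag : NumberField.IsTotallyComplex F) (φ : F →+* ℂ) :
    ∃ C : ℝ, ∀ z : ℂ, ∃ x : 𝓞 F, ‖z - φ x‖ ≤ C := by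
  obtain ⟨ω, hω⟩ : ∃ ω : 𝓞 F, (φ ω).im ≠ 0 := by
    by_contra! hreal
    refine NumberField.IsTotallyComplex.complexEmbedding_not_isReal φ ?_
    rw [NumberField.ComplexEmbedding.isReal_iff]
    ext a
    obtain ⟨x, y, -, rfl⟩ := IsFractionRing.div_surjective (A := 𝓞 F) a
    have hx := Complex.conj_eq_iff_im.2 (hreal x)
    have hy := Complex.conj_eq_iff_im.2 (hreal y)
    change starRingEnd ℂ (φ (x / y)) = φ (x / y)
    rw [map_div₀, map_div₀, hx, hy]
  -- 1 and ω form a real basis of the plane; rounding down both coordinates leaves a point of the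
  -- fundamental parallelogram.
  refine ⟨1 + ‖φ ω‖, fun z => ?_⟩
  set t : ℝ := z.im / (φ ω).im with ht
  set s : ℝ := z.re - t * (φ ω).re with hs
  refine ⟨(⌊s⌋ : 𝓞 F) + (⌊t⌋ : 𝓞 F) * ω, ?_⟩
  have hz : z - φ (((⌊s⌋ : 𝓞 F) + (⌊t⌋ : 𝓞 F) * ω : 𝓞 F) : F) =
      ((Int.fract s : ℝ) : ℂ) + ((Int.fract t : ℝ) : ℂ) * φ ω := by
    have : z = s + t * φ ω := by
      apply Complex.ext
      · simp [hs]
      · simp [ht, hω]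
    nth_rewrite 1 [this]
    simp only [map_add, map_mul, map_intCast, Int.fract, Complex.ofReal_sub, Complex.ofReal_intCast]
    ring
  rw [hz]
  refine (norm_add_le _ _).trans (add_le_add ?_ ?_)
  · rw [Complex.norm_real, Real.norm_of_nonneg (Int.fract_nonneg _)]
    exact (Int.fract_lt_one _).le
  · rw [norm_mul, Complex.norm_real, Real.norm_of_nonneg (Int.fract_nonneg _)]
    exact mul_le_of_le_one_left (norm_nonneg _) (Int.fract_lt_one _).le

theorem isImaginaryLattice (hdeg : Module.finrank ℚ F = 2)
    (himag : NumberField.IsTotallyComplex F) (φ : F →+* ℂ) : IsImaginaryLattice φ where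
  finite_le := finite_norm_le hdeg himag φ
  cobounded := exists_norm_sub_le himag φ
  conj := exists_conj hdeg φ

end Field

theorem IsImaginaryLattice.one_le_norm {F : Type*} [Field F] {φ : F →+* ℂ}
    (h : IsImaginaryLattice φ) {x : 𝓞 F} (hx : x ≠ 0) : 1 ≤ ‖φ x‖ := by
  by_contra! hlt
  have hx0 : φ x ≠ 0 := by
    simpa using hx
  have hpos : 0 < ‖φ x‖ := norm_pos_iff.2 hx0
  -- The powers of a nonzero x with absolute value below 1 would be infinitely many integers in the
  -- unit disc.
  refine (Set.infinite_of_injective_forall_mem (f := fun n : ℕ => x ^ n) ?_ ?_) (h.finite_le 1)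
  · intro m n hmn
    have : ‖φ x‖ ^ m = ‖φ x‖ ^ n := by
      have := congrArg (fun y : 𝓞 F => ‖φ y‖) hmn
      simpa using this
    exact pow_right_injective₀ hpos hlt.ne this
  · intro n
    simpa using pow_le_one₀ hpos.le hlt.le

/-! ### Hermitian forms and the trace pairing -/

section HermitianForms

variable {N : ℕ}

/-- The value `x^* A x` of a form at a complex vector. -/
def val (A : Matrix (Fin N) (Fin N) ℂ) (x : Fin N → ℂ) : ℝ :=
  (star x ⬝ᵥ A *ᵥ x).re

/-- The trace pairing `(A, B) ↦ Re tr (A B)`. -/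
def pairing : Matrix (Fin N) (Fin N) ℂ →ₗ[ℝ] Matrix (Fin N) (Fin N) ℂ →ₗ[ℝ] ℝ :=
  LinearMap.mk₂ ℝ (fun A B => (A * B).trace.re)
    (by intros; simp [add_mul]) (by intros; simp) (by intros; simp [mul_add]) (by intros; simp)

theorem pairing_apply (A B : Matrix (Fin N) (Fin N) ℂ) : pairing A B = (A * B).trace.re := rfl

theorem pairing_comm (A B : Matrix (Fin N) (Fin N) ℂ) : pairing A B = pairing B A := by
  rw [pairing_apply, pairing_apply, Matrix.trace_mul_comm]

theorem pairing_vecMulVec (A : Matrix (Fin N) (Fin N) ℂ) (x : Fin N → ℂ) :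
    pairing A (Matrix.vecMulVec x (star x)) = val A x := by
  rw [pairing_apply, Matrix.mul_vecMulVec, Matrix.trace_vecMulVec, dotProduct_comm, val]

theorem val_eq_pairing (A : Matrix (Fin N) (Fin N) ℂ) (x : Fin N → ℂ) :
    val A x = pairing A (Matrix.vecMulVec x (star x)) := (pairing_vecMulVec A x).symm

theorem val_add (A B : Matrix (Fin N) (Fin N) ℂ) (x : Fin N → ℂ) :
    val (A + B) x = val A x + val B x := by
  simp [val_eq_pairing]

theorem val_sub (A B : Matrix (Fin N) (Fin N) ℂ) (x : Fin N → ℂ) :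
    val (A - B) x = val A x - val B x := by
  simp [val_eq_pairing]

theorem val_neg (A : Matrix (Fin N) (Fin N) ℂ) (x : Fin N → ℂ) : val (-A) x = -val A x := by
  simp [val_eq_pairing]

theorem val_smul (t : ℝ) (A : Matrix (Fin N) (Fin N) ℂ) (x : Fin N → ℂ) :
    val (t • A) x = t * val A x := by
  simp [val_eq_pairing]

theorem val_zero_right (A : Matrix (Fin N) (Fin N) ℂ) : val A 0 = 0 := by
  simp [val]

theorem val_smul_right (A : Matrix (Fin N) (Fin N) ℂ) (t : ℝ) (x : Fin N → ℂ) :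
    val A (t • x) = t ^ 2 * val A x := by
  have : star (t • x) = t • star x := by ext; simp
  rw [val, val, this, Matrix.mulVec_smul, smul_dotProduct, dotProduct_smul, smul_smul,
    Complex.smul_re, smul_eq_mul, sq]

theorem val_conj (A U : Matrix (Fin N) (Fin N) ℂ) (x : Fin N → ℂ) :
    val (Uᴴ * A * U) x = val A (U *ᵥ x) := by
  rw [val, val, Matrix.star_mulVec, ← Matrix.dotProduct_mulVec, Matrix.mulVec_mulVec,
    Matrix.mulVec_mulVec, mul_assoc]

theorem val_vecMulVec (s x : Fin N → ℂ) :
    val (Matrix.vecMulVec s (star s)) x = ‖star s ⬝ᵥ x‖ ^ 2 := by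
  have h : star x ⬝ᵥ s = star (star s ⬝ᵥ x) := by
    rw [Matrix.star_dotProduct]
  rw [val, Matrix.vecMulVec_mulVec, dotProduct_smul, h, op_smul_eq_mul,
    mul_comm, Complex.star_def, Complex.mul_conj, Complex.normSq_eq_norm_sq, Complex.ofReal_re]

theorem continuous_val :
    Continuous fun p : Matrix (Fin N) (Fin N) ℂ × (Fin N → ℂ) => val p.1 p.2 := by
  unfold val
  fun_prop

theorem continuous_pairing (A : Matrix (Fin N) (Fin N) ℂ) : Continuous (pairing A) := by
  change Continuous fun B => (A * B).trace.re
  fun_prop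

theorem posSemidef_iff_val {A : Matrix (Fin N) (Fin N) ℂ} (hA : A.IsHermitian) :
    A.PosSemidef ↔ ∀ x, 0 ≤ val A x := by
  refine ⟨fun h x => (Complex.le_def.1 (h.dotProduct_mulVec_nonneg x)).1, fun h =>
    .of_dotProduct_mulVec_nonneg hA fun x => Complex.le_def.2 ⟨h x, ?_⟩⟩
  have := hA.im_star_dotProduct_mulVec_self x
  exact this.symm

theorem posDef_iff_val {A : Matrix (Fin N) (Fin N) ℂ} (hA : A.IsHermitian) :
    A.PosDef ↔ ∀ x, x ≠ 0 → 0 < val A x := by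
  refine ⟨fun h x hx => (Complex.lt_def.1 (h.dotProduct_mulVec_pos hx)).1, fun h =>
    .of_dotProduct_mulVec_pos hA fun x hx => Complex.lt_def.2 ⟨h x hx, ?_⟩⟩
  have := hA.im_star_dotProduct_mulVec_self x
  exact this.symm

theorem mulVec_eq_zero_of_val_eq_zero {A : Matrix (Fin N) (Fin N) ℂ} (hA : A.PosSemidef)
    {x : Fin N → ℂ} (hx : val A x = 0) : A *ᵥ x = 0 := by
  rw [← hA.dotProduct_mulVec_zero_iff]
  exact Complex.ext hx (hA.1.im_star_dotProduct_mulVec_self x)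

theorem val_eq_zero_of_mulVec_eq_zero {A : Matrix (Fin N) (Fin N) ℂ} {x : Fin N → ℂ}
    (hx : A *ᵥ x = 0) : val A x = 0 := by
  rw [val, hx, dotProduct_zero, Complex.zero_re]

theorem val_add_of_mulVec_eq_zero {A : Matrix (Fin N) (Fin N) ℂ} (hA : A.IsHermitian)
    {z : Fin N → ℂ} (hz : A *ᵥ z = 0) (x : Fin N → ℂ) : val A (z + x) = val A x := by
  have hz' : star z ⬝ᵥ A *ᵥ x = 0 := by
    rw [Matrix.dotProduct_mulVec, ← hA.eq, ← Matrix.star_mulVec, hz, star_zero, zero_dotProduct]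
  rw [val, val, Matrix.mulVec_add, hz, zero_add, star_add, add_dotProduct, hz', zero_add]

theorem eq_zero_of_val_eq_zero {A : Matrix (Fin N) (Fin N) ℂ} (hA : A.IsHermitian)
    (h : ∀ x, val A x = 0) : A = 0 := by
  have hp : A.PosSemidef := (posSemidef_iff_val hA).2 fun x => (h x).ge
  refine Matrix.ext_of_mulVec_single fun i => ?_
  rw [mulVec_eq_zero_of_val_eq_zero hp (h _), Matrix.zero_mulVec]

/-- The norm on vectors is the sup norm, whence the factor counting the N² entries. -/
theorem abs_val_le {A : Matrix (Fin N) (Fin N) ℂ} {B : ℝ} (hB : ∀ i j, ‖A i j‖ ≤ B)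
    (x : Fin N → ℂ) : |val A x| ≤ (N : ℝ) ^ 2 * B * ‖x‖ ^ 2 := by
  have h : ‖star x ⬝ᵥ A *ᵥ x‖ ≤ ∑ _i : Fin N, ∑ _j : Fin N, ‖x‖ * (B * ‖x‖) := by
    rw [dotProduct]
    refine (norm_sum_le _ _).trans (Finset.sum_le_sum fun i _ => ?_)
    rw [Matrix.mulVec, dotProduct, Finset.mul_sum]
    refine (norm_sum_le _ _).trans (Finset.sum_le_sum fun j _ => ?_)
    rw [norm_mul, norm_mul, Pi.star_apply, norm_star]
    have := hB i j
    have := norm_le_pi_norm x i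
    have := norm_le_pi_norm x j
    have : 0 ≤ B := (norm_nonneg _).trans (hB i j)
    gcongr
  refine (Complex.abs_re_le_norm _).trans (h.trans (le_of_eq ?_))
  simp
  ring

theorem exists_abs_val_le (A : Matrix (Fin N) (Fin N) ℂ) :
    ∃ β : ℝ, 0 < β ∧ ∀ x, |val A x| ≤ β * ‖x‖ ^ 2 := by
  have hB : ∀ i j, ‖A i j‖ ≤ ∑ i, ∑ j, ‖A i j‖ := fun i j =>
    (Finset.single_le_sum (f := fun j => ‖A i j‖) (fun _ _ => norm_nonneg _)
      (Finset.mem_univ j)).trans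
    (Finset.single_le_sum (f := fun i => ∑ j, ‖A i j‖)
      (fun _ _ => Finset.sum_nonneg fun _ _ => norm_nonneg _) (Finset.mem_univ i))
  refine ⟨(N : ℝ) ^ 2 * (∑ i, ∑ j, ‖A i j‖) + 1, by positivity, fun x => ?_⟩
  refine (abs_val_le hB x).trans ?_
  gcongr
  linarith

theorem exists_le_val_of_isCompact {K : Set (Matrix (Fin N) (Fin N) ℂ)} (hK : IsCompact K)
    (hpos : ∀ A ∈ K, A.PosDef) : ∃ α : ℝ, 0 < α ∧ ∀ A ∈ K, ∀ x, α * ‖x‖ ^ 2 ≤ val A x := by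
  have hcomp := hK.prod (isCompact_sphere (0 : Fin N → ℂ) 1)
  rcases (K ×ˢ Metric.sphere (0 : Fin N → ℂ) 1).eq_empty_or_nonempty with he | hne
  · refine ⟨1, one_pos, fun A hA x => ?_⟩
    have hx : x = 0 := by
      by_contra hx
      have : (A, (‖x‖⁻¹ : ℝ) • x) ∈ K ×ˢ Metric.sphere (0 : Fin N → ℂ) 1 :=
        ⟨hA, by simp [norm_smul, hx]⟩
      rw [he] at this
      exact this
    simp [hx, val_zero_right]
  · obtain ⟨⟨A₀, x₀⟩, ⟨hA₀, hx₀⟩, hmin⟩ := hcomp.exists_isMinOn hne continuous_val.continuousOn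
    refine ⟨val A₀ x₀, ?_, fun A hA x => ?_⟩
    · refine (posDef_iff_val (hpos A₀ hA₀).1).1 (hpos A₀ hA₀) x₀ ?_
      rintro rfl
      simp at hx₀
    · rcases eq_or_ne x 0 with rfl | hx
      · simp [val_zero_right]
      have hn : 0 < ‖x‖ := norm_pos_iff.2 hx
      have h1 : val A₀ x₀ ≤ val A ((‖x‖⁻¹ : ℝ) • x) :=
        hmin (show (A, (‖x‖⁻¹ : ℝ) • x) ∈ _ from ⟨hA, by simp [norm_smul, hx]⟩)
      rw [val_smul_right, inv_pow, inv_mul_eq_div, le_div_iff₀ (by positivity)] at h1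
      exact h1

theorem exists_le_val {A : Matrix (Fin N) (Fin N) ℂ} (hA : A.PosDef) :
    ∃ α : ℝ, 0 < α ∧ ∀ x, α * ‖x‖ ^ 2 ≤ val A x := by
  obtain ⟨α, hα, h⟩ := exists_le_val_of_isCompact (isCompact_singleton (x := A)) (by simpa using hA)
  exact ⟨α, hα, h A rfl⟩

/-- This is nonnegativity of a 2 by 2 principal minor. -/
theorem norm_apply_sq_le {A : Matrix (Fin N) (Fin N) ℂ} (hA : A.PosSemidef) (i j : Fin N) :
    ‖A i j‖ ^ 2 ≤ (A i i).re * (A j j).re := by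
  have hdet := (hA.submatrix ![i, j]).det_nonneg
  rw [Matrix.det_fin_two] at hdet
  simp only [Matrix.submatrix_apply, Matrix.cons_val_zero, Matrix.cons_val_one] at hdet
  have hji : A j i = star (A i j) := (hA.1.apply j i).symm
  have hre : ∀ k, A k k = ((A k k).re : ℂ) := fun k => (hA.1.coe_re_apply_self k).symm
  rw [hji, Complex.star_def, Complex.mul_conj, Complex.normSq_eq_norm_sq, hre i, hre j] at hdet
  exact_mod_cast sub_nonneg.1 hdet

theorem norm_apply_le_trace {A : Matrix (Fin N) (Fin N) ℂ} (hA : A.PosSemidef) (i j : Fin N) :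
    ‖A i j‖ ≤ A.trace.re := by
  have hdiag : ∀ k, 0 ≤ (A k k).re := fun k => (Complex.le_def.1 hA.diag_nonneg).1
  have hle : ∀ k, (A k k).re ≤ A.trace.re := fun k => by
    rw [Matrix.trace, Complex.re_sum]
    exact Finset.single_le_sum (f := fun k => (A.diag k).re) (fun k _ => hdiag k)
      (Finset.mem_univ k)
  have h0 : 0 ≤ A.trace.re := (hdiag i).trans (hle i)
  refine abs_le_of_sq_le_sq' ?_ h0 |>.2
  calc ‖A i j‖ ^ 2 ≤ (A i i).re * (A j j).re := norm_apply_sq_le hA i j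
    _ ≤ A.trace.re * A.trace.re := mul_le_mul (hle i) (hle j) (hdiag j) h0
    _ = _ := (sq _).symm

open scoped MatrixOrder in
theorem exists_eq_conjTranspose_mul_self {A : Matrix (Fin N) (Fin N) ℂ}
    (hA : A.PosSemidef) : ∃ B : Matrix (Fin N) (Fin N) ℂ, A = Bᴴ * B :=
  CStarAlgebra.nonneg_iff_eq_star_mul_self.mp hA.nonneg

theorem pairing_nonneg {A B : Matrix (Fin N) (Fin N) ℂ} (hA : A.PosSemidef) (hB : B.PosSemidef) :
    0 ≤ pairing A B := by
  obtain ⟨C, rfl⟩ := exists_eq_conjTranspose_mul_self hB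
  have := (hA.mul_mul_conjTranspose_same C).trace_nonneg
  rw [pairing_apply, ← mul_assoc, Matrix.trace_mul_comm, ← mul_assoc]
  exact (Complex.le_def.1 this).1

/-- The pairing is nondegenerate because Re tr(R R*) vanishes only at R = 0, so every functional is
represented; on Hermitian arguments the representing matrix may be replaced by its Hermitian part.
-/
theorem exists_isHermitian_pairing_eq (f : Matrix (Fin N) (Fin N) ℂ →ₗ[ℝ] ℝ) :
    ∃ R : Matrix (Fin N) (Fin N) ℂ, R.IsHermitian ∧ ∀ X, X.IsHermitian → f X = pairing R X := by
  have hinj : Function.Injective (pairing (N := N)) := by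
    rw [← LinearMap.ker_eq_bot, LinearMap.ker_eq_bot']
    intro R hR
    have h : pairing R Rᴴ = 0 := by rw [hR]; rfl
    rw [pairing_apply] at h
    have h2 := (Matrix.posSemidef_self_mul_conjTranspose R).trace_nonneg
    rw [← Matrix.trace_mul_conjTranspose_self_eq_zero_iff]
    exact Complex.ext h (Complex.le_def.1 h2).2.symm
  have hsurj : Function.Surjective (pairing (N := N)) :=
    (LinearMap.injective_iff_surjective_of_finrank_eq_finrank
      (Subspace.dual_finrank_eq (K := ℝ) (V := Matrix (Fin N) (Fin N) ℂ)).symm).1 hinj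
  obtain ⟨R, rfl⟩ := hsurj f
  refine ⟨(2⁻¹ : ℝ) • (R + Rᴴ), ?_, fun X hX => ?_⟩
  · rw [Matrix.IsHermitian, Matrix.conjTranspose_smul, Matrix.conjTranspose_add,
      Matrix.conjTranspose_conjTranspose, add_comm Rᴴ, star_trivial]
  · have : pairing Rᴴ X = pairing R X := by
      rw [pairing_apply, pairing_apply, Matrix.trace_mul_comm]
      nth_rewrite 1 [← hX.eq]
      rw [← Matrix.conjTranspose_mul, Matrix.trace_conjTranspose]
      rfl
    rw [map_smul, map_add, LinearMap.smul_apply, LinearMap.add_apply, this, smul_eq_mul]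
    ring

end HermitianForms

/-! ### The Ryshkov polyhedron -/

section Lattice

variable {F : Type*} [Field F] {φ : F →+* ℂ} {N : ℕ}

theorem embInt_apply (x : Fin N → 𝓞 F) (i : Fin N) : embInt φ N x i = φ (x i) := rfl

theorem embInt_zero : embInt φ N 0 = 0 := by
  ext i
  simp [embInt_apply]

theorem embInt_sub (x y : Fin N → 𝓞 F) : embInt φ N (x - y) = embInt φ N x - embInt φ N y := by
  ext i
  simp [embInt_apply]

theorem embInt_nsmul (n : ℕ) (x : Fin N → 𝓞 F) :
    embInt φ N (n • x) = (n : ℝ) • embInt φ N x := by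
  ext i
  simp [embInt_apply]

theorem embInt_injective : Function.Injective (embInt φ N) := fun x y h => by
  ext i
  exact φ.injective (congrFun h i)

theorem embInt_ne_zero {x : Fin N → 𝓞 F} (hx : x ≠ 0) : embInt φ N x ≠ 0 :=
  fun h => hx (embInt_injective (h.trans embInt_zero.symm))

theorem formValue_eq_val (A : Matrix (Fin N) (Fin N) ℂ) (x : Fin N → 𝓞 F) :
    formValue φ N A x = val A (embInt φ N x) := rfl

theorem pairing_q (A : Matrix (Fin N) (Fin N) ℂ) (x : Fin N → 𝓞 F) :
    pairing A (q φ N x) = formValue φ N A x := pairing_vecMulVec A _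

theorem isHermitian_vecMulVec_star (x : Fin N → ℂ) :
    (Matrix.vecMulVec x (star x)).IsHermitian := (Matrix.posSemidef_vecMulVec_self_star x).1

theorem posSemidef_q (x : Fin N → 𝓞 F) : (q φ N x).PosSemidef :=
  Matrix.posSemidef_vecMulVec_self_star _

theorem exists_norm_sub_embInt_le (h : IsImaginaryLattice φ) (N : ℕ) :
    ∃ C : ℝ, ∀ z : Fin N → ℂ, ∃ x : Fin N → 𝓞 F, ‖z - embInt φ N x‖ ≤ C := by
  obtain ⟨C, hC⟩ := h.cobounded
  have hC0 : 0 ≤ C := (norm_nonneg _).trans (hC 0).choose_spec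
  refine ⟨C, fun z => ?_⟩
  choose x hx using fun i => hC (z i)
  exact ⟨x, (pi_norm_le_iff_of_nonneg hC0).2 hx⟩

theorem finite_norm_embInt_le (h : IsImaginaryLattice φ) (C : ℝ) :
    {x : Fin N → 𝓞 F | ‖embInt φ N x‖ ≤ C}.Finite := by
  refine (Set.Finite.pi fun _ : Fin N => h.finite_le C).subset fun x hx i _ => ?_
  exact (norm_le_pi_norm (embInt φ N x) i).trans hx

/-- Simultaneous Diophantine approximation by lattice vectors. -/
theorem exists_nsmul_approx (h : IsImaginaryLattice φ) (N : ℕ) {ε : ℝ} (hε : 0 < ε) :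
    ∃ K : ℕ, ∀ z : Fin N → ℂ, ∃ j : ℕ, 1 ≤ j ∧ j ≤ K ∧ ∃ c : Fin N → 𝓞 F,
      ‖(j : ℝ) • z - embInt φ N c‖ < ε := by
  obtain ⟨C, hC⟩ := exists_norm_sub_embInt_le h N
  obtain ⟨t, -, htfin, ht⟩ := Metric.totallyBounded_iff.1
    (isCompact_closedBall (0 : Fin N → ℂ) C).totallyBounded (ε / 2) (half_pos hε) |>.imp
      fun t ht => (⟨trivial, ht⟩ : True ∧ _)
  -- Pigeonhole on the remainders of 0, z, 2z, … modulo the lattice: they lie in a fixed ball,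
  -- covered by this many balls of radius ε/2. The bound does not depend on z.
  refine ⟨htfin.toFinset.card, fun z => ?_⟩
  choose c hc using fun j : ℕ => hC ((j : ℝ) • z)
  have hmem : ∀ j : ℕ, ∃ y ∈ htfin.toFinset, (j : ℝ) • z - embInt φ N (c j) ∈
      Metric.ball y (ε / 2) := by
    intro j
    have := ht (show (j : ℝ) • z - embInt φ N (c j) ∈ _ from mem_closedBall_zero_iff.2 (hc j))
    simpa using this
  choose y hy hyb using hmem
  have key : ∀ j k : ℕ, j < k → k ≤ htfin.toFinset.card → y j = y k →
      ∃ j : ℕ, 1 ≤ j ∧ j ≤ htfin.toFinset.card ∧ ∃ c : Fin N → 𝓞 F,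
      ‖(j : ℝ) • z - embInt φ N c‖ < ε := by
    intro j k hjk hk hy
    refine ⟨k - j, by omega, by omega, c k - c j, ?_⟩
    have h1 := hyb j
    have h2 := hyb k
    rw [hy] at h1
    have h3 := dist_triangle_right ((k : ℝ) • z - embInt φ N (c k))
      ((j : ℝ) • z - embInt φ N (c j)) (y k)
    rw [dist_eq_norm] at h3
    rw [Nat.cast_sub hjk.le, embInt_sub, sub_smul, sub_sub_sub_comm]
    rw [Metric.mem_ball] at h1 h2
    linarith
  obtain ⟨j, hj, k, hk, hne, hyjk⟩ := Finset.exists_ne_map_eq_of_card_lt_of_maps_to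
    (s := Finset.range (htfin.toFinset.card + 1)) (t := htfin.toFinset) (by simp)
    (f := y) (fun j _ => hy j)
  rw [Finset.mem_range] at hj hk
  rcases lt_or_gt_of_ne hne with hlt | hlt
  · exact key j k hlt (by omega) hyjk
  · exact key k j hlt (by omega) hyjk.symm

/-- Quotients of lattice vectors by positive integers are dense, and forms are continuous and
homogeneous. -/
theorem val_nonneg_of_formValue_nonneg (h : IsImaginaryLattice φ)
    {A : Matrix (Fin N) (Fin N) ℂ} (hA : ∀ x, 0 ≤ formValue φ N A x) (z : Fin N → ℂ) :
    0 ≤ val A z := by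
  obtain ⟨C, hC⟩ := exists_norm_sub_embInt_le h N
  choose c hc using fun j : ℕ => hC (((j : ℝ) + 1) • z)
  set w : ℕ → Fin N → ℂ := fun j => ((j : ℝ) + 1)⁻¹ • embInt φ N (c j) with hw
  have hlim : Filter.Tendsto w Filter.atTop (nhds z) := by
    rw [tendsto_iff_norm_sub_tendsto_zero]
    have h0 : Filter.Tendsto (fun j : ℕ => C * (1 / ((j : ℝ) + 1))) Filter.atTop (nhds 0) := by
      simpa using tendsto_one_div_add_atTop_nhds_zero_nat.const_mul C
    refine squeeze_zero (fun _ => norm_nonneg _) (fun j => ?_) h0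
    have hj : (0 : ℝ) < (j : ℝ) + 1 := by positivity
    have : w j - z = -(((j : ℝ) + 1)⁻¹ • (((j : ℝ) + 1) • z - embInt φ N (c j))) := by
      rw [smul_sub, smul_smul, inv_mul_cancel₀ hj.ne', one_smul, neg_sub]
    rw [this, norm_neg, norm_smul, Real.norm_of_nonneg (by positivity), mul_comm, one_div]
    exact mul_le_mul_of_nonneg_right (hc j) (by positivity)
  have hcont : Continuous (val A) := continuous_val.comp (Continuous.prodMk_right A)
  refine ge_of_tendsto' ((hcont.tendsto z).comp hlim) fun j => ?_
  change 0 ≤ val A (((j : ℝ) + 1)⁻¹ • embInt φ N (c j))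
  rw [val_smul_right]
  exact mul_nonneg (sq_nonneg _) (hA (c j))

variable (φ N) in
/-- The Ryshkov polyhedron: Hermitian forms which are at least `1` on nonzero lattice vectors. -/
def ryshkov : Set (Matrix (Fin N) (Fin N) ℂ) :=
  {A | A.IsHermitian ∧ ∀ x : Fin N → 𝓞 F, x ≠ 0 → 1 ≤ formValue φ N A x}

variable (φ N) in
/-- The nonzero lattice vectors where a form takes the value `1`. -/
def contacts (A : Matrix (Fin N) (Fin N) ℂ) : Set (Fin N → 𝓞 F) :=
  {x | x ≠ 0 ∧ formValue φ N A x = 1}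

theorem posSemidef_of_mem_ryshkov (h : IsImaginaryLattice φ) {A : Matrix (Fin N) (Fin N) ℂ}
    (hA : A ∈ ryshkov φ N) : A.PosSemidef := by
  refine (posSemidef_iff_val hA.1).2 (val_nonneg_of_formValue_nonneg h fun x => ?_)
  rcases eq_or_ne x 0 with rfl | hx
  · rw [formValue_eq_val, embInt_zero, val_zero_right]
  · exact zero_le_one.trans (hA.2 x hx)

/-- Some multiple of a kernel vector is very close to a nonzero lattice vector; adding a kernel
vector does not change the form, so that lattice vector would have a value below 1. -/
theorem posDef_of_mem_ryshkov (h : IsImaginaryLattice φ) {A : Matrix (Fin N) (Fin N) ℂ}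
    (hA : A ∈ ryshkov φ N) : A.PosDef := by
  have hpsd := posSemidef_of_mem_ryshkov h hA
  refine (posDef_iff_val hA.1).2 fun z hz => lt_of_le_of_ne ((posSemidef_iff_val hA.1).1 hpsd z) ?_
  intro h0
  have hAz := mulVec_eq_zero_of_val_eq_zero hpsd h0.symm
  obtain ⟨β, hβ, hβA⟩ := exists_abs_val_le A
  -- The bound by 1 keeps the approximating lattice vector nonzero, as the approximated multiple has
  -- norm at least 1; the two bounds together make the value of A at the error at most 1/2.
  set ε : ℝ := min 1 (2 * β)⁻¹ with hε
  have hεpos : 0 < ε := lt_min one_pos (by positivity)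
  obtain ⟨K, hK⟩ := exists_nsmul_approx h N hεpos
  obtain ⟨j, hj, -, c, hc⟩ := hK (‖z‖⁻¹ • z)
  have hc0 : c ≠ 0 := by
    rintro rfl
    rw [embInt_zero, sub_zero, norm_smul, norm_smul, norm_inv, norm_norm,
      inv_mul_cancel₀ (norm_ne_zero_iff.2 hz), mul_one, Real.norm_natCast] at hc
    have : (1 : ℝ) ≤ j := by exact_mod_cast hj
    have := min_le_left 1 (2 * β)⁻¹
    linarith
  set r := (j : ℝ) • ‖z‖⁻¹ • z - embInt φ N c with hr
  have h1 := hA.2 c hc0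
  have h2 : embInt φ N c = (j : ℝ) • ‖z‖⁻¹ • z + -r := by rw [hr]; abel
  rw [formValue_eq_val, h2, val_add_of_mulVec_eq_zero hA.1
    (by rw [Matrix.mulVec_smul, Matrix.mulVec_smul, hAz, smul_zero, smul_zero])] at h1
  have h3 := (le_abs_self _).trans (hβA (-r))
  rw [norm_neg] at h3
  have h4 : ‖r‖ ^ 2 ≤ (2 * β)⁻¹ := by
    calc ‖r‖ ^ 2 = ‖r‖ * ‖r‖ := sq _
      _ ≤ 1 * (2 * β)⁻¹ := mul_le_mul (hc.le.trans (min_le_left _ _))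
          (hc.le.trans (min_le_right _ _)) (norm_nonneg _) zero_le_one
      _ = _ := one_mul _
  have h5 : β * ‖r‖ ^ 2 ≤ β * (2 * β)⁻¹ := mul_le_mul_of_nonneg_left h4 hβ.le
  have h6 : β * (2 * β)⁻¹ = 1 / 2 := by field_simp
  linarith

theorem continuous_formValue (x : Fin N → 𝓞 F) : Continuous fun A => formValue φ N A x :=
  continuous_val.comp (Continuous.prodMk_left _)

theorem isClosed_isHermitian : IsClosed {A : Matrix (Fin N) (Fin N) ℂ | A.IsHermitian} :=
  isClosed_eq (by fun_prop) continuous_id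

theorem isClosed_ryshkov : IsClosed (ryshkov φ N) := by
  have : ryshkov φ N = {A | A.IsHermitian} ∩
      ⋂ x : Fin N → 𝓞 F, ⋂ _ : x ≠ 0, {A | 1 ≤ formValue φ N A x} := by
    ext A
    simp [ryshkov]
  rw [this]
  exact isClosed_isHermitian.inter (isClosed_iInter fun x => isClosed_iInter fun _ =>
    isClosed_le continuous_const (continuous_formValue x))

theorem isCompact_of_isClosed_of_norm_apply_le {S : Set (Matrix (Fin N) (Fin N) ℂ)}
    (hS : IsClosed S) {C : ℝ} (hC : ∀ A ∈ S, ∀ i j, ‖A i j‖ ≤ C) : IsCompact S := by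
  have hK : IsCompact (Set.univ.pi fun _ : Fin N => Set.univ.pi fun _ : Fin N =>
      Metric.closedBall (0 : ℂ) C) :=
    isCompact_univ_pi fun _ => isCompact_univ_pi fun _ => isCompact_closedBall _ _
  refine IsCompact.of_isClosed_subset hK hS fun A hA i _ j _ => ?_
  simpa using hC A hA i j

theorem isCompact_ryshkov_trace_le (h : IsImaginaryLattice φ) (C : ℝ) :
    IsCompact {A | A ∈ ryshkov φ N ∧ A.trace.re ≤ C} := by
  refine isCompact_of_isClosed_of_norm_apply_le (C := C) ?_ fun A hA i j =>
    (norm_apply_le_trace (posSemidef_of_mem_ryshkov h hA.1) i j).trans hA.2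
  exact isClosed_ryshkov.inter (isClosed_le
    (Complex.continuous_re.comp (Continuous.matrix_trace continuous_id)) continuous_const)

theorem exists_le_val_of_trace_le (h : IsImaginaryLattice φ) (N : ℕ) (C : ℝ) :
    ∃ α : ℝ, 0 < α ∧ ∀ A ∈ ryshkov φ N, A.trace.re ≤ C → ∀ x, α * ‖x‖ ^ 2 ≤ val A x := by
  obtain ⟨α, hα, H⟩ := exists_le_val_of_isCompact (isCompact_ryshkov_trace_le h C (N := N))
    fun A hA => posDef_of_mem_ryshkov h hA.1
  exact ⟨α, hα, fun A hA hC => H A ⟨hA, hC⟩⟩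

theorem finite_formValue_le (h : IsImaginaryLattice φ) {A : Matrix (Fin N) (Fin N) ℂ}
    (hA : A.PosDef) (C : ℝ) : {x | formValue φ N A x ≤ C}.Finite := by
  obtain ⟨α, hα, H⟩ := exists_le_val hA
  -- A norm exceeding both 1 and C/α has its square exceeding C/α.
  refine (finite_norm_embInt_le h (max 1 (C / α))).subset fun x hx => ?_
  have h1 : ‖embInt φ N x‖ ^ 2 ≤ C / α := by
    rw [le_div_iff₀ hα, mul_comm]
    exact (H _).trans hx
  by_contra hlt
  rw [Set.mem_ofPred_eq, not_le] at hlt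
  have h2 : 1 < ‖embInt φ N x‖ := (le_max_left _ _).trans_lt hlt
  have h3 : C / α < ‖embInt φ N x‖ := (le_max_right _ _).trans_lt hlt
  nlinarith

theorem finite_contacts (h : IsImaginaryLattice φ) {A : Matrix (Fin N) (Fin N) ℂ}
    (hA : A ∈ ryshkov φ N) : (contacts φ N A).Finite :=
  (finite_formValue_le h (posDef_of_mem_ryshkov h hA) 1).subset fun _ hx => hx.2.le

/-- Small perturbations which are nonnegative on the contact vectors stay in the Ryshkov
polyhedron. -/
theorem exists_add_smul_mem_ryshkov (h : IsImaginaryLattice φ) {A R : Matrix (Fin N) (Fin N) ℂ}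
    (hA : A ∈ ryshkov φ N) (hR : R.IsHermitian)
    (hRA : ∀ x ∈ contacts φ N A, 0 ≤ formValue φ N R x) :
    ∃ ε : ℝ, 0 < ε ∧ A + ε • R ∈ ryshkov φ N := by
  obtain ⟨α, hα, hαA⟩ := exists_le_val (posDef_of_mem_ryshkov h hA)
  obtain ⟨β, hβ, hβR⟩ := exists_abs_val_le R
  -- The finitely many vectors of value at most 2 are treated one by one. On the others, a small ε
  -- changes A[x] by at most half of it, which leaves more than 1.
  have hfin := finite_formValue_le h (posDef_of_mem_ryshkov h hA) 2
  have hsmall : ∀ x : Fin N → 𝓞 F, x ≠ 0 →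
      ∀ᶠ ε : ℝ in nhdsWithin 0 (Set.Ioi 0), 1 ≤ formValue φ N (A + ε • R) x := by
    intro x hx
    rcases (hA.2 x hx).eq_or_lt with h1 | h1
    · filter_upwards [self_mem_nhdsWithin] with ε hε
      rw [formValue_eq_val, val_add, val_smul]
      have := hRA x ⟨hx, h1.symm⟩
      rw [formValue_eq_val] at this h1
      rw [← h1]
      have := mul_nonneg (le_of_lt hε) this
      linarith
    · refine Filter.Eventually.mono (nhdsWithin_le_nhds (Filter.Tendsto.eventually_const_lt
        (u := 1) (v := formValue φ N A x) (f := fun ε : ℝ => formValue φ N (A + ε • R) x) h1 ?_))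
        fun _ h => h.le
      have hc : Continuous fun ε : ℝ => formValue φ N (A + ε • R) x :=
        (continuous_formValue x).comp (by fun_prop)
      simpa using hc.tendsto 0
  have hbig : ∀ᶠ ε : ℝ in nhdsWithin 0 (Set.Ioi 0), ε < α / (2 * β) :=
    nhdsWithin_le_nhds (gt_mem_nhds (by positivity))
  have hall : ∀ᶠ ε : ℝ in nhdsWithin 0 (Set.Ioi 0), ∀ x ∈ {x | formValue φ N A x ≤ 2},
      x ≠ 0 → 1 ≤ formValue φ N (A + ε • R) x := by
    rw [hfin.eventually_all]
    intro x _
    by_cases hx : x = 0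
    · simp [hx]
    · simpa [hx] using hsmall x hx
  obtain ⟨ε, ⟨hε1, hε2⟩, hε0⟩ := ((hall.and hbig).and self_mem_nhdsWithin).exists
  have hε0 : 0 < ε := hε0
  refine ⟨ε, hε0, ?_, fun x hx => ?_⟩
  · exact hA.1.add (by rw [Matrix.IsHermitian, Matrix.conjTranspose_smul, hR.eq, star_trivial])
  · by_cases hx2 : formValue φ N A x ≤ 2
    · exact hε1 x hx2 hx
    · rw [formValue_eq_val] at hx2 ⊢
      rw [val_add, val_smul]
      have h1 := hαA (embInt φ N x)
      have h2 := (abs_le.1 (hβR (embInt φ N x))).1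
      rw [lt_div_iff₀ (by positivity)] at hε2
      have h3 : ε * (β * ‖embInt φ N x‖ ^ 2) ≤ α * ‖embInt φ N x‖ ^ 2 / 2 := by
        have := sq_nonneg ‖embInt φ N x‖
        nlinarith
      have h4 := mul_le_mul_of_nonneg_left h2 hε0.le
      push Not at hx2
      linarith

end Lattice

/-! ### Perfect forms and their construction by moving in the polyhedron -/

section Perfect

variable {F : Type*} [Field F] {φ : F →+* ℂ} {N : ℕ}

theorem isHermitian_real_smul {A : Matrix (Fin N) (Fin N) ℂ} (hA : A.IsHermitian) (t : ℝ) :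
    (t • A).IsHermitian := by
  rw [Matrix.IsHermitian, Matrix.conjTranspose_smul, hA.eq, star_trivial]

variable (N) in
/-- The real vector space of Hermitian matrices. -/
def hermitianSubmodule : Submodule ℝ (Matrix (Fin N) (Fin N) ℂ) where
  carrier := {B | B.IsHermitian}
  add_mem' := Matrix.IsHermitian.add
  zero_mem' := Matrix.isHermitian_zero
  smul_mem' t _ hA := isHermitian_real_smul hA t

theorem span_q_le (M : Set (Fin N → 𝓞 F)) :
    Submodule.span ℝ (q φ N '' M) ≤ hermitianSubmodule N := by
  rw [Submodule.span_le]
  rintro _ ⟨x, -, rfl⟩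
  exact (posSemidef_q x).1

theorem pairing_eq_zero_of_mem_span {R : Matrix (Fin N) (Fin N) ℂ} {M : Set (Fin N → 𝓞 F)}
    (hR : ∀ x ∈ M, formValue φ N R x = 0) {B : Matrix (Fin N) (Fin N) ℂ}
    (hB : B ∈ Submodule.span ℝ (q φ N '' M)) : pairing R B = 0 := by
  have : Submodule.span ℝ (q φ N '' M) ≤ LinearMap.ker (pairing R) := by
    rw [Submodule.span_le]
    rintro _ ⟨x, hx, rfl⟩
    exact (pairing_q R x).trans (hR x hx)
  exact this hB

theorem minimum_eq_one {A : Matrix (Fin N) (Fin N) ℂ} (hA : A ∈ ryshkov φ N)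
    (hne : (contacts φ N A).Nonempty) : minimum φ N A = 1 := by
  obtain ⟨w, hw, hw1⟩ := hne
  refine IsLeast.csInf_eq ⟨⟨w, hw, hw1⟩, ?_⟩
  rintro _ ⟨x, hx, rfl⟩
  exact hA.2 x hx

theorem isPerfect_of_mem_ryshkov (h : IsImaginaryLattice φ) {A : Matrix (Fin N) (Fin N) ℂ}
    (hA : A ∈ ryshkov φ N) (hne : (contacts φ N A).Nonempty)
    (hspan : hermitianSubmodule N ≤ Submodule.span ℝ (q φ N '' contacts φ N A)) :
    IsPerfect φ N A := by
  have hm := minimum_eq_one hA hne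
  refine ⟨posDef_of_mem_ryshkov h hA, hm, ?_⟩
  have : minimalVectors φ N A = contacts φ N A := by
    simp only [minimalVectors, contacts, hm]
  rw [this]
  exact congrArg SetLike.coe (le_antisymm (span_q_le _) hspan)

theorem IsPerfect.minimalVectors_eq {A : Matrix (Fin N) (Fin N) ℂ} (hA : IsPerfect φ N A) :
    minimalVectors φ N A = contacts φ N A := by
  simp only [minimalVectors, contacts, hA.2.1]

theorem IsPerfect.mem_ryshkov {A : Matrix (Fin N) (Fin N) ℂ} (hA : IsPerfect φ N A) :
    A ∈ ryshkov φ N := by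
  refine ⟨hA.1.1, fun x hx => ?_⟩
  rw [← hA.2.1]
  refine csInf_le ⟨0, ?_⟩ ⟨x, hx, rfl⟩
  rintro _ ⟨y, -, rfl⟩
  exact (posSemidef_iff_val hA.1.1).1 hA.1.posSemidef _

theorem IsPerfect.span_eq {A : Matrix (Fin N) (Fin N) ℂ} (hA : IsPerfect φ N A) :
    Submodule.span ℝ (q φ N '' contacts φ N A) = hermitianSubmodule N := by
  rw [← hA.minimalVectors_eq]
  exact SetLike.coe_injective hA.2.2

/-- Moving inside the Ryshkov polyhedron along a direction which is not positive semidefinite until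
a new contact vector is met. -/
theorem exists_contact_of_not_posSemidef (h : IsImaginaryLattice φ)
    {A R : Matrix (Fin N) (Fin N) ℂ} (hA : A ∈ ryshkov φ N) (hR : R.IsHermitian)
    (hneg : ∃ z, val R z < 0) :
    ∃ t : ℝ, 0 ≤ t ∧ A + t • R ∈ ryshkov φ N ∧
      ∃ w ∈ contacts φ N (A + t • R), formValue φ N R w < 0 := by
  obtain ⟨x, hx⟩ : ∃ x, formValue φ N R x < 0 := by
    by_contra! hc
    obtain ⟨z, hz⟩ := hneg
    exact hz.not_ge (val_nonneg_of_formValue_nonneg h hc z)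
  have hx0 : x ≠ 0 := by
    rintro rfl
    rw [formValue_eq_val, embInt_zero, val_zero_right] at hx
    exact lt_irrefl _ hx
  set T : Set ℝ := {t | 0 ≤ t ∧ A + t • R ∈ ryshkov φ N} with hT
  have hTclosed : IsClosed T :=
    isClosed_Ici.inter (isClosed_ryshkov.preimage (by fun_prop : Continuous fun t : ℝ => A + t • R))
  have hTbdd : BddAbove T := by
    refine ⟨(formValue φ N A x - 1) / (-formValue φ N R x), fun t ht => ?_⟩
    have := ht.2.2 x hx0
    rw [formValue_eq_val, val_add, val_smul] at this
    rw [le_div_iff₀ (by linarith)]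
    rw [formValue_eq_val, formValue_eq_val]
    linarith
  have hTne : T.Nonempty := ⟨0, le_rfl, by simpa using hA⟩
  have hmem : sSup T ∈ T := hTclosed.csSup_mem hTne hTbdd
  refine ⟨sSup T, hmem.1, hmem.2, ?_⟩
  -- If R were nonnegative on all contacts at the last admissible parameter, one could go further.
  by_contra! hc
  obtain ⟨ε, hε, hmem'⟩ := exists_add_smul_mem_ryshkov h hmem.2 hR hc
  rw [add_assoc, ← add_smul] at hmem'
  have := le_csSup hTbdd (show sSup T + ε ∈ T from ⟨add_nonneg hmem.1 hε.le, hmem'⟩)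
  linarith

theorem exists_val_neg_or {R : Matrix (Fin N) (Fin N) ℂ} (hR : R.IsHermitian) (h0 : R ≠ 0) :
    (∃ z, val R z < 0) ∨ ∃ z, val (-R) z < 0 := by
  by_contra! hc
  refine h0 (eq_zero_of_val_eq_zero hR fun x => le_antisymm ?_ (hc.1 x))
  have := hc.2 x
  rw [val_neg] at this
  linarith

/-- There are no dead ends: directions orthogonal to the contact vectors can be chosen
not positive semidefinite, and nonnegative at a given vector. -/
theorem exists_direction {M : Set (Fin N → 𝓞 F)} (hM : ∃ w ∈ M, w ≠ 0)
    (hspan : ¬ hermitianSubmodule N ≤ Submodule.span ℝ (q φ N '' M)) (v : Fin N → 𝓞 F) :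
    ∃ R : Matrix (Fin N) (Fin N) ℂ, R.IsHermitian ∧ (∀ x ∈ M, formValue φ N R x = 0) ∧
      0 ≤ formValue φ N R v ∧ ∃ z, val R z < 0 := by
  -- A functional killing the span but not all Hermitian matrices gives a nonzero R vanishing on M.
  -- If R also vanishes at v, then R or -R takes a negative value and serves (`hzero`).
  obtain ⟨B, hB, hBs⟩ := Set.not_subset.1 hspan
  obtain ⟨f, hf, hfs⟩ := Submodule.exists_le_ker_of_notMem hBs
  obtain ⟨R, hR, hRf⟩ := exists_isHermitian_pairing_eq f
  have hRM : ∀ x ∈ M, formValue φ N R x = 0 := fun x hx => by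
    rw [← pairing_q, ← hRf _ (posSemidef_q x).1]
    exact hfs (Submodule.subset_span ⟨x, hx, rfl⟩)
  have hR0 : R ≠ 0 := by
    rintro rfl
    rw [hRf _ hB, map_zero] at hf
    exact hf rfl
  have hzero : ∀ R : Matrix (Fin N) (Fin N) ℂ, R.IsHermitian → R ≠ 0 →
      (∀ x ∈ M, formValue φ N R x = 0) → formValue φ N R v = 0 →
      ∃ R : Matrix (Fin N) (Fin N) ℂ, R.IsHermitian ∧ (∀ x ∈ M, formValue φ N R x = 0) ∧
      0 ≤ formValue φ N R v ∧ ∃ z, val R z < 0 := by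
    intro R hR hR0 hRM hv
    rcases exists_val_neg_or hR hR0 with hz | hz
    · exact ⟨R, hR, hRM, hv.ge, hz⟩
    · refine ⟨-R, hR.neg, fun x hx => ?_, ?_, hz⟩
      · rw [formValue_eq_val, val_neg, ← formValue_eq_val, hRM x hx, neg_zero]
      · rw [formValue_eq_val, val_neg, ← formValue_eq_val, hv, neg_zero]
  have hpos : ∀ R : Matrix (Fin N) (Fin N) ℂ, R.IsHermitian →
      (∀ x ∈ M, formValue φ N R x = 0) → 0 < formValue φ N R v →
      ∃ R : Matrix (Fin N) (Fin N) ℂ, R.IsHermitian ∧ (∀ x ∈ M, formValue φ N R x = 0) ∧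
      0 ≤ formValue φ N R v ∧ ∃ z, val R z < 0 := by
    intro R hR hRM hv
    by_cases hz : ∃ z, val R z < 0
    · exact ⟨R, hR, hRM, hv.le, hz⟩
    push Not at hz
    have hpsd := (posSemidef_iff_val hR).2 hz
    have hker : ∀ x ∈ M, R *ᵥ embInt φ N x = 0 := fun x hx =>
      mulVec_eq_zero_of_val_eq_zero hpsd (hRM x hx)
    obtain ⟨w, hw, hw0⟩ := hM
    -- The remaining bad case is R positive semidefinite with R[v] > 0. Then M lies in the kernel of
    -- R, hence is orthogonal to y = Rv. For e in M, the form y e* + e y* vanishes on M too, and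
    -- subtracting a multiple of R makes it vanish at v. It remains nonzero, since it sends e to a
    -- nonzero multiple of y.
    set y := R *ᵥ embInt φ N v with hy
    have hy0 : y ≠ 0 := fun h0 => hv.ne' (val_eq_zero_of_mulVec_eq_zero h0)
    have horth : ∀ x ∈ M, star y ⬝ᵥ embInt φ N x = 0 := fun x hx => by
      rw [hy, Matrix.star_mulVec, ← Matrix.dotProduct_mulVec, hR.eq, hker x hx, dotProduct_zero]
    set e := embInt φ N w with he
    set R₁ := Matrix.vecMulVec y (star e) + Matrix.vecMulVec e (star y) with hR₁
    have hR₁h : R₁.IsHermitian := by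
      rw [Matrix.IsHermitian, hR₁, Matrix.conjTranspose_add, Matrix.conjTranspose_vecMulVec,
        Matrix.conjTranspose_vecMulVec, star_star, star_star, add_comm]
    have hmul : ∀ x ∈ M, R₁ *ᵥ embInt φ N x = MulOpposite.op (star e ⬝ᵥ embInt φ N x) • y := by
      intro x hx
      rw [hR₁, Matrix.add_mulVec, Matrix.vecMulVec_mulVec, Matrix.vecMulVec_mulVec, horth x hx]
      simp
    have hR₁M : ∀ x ∈ M, formValue φ N R₁ x = 0 := by
      intro x hx
      have h1 : star (embInt φ N x) ⬝ᵥ y = 0 := by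
        rw [Matrix.star_dotProduct, horth x hx, star_zero]
      rw [formValue_eq_val, val, hmul x hx, dotProduct_smul, h1]
      simp
    set c := formValue φ N R₁ v / formValue φ N R v with hc
    refine hzero (R₁ - c • R) (hR₁h.sub (isHermitian_real_smul hR c)) (fun h0 => ?_)
      (fun x hx => ?_) ?_
    · have h1 : (R₁ - c • R) *ᵥ e = 0 := by rw [h0, Matrix.zero_mulVec]
      rw [Matrix.sub_mulVec, Matrix.smul_mulVec, he, hker w hw, smul_zero, sub_zero,
        hmul w hw] at h1
      have h2 : star e ⬝ᵥ e ≠ 0 := by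
        rw [Ne, dotProduct_star_self_eq_zero]
        exact embInt_ne_zero hw0
      rcases smul_eq_zero.1 h1 with h3 | h3
      · exact h2 ((MulOpposite.op_eq_zero_iff _).1 h3)
      · exact hy0 h3
    · rw [formValue_eq_val, val_sub, val_smul, ← formValue_eq_val, ← formValue_eq_val, hRM x hx,
        hR₁M x hx, mul_zero, sub_zero]
    · rw [formValue_eq_val, val_sub, val_smul, ← formValue_eq_val, ← formValue_eq_val, hc,
        div_mul_cancel₀ _ hv.ne', sub_self]
  rcases lt_trichotomy (formValue φ N R v) 0 with hv | hv | hv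
  · refine hpos (-R) hR.neg (fun x hx => ?_) ?_
    · rw [formValue_eq_val, val_neg, ← formValue_eq_val, hRM x hx, neg_zero]
    · rw [formValue_eq_val, val_neg, ← formValue_eq_val]
      linarith
  · exact hzero R hR hR0 hRM hv
  · exact hpos R hR hRM hv

/-- Every form in the Ryshkov polyhedron with a contact vector lies on the face of a perfect form,
which can be chosen to avoid a given lattice vector that is not a contact vector. -/
theorem exists_isPerfect_of_contacts (h : IsImaginaryLattice φ) {A : Matrix (Fin N) (Fin N) ℂ}
    (hA : A ∈ ryshkov φ N) (hne : (contacts φ N A).Nonempty) {v : Fin N → 𝓞 F}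
    (hv : 1 < formValue φ N A v) :
    ∃ A', IsPerfect φ N A' ∧ contacts φ N A ⊆ contacts φ N A' ∧ 1 < formValue φ N A' v := by
  -- Each move keeps the old contacts and strictly enlarges their span, so the process stops in
  -- finite dimension. The direction is nonnegative at v, so the value at v stays above 1.
  induction hS : Submodule.span ℝ (q φ N '' contacts φ N A) using
    (wellFounded_gt (α := Submodule ℝ (Matrix (Fin N) (Fin N) ℂ))).induction generalizing A with
  | _ S ih =>
    subst hS
    by_cases hspan : hermitianSubmodule N ≤ Submodule.span ℝ (q φ N '' contacts φ N A)
    · exact ⟨A, isPerfect_of_mem_ryshkov h hA hne hspan, subset_rfl, hv⟩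
    obtain ⟨R, hR, hRM, hRv, hneg⟩ :=
      exists_direction (hne.imp fun w hw => ⟨hw, hw.1⟩) hspan v
    obtain ⟨t, ht, hmem, w, hw, hwR⟩ := exists_contact_of_not_posSemidef h hA hR hneg
    have hsub : contacts φ N A ⊆ contacts φ N (A + t • R) := fun x hx => ⟨hx.1, by
      rw [formValue_eq_val, val_add, val_smul, ← formValue_eq_val, ← formValue_eq_val, hRM x hx,
        hx.2, mul_zero, add_zero]⟩
    have hlt : Submodule.span ℝ (q φ N '' contacts φ N A) <
        Submodule.span ℝ (q φ N '' contacts φ N (A + t • R)) := by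
      refine lt_of_le_of_ne (Submodule.span_mono (Set.image_mono hsub)) fun heq => ?_
      have h1 : q φ N w ∈ Submodule.span ℝ (q φ N '' contacts φ N A) := by
        rw [heq]
        exact Submodule.subset_span ⟨w, hw, rfl⟩
      have h2 := pairing_eq_zero_of_mem_span hRM h1
      rw [pairing_q] at h2
      exact hwR.ne h2
    obtain ⟨A', hA', hsub', hv'⟩ := ih _ hlt hmem (hne.mono hsub) (by
      rw [formValue_eq_val, val_add, val_smul, ← formValue_eq_val, ← formValue_eq_val]
      have := mul_nonneg ht hRv
      linarith) rfl
    exact ⟨A', hA', hsub.trans hsub', hv'⟩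

theorem exists_isPerfect_contacts_subset (h : IsImaginaryLattice φ)
    {A : Matrix (Fin N) (Fin N) ℂ} (hA : A ∈ ryshkov φ N) (hne : (contacts φ N A).Nonempty) :
    ∃ A', IsPerfect φ N A' ∧ contacts φ N A ⊆ contacts φ N A' := by
  obtain ⟨w, hw⟩ := hne
  obtain ⟨A', hA', hsub, -⟩ := exists_isPerfect_of_contacts h hA ⟨w, hw⟩ (v := 2 • w) (by
    rw [formValue_eq_val, embInt_nsmul, val_smul_right, ← formValue_eq_val, hw.2]
    norm_num)
  exact ⟨A', hA', hsub⟩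

end Perfect

/-! ### Cones generated by rank one matrices -/

section Cone

variable {F : Type*} [Field F] {φ : F →+* ℂ} {N : ℕ}

variable (φ N) in
/-- The convex cone generated by the `q v`, `v ∈ M`. -/
def coneHull (M : Set (Fin N → 𝓞 F)) : Set (Matrix (Fin N) (Fin N) ℂ) :=
  {B | ∃ c : (Fin N → 𝓞 F) →₀ ℝ, (∀ v, 0 ≤ c v) ∧ (c.support : Set (Fin N → 𝓞 F)) ⊆ M ∧
    B = c.sum fun v r => r • q φ N v}

theorem coneHull_mono {M M' : Set (Fin N → 𝓞 F)} (hM : M ⊆ M') :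
    coneHull φ N M ⊆ coneHull φ N M' := by
  rintro B ⟨c, hc, hs, rfl⟩
  exact ⟨c, hc, hs.trans hM, rfl⟩

theorem q_mem_coneHull {M : Set (Fin N → 𝓞 F)} {v : Fin N → 𝓞 F} (hv : v ∈ M) :
    q φ N v ∈ coneHull φ N M := by
  classical
  refine ⟨Finsupp.single v 1, fun w => ?_, ?_, ?_⟩
  · rw [Finsupp.single_apply]
    split_ifs <;> norm_num
  · refine (Finset.coe_subset.2 Finsupp.support_single_subset).trans ?_
    simpa using hv
  · rw [Finsupp.sum_single_index (h := fun v r => r • q φ N v) (zero_smul _ _), one_smul]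

theorem add_mem_coneHull {M : Set (Fin N → 𝓞 F)} {B B' : Matrix (Fin N) (Fin N) ℂ}
    (hB : B ∈ coneHull φ N M) (hB' : B' ∈ coneHull φ N M) : B + B' ∈ coneHull φ N M := by
  classical
  obtain ⟨c, hc, hs, rfl⟩ := hB
  obtain ⟨c', hc', hs', rfl⟩ := hB'
  refine ⟨c + c', fun v => add_nonneg (hc v) (hc' v), fun v hv => ?_, ?_⟩
  · rcases Finset.mem_union.1 (Finsupp.support_add hv) with h | h
    · exact hs h
    · exact hs' h
  · exact (Finsupp.sum_add_index' (h := fun v r => r • q φ N v) (fun _ => zero_smul _ _)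
      fun _ _ _ => add_smul _ _ _).symm

theorem smul_mem_coneHull {M : Set (Fin N → 𝓞 F)} {B : Matrix (Fin N) (Fin N) ℂ}
    (hB : B ∈ coneHull φ N M) {t : ℝ} (ht : 0 ≤ t) : t • B ∈ coneHull φ N M := by
  obtain ⟨c, hc, hs, rfl⟩ := hB
  refine ⟨t • c, fun v => mul_nonneg ht (hc v),
    fun v hv => hs (Finsupp.support_smul hv), ?_⟩
  rw [Finsupp.sum_smul_index' (h := fun v r => r • q φ N v) fun _ => zero_smul _ _,
    Finsupp.smul_sum]
  simp_rw [smul_smul, smul_eq_mul]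

theorem convex_coneHull (M : Set (Fin N → 𝓞 F)) : Convex ℝ (coneHull φ N M) :=
  fun _ hB _ hB' _ _ ha hb _ =>
    add_mem_coneHull (smul_mem_coneHull hB ha) (smul_mem_coneHull hB' hb)

theorem pairing_finsupp_sum (A : Matrix (Fin N) (Fin N) ℂ) (c : (Fin N → 𝓞 F) →₀ ℝ) :
    pairing A (c.sum fun v r => r • q φ N v) = c.sum fun v r => r * formValue φ N A v := by
  rw [Finsupp.sum, map_sum]
  exact Finset.sum_congr rfl fun v _ => by rw [map_smul, pairing_q, smul_eq_mul]

theorem posSemidef_finsupp_sum {c : (Fin N → 𝓞 F) →₀ ℝ} (hc : ∀ v, 0 ≤ c v) :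
    (c.sum fun v r => r • q φ N v).PosSemidef :=
  Matrix.posSemidef_sum _ fun v _ => (posSemidef_q v).smul (hc v)

theorem posSemidef_of_mem_coneHull {M : Set (Fin N → 𝓞 F)} {B : Matrix (Fin N) (Fin N) ℂ}
    (hB : B ∈ coneHull φ N M) : B.PosSemidef := by
  obtain ⟨c, hc, -, rfl⟩ := hB
  exact posSemidef_finsupp_sum hc

/-- The form of a perfect cone is minimal on it among the forms of the Ryshkov polyhedron. -/
theorem pairing_le_of_mem_coneHull {A A' B : Matrix (Fin N) (Fin N) ℂ}
    (hA' : A' ∈ ryshkov φ N) (hB : B ∈ coneHull φ N (contacts φ N A)) :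
    pairing A B ≤ pairing A' B := by
  obtain ⟨c, hc, hs, rfl⟩ := hB
  rw [pairing_finsupp_sum, pairing_finsupp_sum]
  refine Finset.sum_le_sum fun v hv => mul_le_mul_of_nonneg_left ?_ (hc v)
  rw [(hs hv).2]
  exact hA'.2 v (hs hv).1

/-- Term by term the pairing with A is at most the pairing with A', so equality of the sums forces
A'[v] = 1 for every v with nonzero coefficient. This is the source of all statements about faces. -/
theorem mem_coneHull_inter {A A' B : Matrix (Fin N) (Fin N) ℂ} {M : Set (Fin N → 𝓞 F)}
    (hM : M ⊆ contacts φ N A)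
    (hA' : A' ∈ ryshkov φ N) (hB : B ∈ coneHull φ N M)
    (hle : pairing A' B ≤ pairing A B) : B ∈ coneHull φ N (M ∩ contacts φ N A') := by
  obtain ⟨c, hc, hs, rfl⟩ := hB
  rw [pairing_finsupp_sum, pairing_finsupp_sum] at hle
  refine ⟨c, hc, fun v hv => ⟨hs hv, (hM (hs hv)).1, ?_⟩, rfl⟩
  have hnn : ∀ v ∈ c.support, c v * formValue φ N A v ≤ c v * formValue φ N A' v := fun v hv =>
    mul_le_mul_of_nonneg_left (by rw [(hM (hs hv)).2]; exact hA'.2 v (hM (hs hv)).1) (hc v)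
  have heq := (Finset.sum_eq_sum_iff_of_le hnn).1 (le_antisymm (Finset.sum_le_sum hnn) hle) v hv
  rw [← mul_left_cancel₀ (Finsupp.mem_support_iff.1 hv) heq, (hM (hs hv)).2]

theorem finsupp_sum_mulVec (c : (Fin N → 𝓞 F) →₀ ℝ) (x : Fin N → ℂ) :
    (c.sum fun v r => r • q φ N v) *ᵥ x =
      c.sum fun v r => r • (star (embInt φ N v) ⬝ᵥ x) • embInt φ N v := by
  rw [Finsupp.sum, Matrix.sum_mulVec]
  refine Finset.sum_congr rfl fun v _ => ?_
  rw [Matrix.smul_mulVec, q, Matrix.vecMulVec_mulVec]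
  ext i
  simp [mul_comm]

/-- The value at x is the sum of the nonnegative terms c(v) |v* x|². -/
theorem finsupp_sum_mulVec_eq_zero_iff {c : (Fin N → 𝓞 F) →₀ ℝ} (hc : ∀ v, 0 ≤ c v)
    (x : Fin N → ℂ) : (c.sum fun v r => r • q φ N v) *ᵥ x = 0 ↔
      ∀ v ∈ c.support, star (embInt φ N v) ⬝ᵥ x = 0 := by
  refine ⟨fun h v hv => ?_, fun h => ?_⟩
  · have h1 := val_eq_zero_of_mulVec_eq_zero h
    rw [val_eq_pairing, pairing_comm, pairing_finsupp_sum] at h1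
    have hterm : ∀ v ∈ c.support,
        0 ≤ c v * formValue φ N (Matrix.vecMulVec x (star x)) v := fun v _ =>
      mul_nonneg (hc v) (by rw [formValue_eq_val, val_vecMulVec]; positivity)
    have h2 := (Finset.sum_eq_zero_iff_of_nonneg hterm).1 h1 v hv
    have h3 := (mul_eq_zero.1 h2).resolve_left (Finsupp.mem_support_iff.1 hv)
    rw [formValue_eq_val, val_vecMulVec, sq_eq_zero_iff, norm_eq_zero] at h3
    rw [Matrix.star_dotProduct, h3, star_zero]
  · rw [finsupp_sum_mulVec]
    exact Finset.sum_eq_zero fun v hv => by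
      simp only [h v hv, zero_smul, smul_zero]

end Cone

/-! ### Rationality of kernels -/

section Rational

variable {F : Type*} [Field F] {φ : F →+* ℂ} {N : ℕ}

theorem emb_apply (x : Fin N → F) (i : Fin N) : emb φ N x i = φ (x i) := rfl

/-- A complex subspace cut out by lattice vectors is spanned by `F`-rational vectors. -/
theorem mem_span_emb_of_orthogonal (h : IsImaginaryLattice φ) {T : Set (Fin N → 𝓞 F)}
    {x : Fin N → ℂ} (hx : ∀ v ∈ T, star (embInt φ N v) ⬝ᵥ x = 0) :
    x ∈ Submodule.span ℂ
      (emb φ N '' {s | ∀ v ∈ T, star (embInt φ N v) ⬝ᵥ emb φ N s = 0}) := by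
  classical
  let _ := φ.toAlgebra
  have hsmul : ∀ (a : F) (z : ℂ), a • z = φ a * z := fun a z => Algebra.smul_def a z
  -- Coordinates over F of the entries of x solve the same equations as x, because the conjugates of
  -- the entries of v again come from F.
  let b := Module.Basis.ofVectorSpace F ℂ
  set J : Finset (Module.Basis.ofVectorSpaceIndex F ℂ) :=
    Finset.univ.biUnion fun i => (b.repr (x i)).support with hJ
  have hsum : x = ∑ j ∈ J, b j • emb φ N fun i => b.repr (x i) j := by
    ext i
    rw [Finset.sum_apply]
    nth_rewrite 1 [← b.linearCombination_repr (x i)]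
    rw [Finsupp.linearCombination_apply, Finsupp.sum_of_support_subset (s := J)]
    · exact Finset.sum_congr rfl fun j _ => by
        rw [hsmul, Pi.smul_apply, emb_apply, smul_eq_mul, mul_comm]
    · exact Finset.subset_biUnion_of_mem (fun i => (b.repr (x i)).support) (Finset.mem_univ i)
    · exact fun _ _ => zero_smul _ _
  rw [hsum]
  refine Submodule.sum_mem _ fun j _ => Submodule.smul_mem _ _ (Submodule.subset_span ⟨_, ?_, rfl⟩)
  intro v hv
  choose w hw using fun i => h.conj (v i)
  have h1 : ∑ i, (w i : F) • x i = 0 := by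
    rw [← hx v hv, dotProduct]
    exact Finset.sum_congr rfl fun i _ => by rw [hsmul, hw, Pi.star_apply, embInt_apply]
  have h2 : ∑ i, (w i : F) * b.repr (x i) j = 0 := by
    have := congrArg (fun y => b.repr y j) h1
    simpa only [map_sum, map_smul, Finsupp.coe_finsetSum, Finset.sum_apply, Finsupp.smul_apply,
      smul_eq_mul, map_zero, Finsupp.zero_apply] using this
  have h3 := congrArg φ h2
  rw [map_sum, map_zero] at h3
  rw [← h3, dotProduct]
  exact Finset.sum_congr rfl fun i _ => by
    rw [map_mul, hw, Pi.star_apply, embInt_apply, emb_apply]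

theorem complexSpan_span (S : Set (Fin N → F)) :
    complexSpan φ N (Submodule.span F S) = Submodule.span ℂ (emb φ N '' S) := by
  refine le_antisymm (Submodule.span_le.2 ?_) (Submodule.span_mono
    (Set.image_mono Submodule.subset_span))
  rintro _ ⟨x, hx, rfl⟩
  induction hx using Submodule.span_induction with
  | mem x hx => exact Submodule.subset_span ⟨x, hx, rfl⟩
  | zero =>
    have : emb φ N 0 = 0 := by ext; simp [emb_apply]
    rw [this]
    exact Submodule.zero_mem _
  | add x y _ _ hx hy =>
    have : emb φ N (x + y) = emb φ N x + emb φ N y := by ext; simp [emb_apply]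
    rw [this]
    exact Submodule.add_mem _ hx hy
  | smul a x _ hx =>
    have : emb φ N (a • x) = φ a • emb φ N x := by ext; simp [emb_apply]
    rw [this]
    exact Submodule.smul_mem _ _ hx

theorem hasRationalKernel_of_mem_coneHull (h : IsImaginaryLattice φ) {M : Set (Fin N → 𝓞 F)}
    {B : Matrix (Fin N) (Fin N) ℂ} (hB : B ∈ coneHull φ N M) : HasRationalKernel φ N B := by
  obtain ⟨c, hc, hs, rfl⟩ := hB
  refine ⟨{s | ∀ v ∈ c.support, star (embInt φ N v) ⬝ᵥ emb φ N s = 0}, le_antisymm ?_ ?_⟩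
  · intro x hx
    rw [LinearMap.mem_ker, Matrix.mulVecLin_apply, finsupp_sum_mulVec_eq_zero_iff hc] at hx
    exact mem_span_emb_of_orthogonal h hx
  · rw [Submodule.span_le]
    rintro _ ⟨s, hs, rfl⟩
    rw [SetLike.mem_coe, LinearMap.mem_ker, Matrix.mulVecLin_apply,
      finsupp_sum_mulVec_eq_zero_iff hc]
    exact hs

/-- Every rational complex subspace is spanned by finitely many lattice vectors. -/
theorem exists_finset_span_eq [NumberField F] (V : Submodule F (Fin N → F)) :
    ∃ s : Finset (Fin N → 𝓞 F), complexSpan φ N V = Submodule.span ℂ (embInt φ N '' s) := by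
  classical
  obtain ⟨t, ht⟩ := (IsNoetherian.noetherian V : V.FG)
  have hden : ∀ x : Fin N → F, ∃ y : Fin N → 𝓞 F, ∃ d : 𝓞 F, d ≠ 0 ∧ ∀ i, (y i : F) = d * x i := by
    intro x
    obtain ⟨d, hd⟩ := IsLocalization.exist_integer_multiples_of_finite (nonZeroDivisors (𝓞 F)) x
    choose y hy using hd
    exact ⟨y, d, nonZeroDivisors.coe_ne_zero d, fun i => by
      simpa [Algebra.smul_def] using hy i⟩
  choose y d hd hy using hden
  refine ⟨t.image y, ?_⟩
  have hemb : ∀ x, embInt φ N (y x) = φ (d x) • emb φ N x := fun x => by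
    ext i
    rw [embInt_apply, hy, map_mul]
    rfl
  have hd' : ∀ x, φ (d x) ≠ 0 := fun x => by simpa using hd x
  rw [← ht, complexSpan_span]
  refine le_antisymm (Submodule.span_le.2 ?_) (Submodule.span_le.2 ?_)
  · rintro _ ⟨x, hx, rfl⟩
    have : emb φ N x = (φ (d x))⁻¹ • embInt φ N (y x) := by
      rw [hemb, smul_smul, inv_mul_cancel₀ (hd' x), one_smul]
    rw [this]
    refine Submodule.smul_mem _ _ (Submodule.subset_span ⟨y x, ?_, rfl⟩)
    exact Finset.mem_coe.2 (Finset.mem_image_of_mem y hx)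
  · rintro _ ⟨_, hv, rfl⟩
    obtain ⟨x, hx, rfl⟩ := Finset.mem_image.1 (Finset.mem_coe.1 hv)
    rw [hemb]
    exact Submodule.smul_mem _ _ (Submodule.subset_span ⟨x, hx, rfl⟩)

end Rational

/-! ### Pseudo-inverses of Hermitian matrices -/

section PseudoInverse

variable {N : ℕ}

instance locallyConvexSpace_matrix : LocallyConvexSpace ℝ (Matrix (Fin N) (Fin N) ℂ) :=
  inferInstanceAs (LocallyConvexSpace ℝ (Fin N → Fin N → ℂ))

/-- Hermitian matrices have a commuting Hermitian pseudo-inverse. -/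
theorem exists_pseudoInverse {D : Matrix (Fin N) (Fin N) ℂ} (hD : D.IsHermitian) :
    ∃ G : Matrix (Fin N) (Fin N) ℂ, G.IsHermitian ∧ D * G = G * D ∧ D * G * D = D := by
  set U : Matrix (Fin N) (Fin N) ℂ := hD.eigenvectorUnitary.1 with hU
  set d : Fin N → ℂ := fun i => (hD.eigenvalues i : ℂ) with hd
  have hs : D = U * Matrix.diagonal d * Uᴴ := hD.spectral_theorem
  have hUU : Uᴴ * U = 1 := Unitary.coe_star_mul_self hD.eigenvectorUnitary
  have hmul : ∀ a b : Fin N → ℂ, (U * Matrix.diagonal a * Uᴴ) * (U * Matrix.diagonal b * Uᴴ) =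
      U * Matrix.diagonal (a * b) * Uᴴ := by
    intro a b
    calc _ = U * Matrix.diagonal a * (Uᴴ * U) * Matrix.diagonal b * Uᴴ := by
          simp only [mul_assoc]
      _ = _ := by
          rw [hUU, mul_one, mul_assoc U, Matrix.diagonal_mul_diagonal]
          rfl
  -- The inverse is entrywise, with 0⁻¹ = 0 on the kernel.
  refine ⟨U * Matrix.diagonal d⁻¹ * Uᴴ, ?_, ?_, ?_⟩
  · refine Matrix.isHermitian_mul_mul_conjTranspose U ?_
    rw [Matrix.isHermitian_diagonal_iff]
    intro i
    rw [IsSelfAdjoint]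
    simp [hd]
  · rw [hs, hmul, hmul, mul_comm]
  · rw [hs, hmul, hmul]
    congr 3
    ext i
    exact mul_inv_mul_cancel _

end PseudoInverse

/-! ### Voronoi's theorem: perfect cones cover the rational closure -/

section Fundamental

variable {F : Type*} [Field F] {φ : F →+* ℂ} {N : ℕ}

/-- A form `D` and a projection `P` adapted to a rational subspace `V`: `P` is the orthogonal
projection onto the orthogonal complement of `V`, which is the kernel of `D`, and `D` is at least
`1` on the lattice vectors outside of its kernel. -/
structure IsAdapted (φ : F →+* ℂ) (V : Submodule F (Fin N → F))
    (D P : Matrix (Fin N) (Fin N) ℂ) : Prop where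
  posSemidef : D.PosSemidef
  isHermitian : P.IsHermitian
  mul_self : P * P = P
  mul_eq_zero : D * P = 0
  mulVec_eq : ∀ x, D *ᵥ x = 0 → P *ᵥ x = x
  zero_or_one_le : ∀ x, D *ᵥ embInt φ N x = 0 ∨ 1 ≤ formValue φ N D x
  orthogonal : ∀ x, D *ᵥ x = 0 ↔ ∀ y ∈ complexSpan φ N V, star y ⬝ᵥ x = 0
  mul_eq : ∀ B : Matrix (Fin N) (Fin N) ℂ, complexSpan φ N V ≤ LinearMap.ker B.mulVecLin →
    B * P = B ∧ B * D = 0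
  ker : LinearMap.ker P.mulVecLin = complexSpan φ N V

/-- D is the sum of q(v) over lattice vectors v spanning V. At a lattice vector x it takes the value
Σ |v* x|², where each v* x is an embedded integer of F and hence is zero or of absolute value at
least 1. With G a pseudo-inverse of D, the projection is 1 - DG. -/
theorem exists_isAdapted [NumberField F] (h : IsImaginaryLattice φ)
    (V : Submodule F (Fin N → F)) : ∃ D P, IsAdapted φ V D P := by
  obtain ⟨s, hs⟩ := exists_finset_span_eq (φ := φ) V
  set D : Matrix (Fin N) (Fin N) ℂ := ∑ v ∈ s, q φ N v with hD
  have hpsd : D.PosSemidef := Matrix.posSemidef_sum _ fun v _ => posSemidef_q v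
  have hval : ∀ x, val D x = ∑ v ∈ s, ‖star (embInt φ N v) ⬝ᵥ x‖ ^ 2 := by
    intro x
    rw [val_eq_pairing, hD, map_sum, LinearMap.sum_apply]
    refine Finset.sum_congr rfl fun v _ => ?_
    rw [← val_eq_pairing, q, val_vecMulVec]
  have hmulVec : ∀ x, D *ᵥ x = ∑ v ∈ s, (star (embInt φ N v) ⬝ᵥ x) • embInt φ N v := by
    intro x
    rw [hD, Matrix.sum_mulVec]
    refine Finset.sum_congr rfl fun v _ => ?_
    rw [q, Matrix.vecMulVec_mulVec]
    ext i
    simp [mul_comm]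
  have hker : ∀ x, D *ᵥ x = 0 ↔ ∀ v ∈ s, star (embInt φ N v) ⬝ᵥ x = 0 := by
    refine fun x => ⟨fun h0 v hv => ?_, fun h0 => ?_⟩
    · have h1 := val_eq_zero_of_mulVec_eq_zero h0
      rw [hval, Finset.sum_eq_zero_iff_of_nonneg fun _ _ => by positivity] at h1
      simpa using h1 v hv
    · rw [hmulVec]
      exact Finset.sum_eq_zero fun v hv => by rw [h0 v hv, zero_smul]
  have horth : ∀ x, D *ᵥ x = 0 ↔ ∀ y ∈ complexSpan φ N V, star y ⬝ᵥ x = 0 := by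
    refine fun x => ⟨fun h0 y hy => ?_, fun h0 => (hker x).2 fun v hv => h0 _ ?_⟩
    · rw [hs] at hy
      induction hy using Submodule.span_induction with
      | mem y hy =>
        obtain ⟨v, hv, rfl⟩ := hy
        exact (hker x).1 h0 v hv
      | zero => simp
      | add y z _ _ hy hz => rw [star_add, add_dotProduct, hy, hz, add_zero]
      | smul a y _ hy => rw [star_smul, smul_dotProduct, hy, smul_zero]
    · rw [hs]
      exact Submodule.subset_span ⟨v, hv, rfl⟩
  have hrange : ∀ x, D *ᵥ x ∈ complexSpan φ N V := by
    intro x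
    rw [hmulVec, hs]
    exact Submodule.sum_mem _ fun v hv =>
      Submodule.smul_mem _ _ (Submodule.subset_span ⟨v, hv, rfl⟩)
  obtain ⟨G, hG, hcomm, hDGD⟩ := exists_pseudoInverse hpsd.1
  set P : Matrix (Fin N) (Fin N) ℂ := 1 - D * G with hP
  have hDP : D * P = 0 := by
    rw [hP, hcomm, mul_sub, mul_one, ← mul_assoc, hDGD, sub_self]
  have hPD : P * D = 0 := by
    rw [hP, sub_mul, one_mul, hDGD, sub_self]
  have hPP : P * P = P := by
    calc P * P = (1 - G * D) * P := by rw [← hcomm]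
      _ = P := by rw [sub_mul, one_mul, mul_assoc, hDP, mul_zero, sub_zero]
  have hPh : P.IsHermitian := by
    rw [Matrix.IsHermitian, hP, Matrix.conjTranspose_sub, Matrix.conjTranspose_one,
      Matrix.conjTranspose_mul, hG.eq, hpsd.1.eq, hcomm]
  refine ⟨D, P, hpsd, hPh, hPP, hDP, fun x hx => ?_, fun x => ?_, horth, fun B hB => ?_,
    le_antisymm ?_ ?_⟩
  · rw [hP, hcomm, Matrix.sub_mulVec, Matrix.one_mulVec, ← Matrix.mulVec_mulVec, hx,
      Matrix.mulVec_zero, sub_zero]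
  · by_cases h0 : D *ᵥ embInt φ N x = 0
    · exact Or.inl h0
    right
    rw [hker] at h0
    push Not at h0
    obtain ⟨v, hv, hvx⟩ := h0
    choose w hw using fun i => h.conj (v i)
    have h1 : star (embInt φ N v) ⬝ᵥ embInt φ N x = φ ((∑ i, w i * x i : 𝓞 F) : F) := by
      change _ = (φ.comp (algebraMap (𝓞 F) F)) (∑ i, w i * x i)
      rw [dotProduct, map_sum]
      refine Finset.sum_congr rfl fun i _ => ?_
      rw [Pi.star_apply, embInt_apply, embInt_apply, ← hw, map_mul]
      rfl
    have h2 : 1 ≤ ‖star (embInt φ N v) ⬝ᵥ embInt φ N x‖ := by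
      rw [h1]
      refine h.one_le_norm fun h0 => hvx ?_
      rw [h1, h0]
      simp
    rw [formValue_eq_val, hval]
    calc (1 : ℝ) ≤ ‖star (embInt φ N v) ⬝ᵥ embInt φ N x‖ ^ 2 := one_le_pow₀ h2
      _ ≤ _ := Finset.single_le_sum
        (f := fun v => ‖star (embInt φ N v) ⬝ᵥ embInt φ N x‖ ^ 2) (fun _ _ => by positivity) hv
  · have hBD : B * D = 0 := by
      refine Matrix.ext_of_mulVec_single fun i => ?_
      rw [← Matrix.mulVec_mulVec, Matrix.zero_mulVec]
      exact hB (hrange _)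
    refine ⟨?_, hBD⟩
    rw [hP, mul_sub, mul_one, ← mul_assoc, hBD, zero_mul, sub_zero]
  · intro x hx
    rw [LinearMap.mem_ker, Matrix.mulVecLin_apply, hP, Matrix.sub_mulVec, Matrix.one_mulVec,
      sub_eq_zero, ← Matrix.mulVec_mulVec] at hx
    rw [hx]
    exact hrange _
  · intro y hy
    rw [LinearMap.mem_ker, Matrix.mulVecLin_apply]
    have h1 : D *ᵥ (P *ᵥ y) = 0 := by rw [Matrix.mulVec_mulVec, hDP, Matrix.zero_mulVec]
    have h2 := (horth _).1 h1 y hy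
    rw [← dotProduct_star_self_eq_zero, Matrix.star_mulVec, hPh.eq,
      ← Matrix.dotProduct_mulVec, Matrix.mulVec_mulVec, hPP, h2]

variable {V : Submodule F (Fin N → F)} {D P : Matrix (Fin N) (Fin N) ℂ}

/-- Lattice vectors in the kernel of D are fixed by P and keep their value under A; on all others D
alone contributes at least 1. -/
theorem IsAdapted.mul_mul_add_mem_ryshkov (hDP : IsAdapted φ V D P) (h : IsImaginaryLattice φ)
    {A : Matrix (Fin N) (Fin N) ℂ} (hA : A ∈ ryshkov φ N) : P * A * P + D ∈ ryshkov φ N := by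
  have hpsd : (Pᴴ * A * P).PosSemidef :=
    (posSemidef_of_mem_ryshkov h hA).conjTranspose_mul_mul_same P
  have hPAP : (P * A * P).PosSemidef := by rwa [hDP.isHermitian.eq] at hpsd
  refine ⟨hPAP.1.add hDP.posSemidef.1, fun x hx => ?_⟩
  rw [formValue_eq_val, val_add]
  rcases hDP.zero_or_one_le x with h0 | h1
  · have h2 : val (P * A * P) (embInt φ N x) = formValue φ N A x := by
      nth_rewrite 1 [← hDP.isHermitian.eq]
      rw [val_conj, hDP.mulVec_eq _ h0, formValue_eq_val]
    rw [h2, val_eq_zero_of_mulVec_eq_zero h0, add_zero]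
    exact hA.2 x hx
  · have := (posSemidef_iff_val hPAP.1).1 hPAP (embInt φ N x)
    rw [formValue_eq_val] at h1
    linarith

theorem IsAdapted.pairing_eq (hDP : IsAdapted φ V D P) {B : Matrix (Fin N) (Fin N) ℂ}
    (hB : B.IsHermitian) (hV : complexSpan φ N V ≤ LinearMap.ker B.mulVecLin)
    (A : Matrix (Fin N) (Fin N) ℂ) : pairing (P * A * P + D) B = pairing A B := by
  obtain ⟨hBP, hBD⟩ := hDP.mul_eq B hV
  have hPB : P * B = B := by
    have := congrArg Matrix.conjTranspose hBP
    rwa [Matrix.conjTranspose_mul, hB.eq, hDP.isHermitian.eq] at this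
  have h1 : pairing D B = 0 := by
    rw [pairing_comm, pairing_apply, hBD]
    simp
  rw [map_add, LinearMap.add_apply, h1, add_zero, pairing_apply, pairing_apply, mul_assoc, hPB,
    mul_assoc, Matrix.trace_mul_comm, mul_assoc, hBP]

/-- The two kernels are the span of V and its orthogonal complement. -/
theorem IsAdapted.posDef_add (hDP : IsAdapted φ V D P) {B : Matrix (Fin N) (Fin N) ℂ}
    (hB : B.PosSemidef) (hV : LinearMap.ker B.mulVecLin = complexSpan φ N V) :
    (B + D).PosDef := by
  refine (posDef_iff_val (hB.1.add hDP.posSemidef.1)).2 fun x hx => ?_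
  rw [val_add]
  have h1 := (posSemidef_iff_val hB.1).1 hB x
  have h2 := (posSemidef_iff_val hDP.posSemidef.1).1 hDP.posSemidef x
  refine lt_of_le_of_ne (add_nonneg h1 h2) fun h0 => hx ?_
  have hB0 : B *ᵥ x = 0 := mulVec_eq_zero_of_val_eq_zero hB (by linarith)
  have hD0 : D *ᵥ x = 0 := mulVec_eq_zero_of_val_eq_zero hDP.posSemidef (by linarith)
  have hx : x ∈ complexSpan φ N V := by
    rw [← hV]
    exact hB0
  exact dotProduct_star_self_eq_zero.1 ((hDP.orthogonal x).1 hD0 x hx)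

theorem val_one_le (x : Fin N → ℂ) : val (1 : Matrix (Fin N) (Fin N) ℂ) x ≤ N * ‖x‖ ^ 2 := by
  have : val (1 : Matrix (Fin N) (Fin N) ℂ) x = ∑ i, ‖x i‖ ^ 2 := by
    rw [val, Matrix.one_mulVec, dotProduct, Complex.re_sum]
    refine Finset.sum_congr rfl fun i _ => ?_
    rw [Pi.star_apply, Complex.star_def, mul_comm, Complex.mul_conj, Complex.normSq_eq_norm_sq,
      Complex.ofReal_re]
  rw [this]
  calc ∑ i, ‖x i‖ ^ 2 ≤ ∑ _i : Fin N, ‖x‖ ^ 2 := Finset.sum_le_sum fun i _ =>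
        pow_le_pow_left₀ (norm_nonneg _) (norm_le_pi_norm x i) 2
    _ = _ := by simp

/-- The factor N compares the sup norm with the Hermitian norm: N M - α is positive semidefinite,
hence pairs nonnegatively with B. -/
theorem mul_trace_le_pairing {M B : Matrix (Fin N) (Fin N) ℂ} (hM : M.IsHermitian) {α : ℝ}
    (hα : 0 ≤ α) (hαM : ∀ x, α * ‖x‖ ^ 2 ≤ val M x) (hB : B.PosSemidef) :
    α * B.trace.re ≤ N * pairing M B := by
  have h1 : ((N : ℝ) • M - α • (1 : Matrix (Fin N) (Fin N) ℂ)).PosSemidef := by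
    refine (posSemidef_iff_val ((isHermitian_real_smul hM _).sub
      (isHermitian_real_smul Matrix.isHermitian_one _))).2 fun x => ?_
    rw [val_sub, val_smul, val_smul]
    have h2 := mul_le_mul_of_nonneg_left (val_one_le x) hα
    have h3 := mul_le_mul_of_nonneg_left (hαM x) (Nat.cast_nonneg (α := ℝ) N)
    linarith
  have h2 := pairing_nonneg h1 hB
  rw [map_sub, map_smul, map_smul, LinearMap.sub_apply, LinearMap.smul_apply,
    LinearMap.smul_apply, smul_eq_mul, smul_eq_mul, pairing_apply 1, one_mul] at h2
  linarith

theorem one_mem_ryshkov (h : IsImaginaryLattice φ) : (1 : Matrix (Fin N) (Fin N) ℂ) ∈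
    ryshkov φ N := by
  refine ⟨Matrix.isHermitian_one, fun x hx => ?_⟩
  obtain ⟨i, hi⟩ := Function.ne_iff.1 hx
  have h1 := h.one_le_norm hi
  rw [formValue_eq_val, val, Matrix.one_mulVec, dotProduct, Complex.re_sum]
  have h2 : ∀ j, (star (embInt φ N x) j * embInt φ N x j).re = ‖φ (x j)‖ ^ 2 := by
    intro j
    rw [Pi.star_apply, Complex.star_def, mul_comm, Complex.mul_conj, Complex.normSq_eq_norm_sq,
      Complex.ofReal_re]
    rfl
  simp_rw [h2]
  calc (1 : ℝ) ≤ ‖φ (x i)‖ ^ 2 := one_le_pow₀ h1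
    _ ≤ _ := Finset.single_le_sum (f := fun j => ‖φ (x j)‖ ^ 2) (fun _ _ => by positivity)
      (Finset.mem_univ i)

/-- The trace of the form adapted to `V` obtained from `A` is controlled by the value of `A` at
matrices with kernel `V`. -/
theorem IsAdapted.mul_trace_le (hDP : IsAdapted φ V D P) (h : IsImaginaryLattice φ)
    {A B : Matrix (Fin N) (Fin N) ℂ} (hA : A ∈ ryshkov φ N) (hB : B.IsHermitian)
    (hV : complexSpan φ N V ≤ LinearMap.ker B.mulVecLin) {α : ℝ} (hα : 0 ≤ α)
    (hαM : ∀ x, α * ‖x‖ ^ 2 ≤ val (B + D) x) :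
    α * (P * A * P + D).trace.re ≤ N * pairing A B + α * D.trace.re := by
  have hpsd : (Pᴴ * A * P).PosSemidef :=
    (posSemidef_of_mem_ryshkov h hA).conjTranspose_mul_mul_same P
  have hPAP : (P * A * P).PosSemidef := by rwa [hDP.isHermitian.eq] at hpsd
  have h1 := mul_trace_le_pairing (hB.add hDP.posSemidef.1) hα hαM hPAP
  have h2 : pairing D (P * A * P) = 0 := by
    rw [pairing_apply, mul_assoc, ← mul_assoc, hDP.mul_eq_zero]
    simp
  have h4 : pairing B D = 0 := by
    rw [pairing_apply, (hDP.mul_eq B hV).2]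
    simp
  have h3 : pairing B (P * A * P) = pairing A B := by
    rw [← hDP.pairing_eq hB hV A, map_add, LinearMap.add_apply, pairing_comm D, h4, add_zero,
      pairing_comm]
  rw [map_add, LinearMap.add_apply, h2, h3, add_zero] at h1
  rw [Matrix.trace_add, Complex.add_re, mul_add]
  linarith

/-- Voronoi's theorem: every element of the rational closure of the cone of positive definite
forms lies in a perfect cone. -/
theorem exists_isPerfect_mem_coneHull [NumberField F] (h : IsImaginaryLattice φ)
    {B : Matrix (Fin N) (Fin N) ℂ} (hB : B.PosSemidef) (hB0 : B ≠ 0)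
    (hV : LinearMap.ker B.mulVecLin = complexSpan φ N V) :
    ∃ A, IsPerfect φ N A ∧ B ∈ coneHull φ N (contacts φ N A) := by
  obtain ⟨D, P, hDP⟩ := exists_isAdapted h V
  obtain ⟨α, hα, hαM⟩ := exists_le_val (hDP.posDef_add hB hV)
  have hpair := fun A => hDP.pairing_eq hB.1 hV.ge A
  -- The competitors of the form PAP + D at which the pairing does not exceed that of the identity.
  -- Their traces are bounded, so T is compact, and a minimum on T is one on the whole polyhedron.
  set T : Set (Matrix (Fin N) (Fin N) ℂ) :=
    {A | A ∈ ryshkov φ N ∧ P * A * P + D = A ∧ pairing A B ≤ pairing 1 B} with hT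
  have hidem : ∀ A, P * (P * A * P + D) * P + D = P * A * P + D := by
    intro A
    rw [mul_add, add_mul, mul_assoc P D P, hDP.mul_eq_zero, mul_zero, add_zero]
    congr 1
    calc P * (P * A * P) * P = (P * P) * A * (P * P) := by simp only [mul_assoc]
      _ = _ := by rw [hDP.mul_self]
  have hcont : Continuous fun A => pairing A B := by
    simp_rw [pairing_comm _ B]
    exact continuous_pairing B
  have hTcomp : IsCompact T := by
    refine (isCompact_ryshkov_trace_le h ((N * pairing 1 B + α * D.trace.re) / α)
      (N := N)).of_isClosed_subset ?_ ?_
    · refine isClosed_ryshkov.inter (IsClosed.inter (isClosed_eq (by fun_prop) continuous_id)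
        (isClosed_le hcont continuous_const))
    · rintro A ⟨hA, hAP, hAB⟩
      refine ⟨hA, ?_⟩
      have h1 := hDP.mul_trace_le h hA hB.1 hV.ge hα.le hαM
      rw [hAP] at h1
      rw [le_div_iff₀ hα, mul_comm]
      have := mul_le_mul_of_nonneg_left hAB (Nat.cast_nonneg (α := ℝ) N)
      linarith
  obtain ⟨A, hAT, hmin⟩ := hTcomp.exists_isMinOn ⟨P * 1 * P + D,
    hDP.mul_mul_add_mem_ryshkov h (one_mem_ryshkov h), hidem 1, (hpair 1).le⟩ hcont.continuousOn
  have hA := hAT.1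
  have hminR : ∀ A' ∈ ryshkov φ N, pairing A B ≤ pairing A' B := by
    intro A' hA'
    by_cases hle : pairing A' B ≤ pairing 1 B
    · rw [← hpair A'] at hle ⊢
      exact hmin (show P * A' * P + D ∈ T from
        ⟨hDP.mul_mul_add_mem_ryshkov h hA', hidem A', hle⟩)
    · exact hAT.2.2.trans (not_le.1 hle).le
  have hpos : 0 < pairing A B := by
    obtain ⟨γ, hγ, hγA⟩ := exists_le_val (posDef_of_mem_ryshkov h hA)
    have h1 := mul_trace_le_pairing hA.1 hγ.le hγA hB
    have h2 : 0 < B.trace.re := by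
      refine lt_of_le_of_ne (Complex.le_def.1 hB.trace_nonneg).1 fun h0 => hB0 ?_
      exact hB.trace_eq_zero_iff.1 (Complex.ext h0.symm (Complex.le_def.1 hB.trace_nonneg).2.symm)
    by_contra hle
    have h3 := mul_nonpos_of_nonneg_of_nonpos (Nat.cast_nonneg (α := ℝ) N) (not_lt.1 hle)
    have h4 := mul_pos hγ h2
    linarith
  set m := pairing A B with hm
  have hmem : m⁻¹ • B ∈ convexHull ℝ (q φ N '' contacts φ N A) := by
    by_contra hnot
    have hfin : (q φ N '' contacts φ N A).Finite := (finite_contacts h hA).image _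
    obtain ⟨f, u, hfu, hf⟩ := geometric_hahn_banach_point_closed
      (convex_convexHull ℝ (q φ N '' contacts φ N A)) (hfin.isClosed_convexHull ℝ) hnot
    obtain ⟨R, hR, hRf⟩ := exists_isHermitian_pairing_eq f.toLinearMap
    have hRu : (R - u • A).IsHermitian := hR.sub (isHermitian_real_smul hA.1 u)
    -- The functional f exceeds u on the contact matrices and is below u at B/m. So R - uA is
    -- positive on the contacts but pairs negatively with B: a small move along it stays in the
    -- polyhedron and contradicts the minimality of A.
    obtain ⟨ε, hε, hmem⟩ := exists_add_smul_mem_ryshkov h hA hRu fun x hx => by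
      have h1 := hf _ (subset_convexHull ℝ _ ⟨x, hx, rfl⟩)
      have h2 := hRf _ (posSemidef_q (φ := φ) x).1
      rw [pairing_q] at h2
      rw [formValue_eq_val, val_sub, val_smul, ← formValue_eq_val, ← formValue_eq_val, hx.2, ← h2]
      simpa using h1.le
    have h1 := hminR _ hmem
    have h2 : pairing R B < u * m := by
      rw [← hRf B hB.1]
      have h3 : f (m⁻¹ • B) = m⁻¹ * f B := by rw [map_smul, smul_eq_mul]
      rw [h3, inv_mul_lt_iff₀ hpos] at hfu
      rw [mul_comm]
      exact hfu
    rw [map_add, map_smul, map_sub, map_smul, LinearMap.add_apply, LinearMap.smul_apply,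
      LinearMap.sub_apply, LinearMap.smul_apply, smul_eq_mul, smul_eq_mul, ← hm] at h1
    nlinarith
  have hne : (contacts φ N A).Nonempty := by
    rw [← Set.image_nonempty (f := q φ N), ← convexHull_nonempty_iff (𝕜 := ℝ)]
    exact ⟨_, hmem⟩
  obtain ⟨A', hA', hsub⟩ := exists_isPerfect_contacts_subset h hA hne
  refine ⟨A', hA', coneHull_mono hsub ?_⟩
  have h1 : m⁻¹ • B ∈ coneHull φ N (contacts φ N A) := by
    refine convexHull_min ?_ (convex_coneHull _) hmem
    rintro _ ⟨x, hx, rfl⟩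
    exact q_mem_coneHull hx
  have h2 := smul_mem_coneHull h1 hpos.le
  rwa [smul_smul, mul_inv_cancel₀ hpos.ne', one_smul] at h2

end Fundamental

/-! ### Finiteness: discreteness of the values of perfect forms -/

section FiniteCovering

variable {F : Type*} [Field F] {φ : F →+* ℂ} {N : ℕ}

theorem eq_zero_of_pairing_eq_zero {R : Matrix (Fin N) (Fin N) ℂ} (hR : R.IsHermitian)
    (h : ∀ X, X.IsHermitian → pairing R X = 0) : R = 0 :=
  eq_zero_of_val_eq_zero hR fun x => by
    rw [val_eq_pairing]
    exact h _ (isHermitian_vecMulVec_star x)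

theorem IsPerfect.eq_zero_of_formValue_eq_zero {A R : Matrix (Fin N) (Fin N) ℂ}
    (hA : IsPerfect φ N A) (hR : R.IsHermitian)
    (h : ∀ v ∈ contacts φ N A, formValue φ N R v = 0) : R = 0 :=
  eq_zero_of_pairing_eq_zero hR fun X hX => pairing_eq_zero_of_mem_span h (by
    rw [hA.span_eq]
    exact hX)

/-- A functional z* vanishing on the contacts makes the rank one form z z* vanish there, and a
Hermitian form vanishing on the contacts of a perfect form is zero. -/
theorem IsPerfect.span_contacts_eq_top {A : Matrix (Fin N) (Fin N) ℂ} (hA : IsPerfect φ N A) :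
    Submodule.span ℂ (embInt φ N '' contacts φ N A) = ⊤ := by
  by_contra hne
  obtain ⟨f, hf, hker⟩ := Submodule.exists_le_ker_of_lt_top _ (lt_top_iff_ne_top.2 hne)
  set z : Fin N → ℂ := fun i => star (f (Pi.single i 1)) with hz
  have hfz : ∀ x, f x = star z ⬝ᵥ x := by
    intro x
    rw [LinearMap.pi_apply_eq_sum_univ f x, dotProduct]
    refine Finset.sum_congr rfl fun i _ => ?_
    rw [Pi.star_apply, hz, star_star, smul_eq_mul, mul_comm]
    congr 2
    ext j
    simp [Pi.single_apply, eq_comm]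
  have h0 : Matrix.vecMulVec z (star z) = 0 := by
    refine hA.eq_zero_of_formValue_eq_zero (isHermitian_vecMulVec_star z) fun v hv => ?_
    have h1 : f (embInt φ N v) = 0 := hker (Submodule.subset_span ⟨v, hv, rfl⟩)
    rw [formValue_eq_val, val_vecMulVec, ← hfz, h1, norm_zero, zero_pow two_ne_zero]
  refine hf (LinearMap.ext fun x => ?_)
  have h2 := val_vecMulVec z x
  rw [h0, val, Matrix.zero_mulVec, dotProduct_zero, Complex.zero_re] at h2
  rw [hfz, LinearMap.zero_apply]
  simpa using h2.symm

/-- The matrix with the given lattice vectors as columns. -/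
def columnMatrix (φ : F →+* ℂ) (u : Fin N → Fin N → 𝓞 F) : Matrix (Fin N) (Fin N) ℂ :=
  Matrix.of fun i k => embInt φ N (u k) i

/-- The linear combination of lattice vectors with given integral coefficients. -/
def columnCombination (u : Fin N → Fin N → 𝓞 F) (c : Fin N → 𝓞 F) : Fin N → 𝓞 F :=
  fun i => ∑ k, u k i * c k

theorem columnMatrix_mulVec (u : Fin N → Fin N → 𝓞 F) (z : Fin N → ℂ) :
    columnMatrix φ u *ᵥ z = ∑ k, z k • embInt φ N (u k) := by
  ext i
  rw [Matrix.mulVec, dotProduct, Finset.sum_apply]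
  exact Finset.sum_congr rfl fun k _ => mul_comm (embInt φ N (u k) i) (z k)

theorem embInt_columnCombination (u : Fin N → Fin N → 𝓞 F) (c : Fin N → 𝓞 F) :
    embInt φ N (columnCombination u c) = columnMatrix φ u *ᵥ embInt φ N c := by
  ext i
  change (φ.comp (algebraMap (𝓞 F) F)) (∑ k, u k i * c k) = _
  rw [map_sum]
  exact Finset.sum_congr rfl fun k _ => map_mul _ _ _

theorem IsPerfect.exists_columnMatrix {A : Matrix (Fin N) (Fin N) ℂ} (hA : IsPerfect φ N A) :
    ∃ u : Fin N → Fin N → 𝓞 F, (∀ k, u k ∈ contacts φ N A) ∧ IsUnit (columnMatrix φ u) := by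
  obtain ⟨b, hb, hspan, hli⟩ := exists_linearIndependent ℂ (embInt φ N '' contacts φ N A)
  rw [hA.span_contacts_eq_top] at hspan
  let B : Module.Basis b ℂ (Fin N → ℂ) := Module.Basis.mk hli (by simp [hspan])
  let e : b ≃ Fin N := B.indexEquiv (Pi.basisFun ℂ (Fin N))
  choose u hu hue using fun k : Fin N => hb (e.symm k).2
  refine ⟨u, hu, Matrix.mulVec_surjective_iff_isUnit.1 fun y => ⟨(B.reindex e).repr y, ?_⟩⟩
  rw [columnMatrix_mulVec]
  conv_rhs => rw [← (B.reindex e).sum_repr y]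
  refine Finset.sum_congr rfl fun k _ => ?_
  rw [hue, Module.Basis.reindex_apply, Module.Basis.mk_apply]

/-- The diagonal entries are the values A[u k] = 1. In the coordinates given by its own contact
vectors, a perfect form thus lies in a fixed compact part of the polyhedron. -/
theorem trace_conj_columnMatrix {A : Matrix (Fin N) (Fin N) ℂ} {u : Fin N → Fin N → 𝓞 F}
    (hu : ∀ k, u k ∈ contacts φ N A) :
    ((columnMatrix φ u)ᴴ * A * columnMatrix φ u).trace.re = N := by
  have h1 : ∀ k, (((columnMatrix φ u)ᴴ * A * columnMatrix φ u) k k).re = 1 := by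
    intro k
    have h2 : columnMatrix φ u *ᵥ Pi.single k 1 = embInt φ N (u k) := by
      rw [Matrix.mulVec_single_one]
      rfl
    rw [← (hu k).2, formValue_eq_val, ← h2, ← val_conj, val, Matrix.mulVec_single_one]
    have h3 : star (Pi.single k 1 : Fin N → ℂ) = Pi.single k 1 := by
      rw [Pi.star_single, star_one]
    rw [h3, single_one_dotProduct]
    rfl
  rw [Matrix.trace, Complex.re_sum]
  simp [h1]

theorem conj_columnMatrix_mem_ryshkov {A : Matrix (Fin N) (Fin N) ℂ} (hA : A ∈ ryshkov φ N)
    {u : Fin N → Fin N → 𝓞 F} (hunit : IsUnit (columnMatrix φ u)) :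
    (columnMatrix φ u)ᴴ * A * columnMatrix φ u ∈ ryshkov φ N := by
  refine ⟨Matrix.isHermitian_conjTranspose_mul_mul _ hA.1, fun x hx => ?_⟩
  rw [formValue_eq_val, val_conj, ← embInt_columnCombination]
  refine hA.2 _ fun h0 => embInt_ne_zero (φ := φ) hx ?_
  refine Matrix.mulVec_injective_iff_isUnit.2 hunit ?_
  rw [← embInt_columnCombination, h0, embInt_zero, Matrix.mulVec_zero]

/-- The sublattice generated by minimal vectors has bounded exponent in the full lattice. -/
theorem exists_nsmul_eq_columnCombination (h : IsImaginaryLattice φ) (N : ℕ) :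
    ∃ d : ℕ, 0 < d ∧ ∀ (A : Matrix (Fin N) (Fin N) ℂ) (u : Fin N → Fin N → 𝓞 F),
      A ∈ ryshkov φ N → (∀ k, u k ∈ contacts φ N A) → IsUnit (columnMatrix φ u) →
      ∀ w, ∃ c, d • w = columnCombination u c := by
  obtain ⟨K, hK⟩ := exists_nsmul_approx h N
    (show (0 : ℝ) < 1 / ((N : ℝ) + 1) ^ 2 by positivity)
  -- The multiplier j ≤ K depends on w; K! is a multiple of all of them.
  refine ⟨K.factorial, K.factorial_pos, fun A u hA hu hunit w => ?_⟩
  have hinj := Matrix.mulVec_injective_iff_isUnit.2 hunit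
  obtain ⟨z, hz⟩ := Matrix.mulVec_surjective_iff_isUnit.2 hunit (embInt φ N w)
  obtain ⟨j, hj, hjK, c, hc⟩ := hK z
  have hA' := conj_columnMatrix_mem_ryshkov hA hunit
  -- The difference has coordinates of size less than 1/(N+1)² in the columns of u, and the
  -- conjugated form has entries bounded by its trace N. Its value is at most N³/(N+1)⁴ < 1, so this
  -- lattice vector is zero.
  have hw : j • w = columnCombination u c := by
    by_contra hne
    have h1 := hA.2 (j • w - columnCombination u c) (sub_ne_zero.2 hne)
    have h2 : embInt φ N (j • w - columnCombination u c) =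
        columnMatrix φ u *ᵥ ((j : ℝ) • z - embInt φ N c) := by
      rw [embInt_sub, embInt_nsmul, embInt_columnCombination, Matrix.mulVec_sub,
        Matrix.mulVec_smul]
      congr 2
      exact hz.symm
    rw [formValue_eq_val, h2, ← val_conj] at h1
    have h3 := abs_val_le (fun i j => norm_apply_le_trace (posSemidef_of_mem_ryshkov h hA') i j)
      ((j : ℝ) • z - embInt φ N c)
    rw [trace_conj_columnMatrix hu] at h3
    have h4 : ‖(j : ℝ) • z - embInt φ N c‖ ^ 2 ≤ (1 / ((N : ℝ) + 1) ^ 2) ^ 2 :=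
      pow_le_pow_left₀ (norm_nonneg _) hc.le 2
    have h5 : (N : ℝ) ^ 2 * N * ‖(j : ℝ) • z - embInt φ N c‖ ^ 2 ≤
        (N : ℝ) ^ 2 * N * (1 / ((N : ℝ) + 1) ^ 2) ^ 2 :=
      mul_le_mul_of_nonneg_left h4 (by positivity)
    have h6 : (N : ℝ) ^ 2 * N * (1 / ((N : ℝ) + 1) ^ 2) ^ 2 < 1 := by
      rw [div_pow, one_pow, mul_one_div, div_lt_one (by positivity)]
      have : (0 : ℝ) ≤ N := Nat.cast_nonneg N
      nlinarith [pow_nonneg this 2, pow_nonneg this 3, pow_nonneg this 4]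
    have h7 := le_abs_self (val ((columnMatrix φ u)ᴴ * A * columnMatrix φ u)
      ((j : ℝ) • z - embInt φ N c))
    linarith
  obtain ⟨m, hm⟩ := Nat.dvd_factorial hj hjK
  refine ⟨m • c, ?_⟩
  rw [hm, mul_comm, mul_smul, hw]
  ext i
  simp [columnCombination, Finset.mul_sum, mul_left_comm]

/-- A set of forms of bounded trace in the Ryshkov polyhedron which are determined by the lattice
vectors on which they take a given value is finite. -/
theorem finite_determined (h : IsImaginaryLattice φ) (N : ℕ) (C r : ℝ) :
    {A | A ∈ ryshkov φ N ∧ A.trace.re ≤ C ∧ ∀ R : Matrix (Fin N) (Fin N) ℂ, R.IsHermitian →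
      (∀ c, formValue φ N A c = r → formValue φ N R c = 0) → R = 0}.Finite := by
  obtain ⟨α, hα, H⟩ := exists_le_val_of_trace_le h N C
  have hfin : {x : Fin N → 𝓞 F | α * ‖embInt φ N x‖ ^ 2 ≤ r}.Finite := by
    refine (finite_norm_embInt_le h (Real.sqrt (r / α))).subset fun x hx => ?_
    refine Real.le_sqrt_of_sq_le ?_
    rw [le_div_iff₀ hα, mul_comm]
    exact hx
  -- A form in this set is determined by its level set at r, and all these level sets lie in one
  -- finite set of vectors.
  refine Set.Finite.of_finite_image (f := fun A => {c | formValue φ N A c = r})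
    (hfin.finite_subsets.subset ?_) ?_
  · rintro _ ⟨A, hA, rfl⟩ x hx
    exact (H A hA.1 hA.2.1 _).trans_eq hx
  · intro A hA A' hA' heq
    have := hA.2.2 (A - A') (hA.1.1.sub hA'.1.1) fun c hc => by
      have hc' : c ∈ {c | formValue φ N A' c = r} := by
        rw [← show {c | formValue φ N A c = r} = {c | formValue φ N A' c = r} from heq]
        exact hc
      rw [formValue_eq_val, val_sub, ← formValue_eq_val, ← formValue_eq_val, hc, hc', sub_self]
    exact sub_eq_zero.1 this

/-- The values of perfect forms at a given lattice vector form a discrete set. -/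
theorem finite_perfect_values_le (h : IsImaginaryLattice φ) (w : Fin N → 𝓞 F) (C : ℝ) :
    {r | r ≤ C ∧ ∃ A, IsPerfect φ N A ∧ formValue φ N A w = r}.Finite := by
  obtain ⟨d, hd, H⟩ := exists_nsmul_eq_columnCombination h N
  have hd' : (0 : ℝ) < d := by exact_mod_cast hd
  -- In the coordinates u, the vectors d·v with v a contact become integral of value d², and they
  -- determine the form. So finitely many forms arise, and the value at w is the value of one of
  -- them at an integral vector, divided by d².
  have hfin := finite_determined h N N ((d : ℝ) ^ 2)
  refine (hfin.biUnion (t := fun A => (fun c => formValue φ N A c / (d : ℝ) ^ 2) ''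
    {c | formValue φ N A c ≤ (d : ℝ) ^ 2 * C}) fun A hA =>
    (finite_formValue_le h (posDef_of_mem_ryshkov h hA.1) _).image _).subset ?_
  rintro _ ⟨hC, A, hA, rfl⟩
  obtain ⟨u, hu, hunit⟩ := hA.exists_columnMatrix
  have hcoord : ∀ v, ∃ c, formValue φ N ((columnMatrix φ u)ᴴ * A * columnMatrix φ u) c =
      (d : ℝ) ^ 2 * formValue φ N A v ∧
      (d : ℝ) • embInt φ N v = columnMatrix φ u *ᵥ embInt φ N c := by
    intro v
    obtain ⟨c, hc⟩ := H A u hA.mem_ryshkov hu hunit v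
    have h1 : (d : ℝ) • embInt φ N v = columnMatrix φ u *ᵥ embInt φ N c := by
      rw [← embInt_nsmul, hc, embInt_columnCombination]
    refine ⟨c, ?_, h1⟩
    rw [formValue_eq_val, val_conj, ← h1, val_smul_right, formValue_eq_val]
  obtain ⟨c, hc, -⟩ := hcoord w
  refine Set.mem_biUnion (x := (columnMatrix φ u)ᴴ * A * columnMatrix φ u)
    ⟨conj_columnMatrix_mem_ryshkov hA.mem_ryshkov hunit, (trace_conj_columnMatrix hu).le, ?_⟩
    ⟨c, ?_, ?_⟩
  · intro R hR hRc
    obtain ⟨U, hU⟩ := hunit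
    have hinv : (↑U⁻¹ : Matrix (Fin N) (Fin N) ℂ) * columnMatrix φ u = 1 := by
      rw [← hU]
      exact U.inv_mul
    set W : Matrix (Fin N) (Fin N) ℂ := ↑U⁻¹ with hW
    -- Transported back by the inverse of the column matrix, R vanishes on the contacts of A.
    have h0 : Wᴴ * R * W = 0 := by
      refine hA.eq_zero_of_formValue_eq_zero (Matrix.isHermitian_conjTranspose_mul_mul _ hR)
        fun v hv => ?_
      obtain ⟨c, hc, hcv⟩ := hcoord v
      rw [hv.2, mul_one] at hc
      have h1 := hRc c hc
      have h2 : (d : ℝ) • W *ᵥ embInt φ N v = embInt φ N c := by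
        rw [← Matrix.mulVec_smul, hcv, Matrix.mulVec_mulVec, hinv, Matrix.one_mulVec]
      rw [formValue_eq_val, ← h2, val_smul_right, ← val_conj] at h1
      exact (mul_eq_zero.1 h1).resolve_left (by positivity)
    calc R = (W * columnMatrix φ u)ᴴ * R * (W * columnMatrix φ u) := by
          rw [hinv, Matrix.conjTranspose_one, one_mul, mul_one]
      _ = (columnMatrix φ u)ᴴ * (Wᴴ * R * W) * columnMatrix φ u := by
          rw [Matrix.conjTranspose_mul]
          simp only [mul_assoc]
      _ = 0 := by rw [h0, mul_zero, zero_mul]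
  · rw [Set.mem_ofPred_eq, hc]
    exact mul_le_mul_of_nonneg_left hC (by positivity)
  · change _ / _ = _
    rw [hc, mul_div_cancel_left₀ _ (by positivity)]

/-- A strictly descending sequence would stay below its first term, in a finite set. -/
theorem isPWO_of_finite_le {s : Set ℝ} (hs : ∀ C, (s ∩ Set.Iic C).Finite) : s.IsPWO := by
  rw [Set.isPWO_iff_isWF, Set.isWF_iff_no_descending_seq]
  intro f hf hmem
  refine Set.infinite_of_injective_forall_mem hf.injective (fun n => ?_) (hs (f 0))
  exact ⟨hmem n, hf.antitone (Nat.zero_le n)⟩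

/-- A rational polyhedral cone is covered by finitely many perfect cones. -/
theorem exists_finite_cover [NumberField F] (h : IsImaginaryLattice φ)
    {T : Set (Fin N → 𝓞 F)} (hT : T.Finite) :
    ∃ S : Set (Matrix (Fin N) (Fin N) ℂ), S.Finite ∧ (∀ A ∈ S, IsPerfect φ N A) ∧
      ∀ B ∈ coneHull φ N T, B ≠ 0 → ∃ A ∈ S, B ∈ coneHull φ N (contacts φ N A) := by
  have : Finite T := hT
  set ev : Matrix (Fin N) (Fin N) ℂ → T → ℝ := fun A w => formValue φ N A w with hev
  set Z : Set (T → ℝ) := ev '' {A | IsPerfect φ N A} with hZ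
  -- Dickson's argument: a finite product of well-ordered sets of reals is partially well ordered,
  -- so the antichain of minimal elements is finite.
  have hpwo : Z.IsPWO := by
    refine (Set.IsPWO.pi (s := fun w : T => {r | ∃ A, IsPerfect φ N A ∧ formValue φ N A w = r})
      fun w => isPWO_of_finite_le fun C => (finite_perfect_values_le h (w : Fin N → 𝓞 F) C).subset
        fun r hr => ⟨hr.2, hr.1⟩).mono ?_
    rintro _ ⟨A, hA, rfl⟩ w -
    exact ⟨A, hA, rfl⟩
  have hfin : {z | Minimal (· ∈ Z) z}.Finite :=
    (setOfPred_minimal_antichain _).finite_of_partiallyWellOrderedOn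
      (hpwo.mono fun z hz => hz.prop)
  choose! g hg hgz using fun (z : T → ℝ) (hz : z ∈ Z) => hz
  refine ⟨g '' {z | Minimal (· ∈ Z) z}, hfin.image g, ?_, fun B hB hB0 => ?_⟩
  · rintro _ ⟨z, hz, rfl⟩
    exact hg z hz.prop
  · obtain ⟨S, hS⟩ := hasRationalKernel_of_mem_coneHull h hB
    rw [← complexSpan_span] at hS
    obtain ⟨A, hA, hBA⟩ :=
      exists_isPerfect_mem_coneHull h (posSemidef_of_mem_coneHull hB) hB0 hS
    obtain ⟨z, hzA, hz⟩ := hpwo.exists_le_minimal (a := ev A) ⟨A, hA, rfl⟩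
    -- A perfect form with smaller values on T pairs with B at most as A does; since A minimizes
    -- this pairing, B is in the cone of the new form as well.
    refine ⟨g z, ⟨z, hz, rfl⟩, coneHull_mono Set.inter_subset_right
      (mem_coneHull_inter subset_rfl (hg z hz.prop).mem_ryshkov hBA ?_)⟩
    obtain ⟨c, hc, hs, rfl⟩ := hB
    rw [pairing_finsupp_sum, pairing_finsupp_sum]
    refine Finset.sum_le_sum fun v hv => mul_le_mul_of_nonneg_left ?_ (hc v)
    have h1 := hzA ⟨v, hs hv⟩
    rw [← hgz z hz.prop] at h1
    exact h1

end FiniteCovering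

/-! ### Compact convex sets as balls -/

section ConvexGeometry

variable {E : Type*} [AddCommGroup E] [Module ℝ E]

/-- The relative interior of a convex set, described by supporting functionals: points at which a
linear functional is minimal only if it is constant. -/
def relint (K : Set E) : Set E :=
  {x | x ∈ K ∧ ∀ f : E →ₗ[ℝ] ℝ, (∀ y ∈ K, f x ≤ f y) → ∀ y ∈ K, f y = f x}

theorem finrank_vectorSpan_lt [FiniteDimensional ℝ E] {K K' : Set E} (hK : K' ⊆ K) {x y : E}
    (hx : x ∈ K') (hy : y ∈ K) {f : E →ₗ[ℝ] ℝ} (hf : ∀ z ∈ K', f z = f x) (hfy : f y ≠ f x) :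
    Module.finrank ℝ (vectorSpan ℝ K') < Module.finrank ℝ (vectorSpan ℝ K) := by
  refine Submodule.finrank_lt_finrank_of_lt (lt_of_le_of_ne (vectorSpan_mono ℝ hK) fun heq => ?_)
  have h1 : vectorSpan ℝ K' ≤ LinearMap.ker f := by
    rw [vectorSpan_def, Submodule.span_le]
    rintro _ ⟨a, ha, b, hb, rfl⟩
    change f (a - b) = 0
    rw [map_sub, hf a ha, hf b hb, sub_self]
  have h2 : y -ᵥ x ∈ vectorSpan ℝ K' := by
    rw [heq]
    exact vsub_mem_vectorSpan ℝ hy (hK hx)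
  have h3 := h1 h2
  rw [LinearMap.mem_ker, vsub_eq_sub, map_sub, sub_eq_zero] at h3
  exact hfy h3

variable [TopologicalSpace E] [IsTopologicalAddGroup E] [ContinuousSMul ℝ E] [T2Space E]
  [FiniteDimensional ℝ E]

/-- A compact convex set is parametrized by the closed ball of its dimension, its relative interior
corresponding to the open ball. -/
theorem exists_ball_parametrization {K : Set E} (hconv : Convex ℝ K) (hcomp : IsCompact K)
    (hne : K.Nonempty) {n : ℕ} (hn : Module.finrank ℝ (vectorSpan ℝ K) = n) :
    ∃ (g : (Fin n → ℝ) → E) (r : E → Fin n → ℝ), Continuous g ∧ Continuous r ∧ (∀ x, r (g x) = x) ∧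
      g '' Metric.closedBall 0 1 = K ∧ g '' Metric.ball 0 1 = relint K := by
  obtain ⟨p, hp⟩ := hne
  let L : (Fin n → ℝ) ≃L[ℝ] vectorSpan ℝ K :=
    ContinuousLinearEquiv.ofFinrankEq (by rw [hn, Module.finrank_fin_fun])
  obtain ⟨ρ, hρ⟩ := (vectorSpan ℝ K).subtype.exists_leftInverse_of_injective
    (Submodule.ker_subtype _)
  have hρ' : ∀ y : vectorSpan ℝ K, ρ y = y := fun y => LinearMap.congr_fun hρ y
  have hρc : Continuous ρ := ρ.continuous_of_finiteDimensional
  -- An affine chart of the affine span of K; in it K becomes a convex body with nonempty interior,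
  -- homeomorphic to the ball.
  let a : (Fin n → ℝ) →ᵃ[ℝ] E :=
    ((vectorSpan ℝ K).subtype ∘ₗ (L : (Fin n → ℝ) →ₗ[ℝ] vectorSpan ℝ K)).toAffineMap +
      AffineMap.const ℝ _ p
  have ha : ∀ x, a x = (L x : E) + p := fun x => rfl
  have hac : Continuous a := by
    change Continuous fun x => (L x : E) + p
    fun_prop
  let b : E → Fin n → ℝ := fun y => L.symm (ρ (y - p))
  have hb : Continuous b := by
    change Continuous fun y => L.symm (ρ (y - p))
    fun_prop
  have hba : ∀ x, b (a x) = x := fun x => by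
    change L.symm (ρ (a x - p)) = x
    rw [ha, add_sub_cancel_right, hρ', L.symm_apply_apply]
  have hab : ∀ y ∈ K, a (b y) = y := fun y hy => by
    have h1 : y - p ∈ vectorSpan ℝ K := vsub_mem_vectorSpan ℝ hy hp
    rw [ha]
    change (L (L.symm (ρ ((⟨y - p, h1⟩ : vectorSpan ℝ K) : E))) : E) + p = y
    rw [hρ', L.apply_symm_apply, sub_add_cancel]
  set K' : Set (Fin n → ℝ) := a ⁻¹' K with hK'
  have haK : a '' K' = K := by
    refine Set.Subset.antisymm (Set.image_preimage_subset _ _) fun y hy => ⟨b y, ?_, hab y hy⟩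
    rw [hK', Set.mem_preimage, hab y hy]
    exact hy
  have hconv' : Convex ℝ K' := hconv.affine_preimage a
  have hcomp' : IsCompact K' := by
    have : K' = b '' K := by
      rw [← haK, Set.image_image]
      simp [hba]
    rw [this]
    exact hcomp.image hb
  have hspan : vectorSpan ℝ K' = ⊤ := by
    have h1 := a.map_vectorSpan (s := K')
    rw [haK] at h1
    rw [eq_top_iff]
    intro x _
    obtain ⟨z, hz, hzx⟩ := h1.ge (L x).2
    have h3 : a.linear z = (L z : E) := by
      change (L z : E) + 0 = L z
      rw [add_zero]
    rw [h3] at hzx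
    rwa [← L.injective (Subtype.ext hzx)]
  have hne' : K'.Nonempty := ⟨b p, by rw [hK', Set.mem_preimage, hab p hp]; exact hp⟩
  have hint : (interior K').Nonempty := by
    rw [hconv'.interior_nonempty_iff_affineSpan_eq_top,
      AffineSubspace.affineSpan_eq_top_iff_vectorSpan_eq_top_of_nonempty _ _ _ hne', hspan]
  obtain ⟨h, hball, hclosed, -⟩ :=
    exists_homeomorph_image_interior_closure_frontier_eq_unitBall hconv' hint hcomp'.isBounded
  rw [hcomp'.isClosed.closure_eq] at hclosed
  have himage : ∀ s : Set (Fin n → ℝ), (a ∘ h.symm) '' (h '' s) = a '' s := fun s => by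
    rw [← Set.image_comp]
    congr 1
    ext x
    simp
  refine ⟨a ∘ h.symm, h ∘ b, hac.comp h.symm.continuous, h.continuous.comp hb, fun x => ?_, ?_, ?_⟩
  · simp [hba]
  · rw [← hclosed, himage, haK]
  rw [← hball, himage]
  refine Set.Subset.antisymm ?_ ?_
  · rintro _ ⟨x, hx, rfl⟩
    refine ⟨interior_subset (s := K') hx, fun f hf y hy => ?_⟩
    rw [← haK] at hy
    -- From an interior point one can move slightly beyond x, away from z; minimality of the
    -- functional at x then forces equality at z.
    obtain ⟨z, hz, rfl⟩ := hy
    have hcont : Continuous fun ε : ℝ => x + ε • (x - z) := by fun_prop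
    have hmem : ∀ᶠ ε : ℝ in nhdsWithin 0 (Set.Ioi 0), x + ε • (x - z) ∈ K' :=
      nhdsWithin_le_nhds (hcont.continuousAt.preimage_mem_nhds (by
        simpa using mem_interior_iff_mem_nhds.1 hx))
    obtain ⟨ε, hε, hε0⟩ := (hmem.and self_mem_nhdsWithin).exists
    have hε0 : 0 < ε := hε0
    have h1 := hf _ hε
    have h2 : a (x + ε • (x - z)) = a x + ε • (a x - a z) := by
      rw [ha, ha, ha, map_add, map_smul, map_sub]
      push_cast
      rw [add_sub_add_right_eq_sub]
      abel
    rw [h2, map_add, map_smul, map_sub, smul_eq_mul] at h1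
    have h3 : 0 ≤ f (a x) - f (a z) := by
      by_contra hneg
      have := mul_neg_of_pos_of_neg hε0 (not_le.1 hneg)
      linarith
    exact le_antisymm (by linarith) (hf _ hz)
  · rintro y ⟨hy, hyf⟩
    rw [← haK] at hy
    obtain ⟨x, hx, rfl⟩ := hy
    refine ⟨x, ?_, rfl⟩
    by_contra hnot
    obtain ⟨f, hf⟩ := geometric_hahn_banach_open_point hconv'.interior isOpen_interior hnot
    have hle : ∀ z ∈ K', f z ≤ f x := by
      intro z hz
      have h1 : z ∈ closure (interior K') := by
        rw [hconv'.closure_interior_eq_closure_of_nonempty_interior hint]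
        exact subset_closure hz
      exact closure_minimal (fun w hw => (hf w hw).le)
        (isClosed_le f.continuous continuous_const) h1
    -- The supporting functional at a non-interior point, carried back by the chart with its sign
    -- reversed: it is minimal at that point but not constant.
    let G : E →ₗ[ℝ] ℝ := -((f : (Fin n → ℝ) →ₗ[ℝ] ℝ) ∘ₗ (L.symm : vectorSpan ℝ K →ₗ[ℝ] _) ∘ₗ ρ)
    have hG : ∀ z, G (a z) = -f z + G p := by
      intro z
      change -f (L.symm (ρ (a z))) = -f z + -f (L.symm (ρ p))
      rw [ha, map_add, hρ', map_add, L.symm_apply_apply, map_add]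
      ring
    obtain ⟨w, hw⟩ := hint
    have h1 := hyf G (fun y hy => by
      rw [← haK] at hy
      obtain ⟨z, hz, rfl⟩ := hy
      rw [hG, hG]
      have := hle z hz
      linarith) (a w) (interior_subset (s := K') hw)
    rw [hG, hG] at h1
    have := hf w hw
    linarith

end ConvexGeometry

/-! ### Representatives of trace 1 -/

section NormalizedRepresentative

variable {F : Type*} [Field F] {φ : F →+* ℂ} {N : ℕ}

theorem trace_re_pos {B : Matrix (Fin N) (Fin N) ℂ} (hB : B.PosSemidef) (h0 : B ≠ 0) :
    0 < B.trace.re := by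
  have h1 := Complex.le_def.1 hB.trace_nonneg
  exact lt_of_le_of_ne h1.1 fun h => h0 (hB.trace_eq_zero_iff.1 (Complex.ext h.symm h1.2.symm))

theorem trace_re_smul (t : ℝ) (B : Matrix (Fin N) (Fin N) ℂ) :
    (t • B).trace.re = t * B.trace.re := by
  rw [Matrix.trace_smul, Complex.smul_re, smul_eq_mul]

theorem pairing_one (B : Matrix (Fin N) (Fin N) ℂ) : pairing 1 B = B.trace.re := by
  rw [pairing_apply, one_mul]

theorem ker_real_smul {t : ℝ} (ht : t ≠ 0) (B : Matrix (Fin N) (Fin N) ℂ) :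
    LinearMap.ker (t • B).mulVecLin = LinearMap.ker B.mulVecLin := by
  ext x
  simp [ht]

/-- The representative of trace `1` of an element of `X^*_N`. -/
def normRep (x : XStar φ N) : Matrix (Fin N) (Fin N) ℂ :=
  Quotient.lift (s := homothety φ N) (fun B : CStar φ N => (B.1.trace.re)⁻¹ • B.1) (by
    rintro A B ⟨t, ht, h⟩
    rw [h, trace_re_smul, smul_smul, mul_inv, mul_right_comm, inv_mul_cancel₀ ht.ne', one_mul]) x

theorem normRep_proj (B : CStar φ N) : normRep (proj φ N B) = (B.1.trace.re)⁻¹ • B.1 := rfl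

theorem exists_rep (x : XStar φ N) :
    ∃ B : CStar φ N, proj φ N B = x ∧ B.1 = normRep x ∧ B.1.trace.re = 1 := by
  obtain ⟨B, rfl⟩ : ∃ B, proj φ N B = x := Quotient.exists_rep x
  have hpos := trace_re_pos B.2.1 B.2.2.1
  have hinv := inv_pos.2 hpos
  refine ⟨⟨(B.1.trace.re)⁻¹ • B.1, B.2.1.smul hinv.le, smul_ne_zero hinv.ne' B.2.2.1, ?_⟩, ?_, rfl,
    ?_⟩
  · obtain ⟨S, hS⟩ := B.2.2.2
    exact ⟨S, by rw [ker_real_smul hinv.ne', hS]⟩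
  · refine Quotient.sound (s := homothety φ N) ⟨B.1.trace.re, hpos, ?_⟩
    rw [smul_smul, mul_inv_cancel₀ hpos.ne', one_smul]
  · rw [trace_re_smul, inv_mul_cancel₀ hpos.ne']

theorem normRep_injective : Function.Injective (normRep (φ := φ) (N := N)) := by
  intro x y hxy
  obtain ⟨B, rfl, hB, -⟩ := exists_rep x
  obtain ⟨B', rfl, hB', -⟩ := exists_rep y
  rw [← hB, ← hB'] at hxy
  rw [Subtype.ext hxy]

theorem posSemidef_normRep (x : XStar φ N) : (normRep x).PosSemidef := by
  obtain ⟨B, -, hB, -⟩ := exists_rep x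
  exact hB ▸ B.2.1

theorem normRep_ne_zero (x : XStar φ N) : normRep x ≠ 0 := by
  obtain ⟨B, -, hB, -⟩ := exists_rep x
  exact hB ▸ B.2.2.1

theorem trace_normRep (x : XStar φ N) : (normRep x).trace.re = 1 := by
  obtain ⟨B, -, hB, hB1⟩ := exists_rep x
  exact hB ▸ hB1

theorem exists_ker_normRep (x : XStar φ N) :
    ∃ V : Submodule F (Fin N → F), LinearMap.ker (normRep x).mulVecLin = complexSpan φ N V := by
  obtain ⟨B, -, hB, -⟩ := exists_rep x
  obtain ⟨S, hS⟩ := B.2.2.2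
  exact ⟨Submodule.span F S, by rw [complexSpan_span, ← hS, hB]⟩

theorem ker_normRep_proj (B : CStar φ N) :
    LinearMap.ker (normRep (proj φ N B)).mulVecLin = LinearMap.ker B.1.mulVecLin := by
  rw [normRep_proj, ker_real_smul (inv_pos.2 (trace_re_pos B.2.1 B.2.2.1)).ne']

theorem exists_normRep_eq (h : IsImaginaryLattice φ) {M : Set (Fin N → 𝓞 F)}
    {B : Matrix (Fin N) (Fin N) ℂ} (hB : B ∈ coneHull φ N M) (hB1 : B.trace.re = 1) :
    ∃ x : XStar φ N, normRep x = B := by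
  have h0 : B ≠ 0 := by
    rintro rfl
    simp at hB1
  refine ⟨proj φ N ⟨B, posSemidef_of_mem_coneHull hB, h0, hasRationalKernel_of_mem_coneHull h hB⟩,
    ?_⟩
  rw [normRep_proj]
  simp [hB1]

/-- The usual topology is induced by the representatives of trace `1`. -/
theorem usualTopology_eq :
    usualTopology φ N = TopologicalSpace.induced (normRep (φ := φ) (N := N)) inferInstance := by
  refine le_antisymm ?_ fun U hU => ?_
  · rw [← continuous_iff_le_induced, continuous_coinduced_dom]
    change Continuous fun B : CStar φ N => (B.1.trace.re)⁻¹ • B.1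
    have h1 : Continuous fun B : CStar φ N => B.1.trace.re :=
      Complex.continuous_re.comp (Continuous.matrix_trace continuous_subtype_val)
    exact (h1.inv₀ fun B => (trace_re_pos B.2.1 B.2.2.1).ne').smul continuous_subtype_val
  · obtain ⟨W, hW, hWU⟩ := isOpen_induced_iff.1 (isOpen_coinduced.1 hU)
    refine isOpen_induced_iff.2 ⟨W, hW, Set.ext fun x => ?_⟩
    obtain ⟨B, rfl, hB, -⟩ := exists_rep x
    have h1 : B ∈ Subtype.val ⁻¹' W ↔ B ∈ proj φ N ⁻¹' U := by rw [hWU]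
    rw [Set.mem_preimage, ← hB]
    exact h1

theorem mem_sigma_iff {A : Matrix (Fin N) (Fin N) ℂ} (hA : IsPerfect φ N A) {x : XStar φ N} :
    x ∈ sigma φ N A ↔ normRep x ∈ coneHull φ N (contacts φ N A) := by
  rw [sigma, hA.minimalVectors_eq]
  constructor
  · rintro ⟨B, hB, rfl⟩
    exact smul_mem_coneHull hB.2 (inv_pos.2 (trace_re_pos B.2.1 B.2.2.1)).le
  · intro hx
    obtain ⟨B, rfl, hB, -⟩ := exists_rep x
    exact ⟨B, ⟨B.2.2.1, hB ▸ hx⟩, rfl⟩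

end NormalizedRepresentative

/-! ### Perfect cells, their faces and minimal cells -/

section Cells

variable {F : Type*} [Field F] {φ : F →+* ℂ} {N : ℕ}

variable (φ N) in
/-- The matrices of trace `1` in the cone generated by the `q v`, `v ∈ M`. -/
def slice (M : Set (Fin N → 𝓞 F)) : Set (Matrix (Fin N) (Fin N) ℂ) :=
  {B | B ∈ coneHull φ N M ∧ B.trace.re = 1}

theorem convex_slice (M : Set (Fin N → 𝓞 F)) : Convex ℝ (slice φ N M) := by
  refine (convex_coneHull M).inter fun A hA B hB a b _ _ hab => ?_
  change A.trace.re = 1 at hA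
  change B.trace.re = 1 at hB
  change (a • A + b • B).trace.re = 1
  rw [Matrix.trace_add, Complex.add_re, trace_re_smul, trace_re_smul, hA, hB, mul_one, mul_one, hab]

theorem trace_q_pos {v : Fin N → 𝓞 F} (hv : v ≠ 0) : 0 < (q φ N v).trace.re := by
  refine trace_re_pos (posSemidef_q v) ?_
  rw [q, Ne, Matrix.vecMulVec_eq_zero, star_eq_zero, or_self]
  exact embInt_ne_zero hv

/-- The weight of each normalized generator in a convex combination is the trace of its term. The
slice is therefore a polytope when M is finite. -/
theorem slice_eq_convexHull {M : Set (Fin N → 𝓞 F)} (hM : ∀ v ∈ M, v ≠ 0) :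
    slice φ N M = convexHull ℝ ((fun v => ((q φ N v).trace.re)⁻¹ • q φ N v) '' M) := by
  refine Set.Subset.antisymm ?_ (convexHull_min ?_ (convex_slice M))
  · rintro _ ⟨⟨c, hc, hs, rfl⟩, htr⟩
    rw [Finsupp.sum, Matrix.trace_sum, Complex.re_sum] at htr
    have h1 : (c.sum fun v r => r • q φ N v) = ∑ v ∈ c.support,
        (c v • q φ N v).trace.re • (((q φ N v).trace.re)⁻¹ • q φ N v) := by
      refine Finset.sum_congr rfl fun v hv => ?_
      rw [trace_re_smul, smul_smul, mul_assoc, mul_inv_cancel₀ (trace_q_pos (hM v (hs hv))).ne',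
        mul_one]
    rw [h1]
    refine (convex_convexHull ℝ _).sum_mem (fun v hv => ?_) htr fun v hv =>
      subset_convexHull ℝ _ ⟨v, hs hv, rfl⟩
    rw [trace_re_smul]
    exact mul_nonneg (hc v) (trace_q_pos (hM v (hs hv))).le
  · rintro _ ⟨v, hv, rfl⟩
    have h1 := trace_q_pos (φ := φ) (hM v hv)
    exact ⟨smul_mem_coneHull (q_mem_coneHull hv) (inv_pos.2 h1).le, by
      rw [trace_re_smul, inv_mul_cancel₀ h1.ne']⟩

theorem isCompact_slice {M : Set (Fin N → 𝓞 F)} (hM : ∀ v ∈ M, v ≠ 0) (hfin : M.Finite) :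
    IsCompact (slice φ N M) := by
  rw [slice_eq_convexHull hM]
  exact (hfin.image _).isCompact_convexHull ℝ

theorem pairing_eq_of_mem_coneHull {A A' B : Matrix (Fin N) (Fin N) ℂ}
    (hA : A ∈ ryshkov φ N) (hA' : A' ∈ ryshkov φ N) (hB : B ∈ coneHull φ N (contacts φ N A))
    (hB' : B ∈ coneHull φ N (contacts φ N A')) : pairing A B = pairing A' B :=
  le_antisymm (pairing_le_of_mem_coneHull hA' hB) (pairing_le_of_mem_coneHull hA hB')

/-- Intersections of finitely many perfect cones are faces, cut out by the barycenter of the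
corresponding forms. -/
theorem exists_barycenter {S : Set (Matrix (Fin N) (Fin N) ℂ)} (hS : S.Finite) (hne : S.Nonempty)
    (hR : S ⊆ ryshkov φ N) :
    ∃ A₀ ∈ ryshkov φ N, (∀ A ∈ S, contacts φ N A₀ ⊆ contacts φ N A) ∧
      ∀ B, (∀ A ∈ S, B ∈ coneHull φ N (contacts φ N A)) ↔
        B ∈ coneHull φ N (contacts φ N A₀) := by
  obtain ⟨S, rfl⟩ := hS.exists_finset_coe
  have hcard : (0 : ℝ) < S.card := by
    exact_mod_cast Finset.card_pos.2 (Finset.coe_nonempty.1 hne)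
  -- Since every form is at least 1 on nonzero lattice vectors, the average equals 1 exactly at the
  -- common contacts. Forms whose cones contain B have equal pairings with B, so their average has
  -- the same one.
  set A₀ : Matrix (Fin N) (Fin N) ℂ := (S.card : ℝ)⁻¹ • ∑ A ∈ S, A with hA₀
  have hpair : ∀ B, S.card * pairing A₀ B = ∑ A ∈ S, pairing A B := by
    intro B
    rw [hA₀, map_smul, map_sum, LinearMap.smul_apply, LinearMap.sum_apply, smul_eq_mul,
      mul_inv_cancel_left₀ hcard.ne']
  have hA₀R : A₀ ∈ ryshkov φ N := by
    refine ⟨isHermitian_real_smul ?_ _, fun x hx => ?_⟩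
    · exact (hermitianSubmodule N).sum_mem fun A hA => (hR hA).1
    · have h1 : ∑ A ∈ S, (1 : ℝ) ≤ ∑ A ∈ S, pairing A (q φ N x) :=
        Finset.sum_le_sum fun A hA => by
          rw [pairing_q]
          exact (hR hA).2 x hx
      rw [← hpair, pairing_q, Finset.sum_const, nsmul_eq_mul, mul_one] at h1
      exact le_of_mul_le_mul_left (by rwa [mul_one]) hcard
  have hsub : ∀ A ∈ S, contacts φ N A₀ ⊆ contacts φ N A := by
    intro A hA x hx
    have h1 : ∑ A ∈ S, (1 : ℝ) = ∑ A ∈ S, pairing A (q φ N x) := by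
      rw [← hpair, pairing_q, hx.2]
      simp
    have h2 := (Finset.sum_eq_sum_iff_of_le fun A hA => by
      rw [pairing_q]
      exact (hR hA).2 x hx.1).1 h1 A hA
    rw [pairing_q] at h2
    exact ⟨hx.1, h2.symm⟩
  refine ⟨A₀, hA₀R, hsub, fun B => ⟨fun hB => ?_, fun hB A hA => coneHull_mono (hsub A hA) hB⟩⟩
  obtain ⟨A, hA⟩ := hne
  refine coneHull_mono Set.inter_subset_right
    (mem_coneHull_inter subset_rfl hA₀R (hB A hA) (le_of_eq ?_))
  refine mul_left_cancel₀ hcard.ne' ?_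
  rw [hpair, Finset.sum_congr rfl fun A' hA' =>
    pairing_eq_of_mem_coneHull (hR hA') (hR hA) (hB A' hA') (hB A hA)]
  simp

/-- A closed cell is the set of classes of matrices in the cone of a form in the Ryshkov
polyhedron. -/
theorem exists_form_of_mem_closedCells {τ : Set (XStar φ N)} (hτ : τ ∈ closedCells φ N) :
    ∃ A₀ ∈ ryshkov φ N, ∀ x, x ∈ τ ↔ normRep x ∈ coneHull φ N (contacts φ N A₀) := by
  obtain ⟨-, S, hS, hne, hperf, rfl⟩ := hτ
  obtain ⟨A₀, hA₀, -, H⟩ := exists_barycenter hS hne fun A hA => (hperf A hA).mem_ryshkov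
  refine ⟨A₀, hA₀, fun x => ?_⟩
  rw [← H, Set.mem_iInter₂]
  exact forall₂_congr fun A hA => mem_sigma_iff (hperf A hA)

theorem image_normRep_eq_slice (h : IsImaginaryLattice φ) {τ : Set (XStar φ N)}
    {M : Set (Fin N → 𝓞 F)} (hτ : ∀ x, x ∈ τ ↔ normRep x ∈ coneHull φ N M) :
    normRep '' τ = slice φ N M := by
  ext B
  constructor
  · rintro ⟨x, hx, rfl⟩
    exact ⟨(hτ x).1 hx, trace_normRep x⟩
  · rintro ⟨hB, hB1⟩
    obtain ⟨x, rfl⟩ := exists_normRep_eq h hB hB1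
    exact ⟨x, (hτ x).2 hB, rfl⟩

theorem isCompact_image_normRep (h : IsImaginaryLattice φ) {τ : Set (XStar φ N)}
    (hτ : τ ∈ closedCells φ N) : IsCompact (normRep '' τ) := by
  obtain ⟨A₀, hA₀, H⟩ := exists_form_of_mem_closedCells hτ
  rw [image_normRep_eq_slice h H]
  exact isCompact_slice (fun v hv => hv.1) (finite_contacts h hA₀)

theorem convex_image_normRep (h : IsImaginaryLattice φ) {τ : Set (XStar φ N)}
    (hτ : τ ∈ closedCells φ N) : Convex ℝ (normRep '' τ) := by
  obtain ⟨A₀, hA₀, H⟩ := exists_form_of_mem_closedCells hτ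
  rw [image_normRep_eq_slice h H]
  exact convex_slice _

variable (φ N) in
/-- The intersection of all cells of perfect forms containing a point. -/
def minimalCell (x : XStar φ N) : Set (XStar φ N) :=
  {y | ∀ A, IsPerfect φ N A → x ∈ sigma φ N A → y ∈ sigma φ N A}

theorem self_mem_minimalCell (x : XStar φ N) : x ∈ minimalCell φ N x := fun _ _ hx => hx

theorem minimalCell_subset {τ : Set (XStar φ N)} (hτ : τ ∈ closedCells φ N) {x : XStar φ N}
    (hx : x ∈ τ) : minimalCell φ N x ⊆ τ := by
  obtain ⟨-, S, hS, hne, hperf, rfl⟩ := hτ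
  rw [Set.mem_iInter₂] at hx
  exact fun y hy => Set.mem_iInter₂.2 fun A hA => hy A (hperf A hA) (hx A hA)

theorem exists_mem_sigma [NumberField F] (h : IsImaginaryLattice φ) (x : XStar φ N) :
    ∃ A, IsPerfect φ N A ∧ x ∈ sigma φ N A := by
  obtain ⟨V, hV⟩ := exists_ker_normRep x
  obtain ⟨A, hA, hx⟩ :=
    exists_isPerfect_mem_coneHull h (posSemidef_normRep x) (normRep_ne_zero x) hV
  exact ⟨A, hA, (mem_sigma_iff hA).2 hx⟩

theorem mem_coneHull_contacts_inter {A A' : Matrix (Fin N) (Fin N) ℂ} (hA : IsPerfect φ N A)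
    (hA' : IsPerfect φ N A') {x : XStar φ N} (hx : x ∈ sigma φ N A) (hx' : x ∈ sigma φ N A') :
    normRep x ∈ coneHull φ N (contacts φ N A ∩ contacts φ N A') := by
  rw [mem_sigma_iff hA] at hx
  rw [mem_sigma_iff hA'] at hx'
  exact mem_coneHull_inter subset_rfl hA'.mem_ryshkov hx
    (pairing_eq_of_mem_coneHull hA'.mem_ryshkov hA.mem_ryshkov hx' hx).le

/-- The perfect cells through x may be infinitely many. Inside a fixed one, of form A₀, the
intersection with the cell of A depends only on the common contacts of A₀ and A, and A₀ has finitely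
many sets of contacts. -/
theorem minimalCell_mem_closedCells [NumberField F] (h : IsImaginaryLattice φ) (x : XStar φ N) :
    minimalCell φ N x ∈ closedCells φ N := by
  obtain ⟨A₀, hA₀, hx₀⟩ := exists_mem_sigma h x
  set 𝒯 : Set (Set (Fin N → 𝓞 F)) :=
    (fun A => contacts φ N A₀ ∩ contacts φ N A) '' {A | IsPerfect φ N A ∧ x ∈ sigma φ N A} with h𝒯
  have hfin : 𝒯.Finite := by
    refine (finite_contacts h hA₀.mem_ryshkov).finite_subsets.subset ?_
    rintro _ ⟨A, -, rfl⟩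
    exact Set.inter_subset_left
  choose! g hg hg' using fun (M : Set (Fin N → 𝓞 F)) (hM : M ∈ 𝒯) => hM
  refine ⟨⟨x, self_mem_minimalCell x⟩, insert A₀ (g '' 𝒯), (hfin.image g).insert A₀,
    Set.insert_nonempty _ _, ?_, ?_⟩
  · rintro A (rfl | ⟨M, hM, rfl⟩)
    · exact hA₀
    · exact (hg M hM).1
  · refine Set.Subset.antisymm (fun y hy => Set.mem_iInter₂.2 ?_) fun y hy A hA hxA => ?_
    · rintro A (rfl | ⟨M, hM, rfl⟩)
      · exact hy _ hA₀ hx₀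
      · exact hy _ (hg M hM).1 (hg M hM).2
    · rw [Set.mem_iInter₂] at hy
      have hM : contacts φ N A₀ ∩ contacts φ N A ∈ 𝒯 := ⟨A, ⟨hA, hxA⟩, rfl⟩
      have h1 := mem_coneHull_contacts_inter hA₀ (hg _ hM).1 (hy A₀ (Set.mem_insert _ _))
        (hy _ (Set.mem_insert_of_mem _ ⟨_, hM, rfl⟩))
      rw [mem_sigma_iff hA]
      refine coneHull_mono ?_ h1
      rw [show contacts φ N A₀ ∩ contacts φ N (g _) = _ from hg' _ hM]
      exact Set.inter_subset_right

/-- A closed cell having a given point in its relative interior is the minimal cell of that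
point. -/
theorem eq_minimalCell_of_mem_relint {τ : Set (XStar φ N)} (hτ : τ ∈ closedCells φ N)
    {x : XStar φ N} (hx : normRep x ∈ relint (normRep '' τ)) : τ = minimalCell φ N x := by
  have hxτ : x ∈ τ := normRep_injective.mem_set_image.1 hx.1
  refine Set.Subset.antisymm (fun y hy A' hA' hxA' => ?_) (minimalCell_subset hτ hxτ)
  obtain ⟨-, S, hS, ⟨A, hAS⟩, hperf, rfl⟩ := hτ
  have hA := hperf A hAS
  have hτA : ∀ z ∈ ⋂ A ∈ S, sigma φ N A, normRep z ∈ coneHull φ N (contacts φ N A) :=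
    fun z hz => (mem_sigma_iff hA).1 (Set.mem_iInter₂.1 hz A hAS)
  rw [mem_sigma_iff hA'] at hxA'
  have h0 : pairing (A' - A) (normRep x) = 0 := by
    rw [map_sub, LinearMap.sub_apply, sub_eq_zero]
    exact pairing_eq_of_mem_coneHull hA'.mem_ryshkov hA.mem_ryshkov hxA' (hτA x hxτ)
  -- The difference A' - A is nonnegative on τ and zero at x, hence zero on all of τ.
  have h1 := hx.2 (pairing (A' - A)) (by
    rintro _ ⟨z, hz, rfl⟩
    rw [h0, map_sub, LinearMap.sub_apply, sub_nonneg]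
    exact pairing_le_of_mem_coneHull hA'.mem_ryshkov (hτA z hz)) _ ⟨y, hy, rfl⟩
  rw [h0, map_sub, LinearMap.sub_apply, sub_eq_zero] at h1
  rw [mem_sigma_iff hA']
  exact coneHull_mono Set.inter_subset_right
    (mem_coneHull_inter subset_rfl hA'.mem_ryshkov (hτA y hy) h1.le)

theorem exists_formValue_pos {M : Set (Fin N → 𝓞 F)} {R B : Matrix (Fin N) (Fin N) ℂ}
    (hB : B ∈ coneHull φ N M) (hpos : 0 < pairing R B) : ∃ v ∈ M, 0 < formValue φ N R v := by
  obtain ⟨c, hc, hs, rfl⟩ := hB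
  rw [pairing_finsupp_sum] at hpos
  by_contra! hle
  exact hpos.not_ge (Finset.sum_nonpos fun v hv =>
    mul_nonpos_of_nonneg_of_nonpos (hc v) (hle v (hs hv)))

theorem nonempty_of_mem_coneHull {M : Set (Fin N → 𝓞 F)} {B : Matrix (Fin N) (Fin N) ℂ}
    (hB : B ∈ coneHull φ N M) (h0 : B ≠ 0) : M.Nonempty := by
  obtain ⟨c, hc, hs, rfl⟩ := hB
  by_contra hempty
  refine h0 (Finset.sum_eq_zero fun v hv => (hempty ⟨v, hs hv⟩).elim)

/-- Every point is in the relative interior of its minimal cell. -/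
theorem mem_relint_minimalCell [NumberField F] (h : IsImaginaryLattice φ) (x : XStar φ N) :
    normRep x ∈ relint (normRep '' minimalCell φ N x) := by
  refine ⟨⟨x, self_mem_minimalCell x, rfl⟩, fun f hf => ?_⟩
  by_contra! hne
  obtain ⟨_, ⟨y, hy, rfl⟩, hne⟩ := hne
  have hlt : f (normRep x) < f (normRep y) := lt_of_le_of_ne (hf _ ⟨y, hy, rfl⟩) hne.symm
  obtain ⟨R₁, hR₁, hR₁f⟩ := exists_isHermitian_pairing_eq f
  obtain ⟨A₀, hA₀, H⟩ := exists_form_of_mem_closedCells (minimalCell_mem_closedCells h x)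
  -- Subtracting a multiple of the trace turns the supporting functional into one vanishing at x,
  -- without changing its variation on matrices of trace 1.
  set R := R₁ - f (normRep x) • (1 : Matrix (Fin N) (Fin N) ℂ) with hRdef
  have hR : R.IsHermitian := hR₁.sub (isHermitian_real_smul Matrix.isHermitian_one _)
  have hRz : ∀ z : XStar φ N, pairing R (normRep z) = f (normRep z) - f (normRep x) := by
    intro z
    rw [hRdef, map_sub, map_smul, LinearMap.sub_apply, LinearMap.smul_apply, pairing_one,
      trace_normRep, ← hR₁f _ (posSemidef_normRep z).1, smul_eq_mul, mul_one]
  have hq : ∀ v ∈ contacts φ N A₀, ∃ z ∈ minimalCell φ N x,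
      normRep z = ((q φ N v).trace.re)⁻¹ • q φ N v := by
    intro v hv
    have hpos := trace_q_pos (φ := φ) hv.1
    have hmem : ((q φ N v).trace.re)⁻¹ • q φ N v ∈ coneHull φ N (contacts φ N A₀) :=
      smul_mem_coneHull (q_mem_coneHull hv) (inv_pos.2 hpos).le
    obtain ⟨z, hz⟩ := exists_normRep_eq h hmem (by rw [trace_re_smul, inv_mul_cancel₀ hpos.ne'])
    exact ⟨z, (H z).2 (hz ▸ hmem), hz⟩
  obtain ⟨ε, hε, hmem⟩ := exists_add_smul_mem_ryshkov h hA₀ hR fun v hv => by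
    obtain ⟨z, hz, hzq⟩ := hq v hv
    have h1 := hRz z
    rw [hzq, map_smul, pairing_q, smul_eq_mul] at h1
    have h2 := hf _ ⟨z, hz, rfl⟩
    rw [hzq] at h2
    have h3 := inv_pos.2 (trace_q_pos (φ := φ) hv.1)
    exact nonneg_of_mul_nonneg_right (by linarith) h3
  -- Tilting A₀ along R keeps x in the cone but makes v leave the contacts, and some perfect form A'
  -- still avoids v. The class of q v is in the minimal cell, hence in the cell of A', which forces
  -- A'[v] = 1, a contradiction.
  obtain ⟨v, hv, hvpos⟩ := exists_formValue_pos ((H y).1 hy) (by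
    rw [hRz]
    linarith : 0 < pairing R (normRep y))
  have hx₀ := (H x).1 (self_mem_minimalCell x)
  have hpairx : pairing (A₀ + ε • R) (normRep x) = pairing A₀ (normRep x) := by
    rw [map_add, map_smul, LinearMap.add_apply, LinearMap.smul_apply, hRz, sub_self, smul_zero,
      add_zero]
  have hx₁ : normRep x ∈ coneHull φ N (contacts φ N (A₀ + ε • R)) :=
    coneHull_mono Set.inter_subset_right (mem_coneHull_inter subset_rfl hmem hx₀ hpairx.le)
  obtain ⟨A', hA', hsub, hv'⟩ := exists_isPerfect_of_contacts h hmem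
    (nonempty_of_mem_coneHull hx₁ (normRep_ne_zero x)) (v := v) (by
      rw [formValue_eq_val, val_add, val_smul, ← formValue_eq_val, ← formValue_eq_val, hv.2]
      have := mul_pos hε hvpos
      linarith)
  obtain ⟨z, hz, hzq⟩ := hq v hv
  have hzA' := (mem_sigma_iff hA').1 (hz A' hA' ((mem_sigma_iff hA').2 (coneHull_mono hsub hx₁)))
  have h1 := pairing_eq_of_mem_coneHull hA'.mem_ryshkov hA₀ hzA' ((H z).1 hz)
  rw [hzq, map_smul, map_smul, pairing_q, pairing_q, hv.2, smul_eq_mul, smul_eq_mul] at h1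
  have h2 := mul_left_cancel₀ (inv_pos.2 (trace_q_pos (φ := φ) hv.1)).ne' h1
  exact hv'.ne' h2

/-- The dimension of a set of classes. -/
def cellDim (τ : Set (XStar φ N)) : ℕ := Module.finrank ℝ (vectorSpan ℝ (normRep '' τ))

/-- If τ sticks out of the cell of some A' containing x, then for A with τ in its cell, A' - A is
constant on the minimal cell but not on τ. -/
theorem cellDim_minimalCell_lt {τ : Set (XStar φ N)} (hτ : τ ∈ closedCells φ N)
    {x : XStar φ N} (hx : x ∈ τ) (hne : τ ≠ minimalCell φ N x) :
    cellDim (minimalCell φ N x) < cellDim τ := by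
  have hsub := minimalCell_subset hτ hx
  obtain ⟨y, hy, hyx⟩ := Set.exists_of_ssubset (lt_of_le_of_ne hsub hne.symm)
  simp only [minimalCell, Set.mem_ofPred_eq, not_forall] at hyx
  obtain ⟨A', hA', hxA', hyA'⟩ := hyx
  obtain ⟨-, S, hS, ⟨A, hAS⟩, hperf, rfl⟩ := hτ
  have hA := hperf A hAS
  have hτA : ∀ z ∈ ⋂ A ∈ S, sigma φ N A, normRep z ∈ coneHull φ N (contacts φ N A) :=
    fun z hz => (mem_sigma_iff hA).1 (Set.mem_iInter₂.1 hz A hAS)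
  have h0 : ∀ z ∈ minimalCell φ N x, pairing (A' - A) (normRep z) = 0 := by
    intro z hz
    rw [map_sub, LinearMap.sub_apply, sub_eq_zero]
    exact pairing_eq_of_mem_coneHull hA'.mem_ryshkov hA.mem_ryshkov
      ((mem_sigma_iff hA').1 (hz A' hA' hxA')) (hτA z (hsub hz))
  refine finrank_vectorSpan_lt (Set.image_mono hsub) ⟨x, self_mem_minimalCell x, rfl⟩
    ⟨y, hy, rfl⟩ (f := pairing (A' - A)) ?_ ?_
  · rintro _ ⟨z, hz, rfl⟩
    rw [h0 z hz, h0 x (self_mem_minimalCell x)]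
  · rw [h0 x (self_mem_minimalCell x), map_sub, LinearMap.sub_apply, sub_ne_zero]
    intro heq
    exact hyA' ((mem_sigma_iff hA').2 (coneHull_mono Set.inter_subset_right
      (mem_coneHull_inter subset_rfl hA'.mem_ryshkov (hτA y hy) heq.le)))

/-- A cell inside the cell of A is unchanged by intersecting with it, so it is given by a subset of
the finitely many contacts of A. -/
theorem finite_closedCells_subset (h : IsImaginaryLattice φ) {τ : Set (XStar φ N)}
    (hτ : τ ∈ closedCells φ N) : {τ' | τ' ∈ closedCells φ N ∧ τ' ⊆ τ}.Finite := by
  obtain ⟨-, S₀, -, ⟨A, hAS⟩, hperf₀, rfl⟩ := hτ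
  have hA := hperf₀ A hAS
  refine (((finite_contacts h hA.mem_ryshkov).finite_subsets).image
    fun M => {x : XStar φ N | normRep x ∈ coneHull φ N M}).subset ?_
  rintro τ' ⟨⟨-, S, hS, hne, hperf, rfl⟩, hsub⟩
  have hperf' : ∀ B ∈ insert A S, IsPerfect φ N B := by
    rintro B (rfl | hB)
    · exact hA
    · exact hperf B hB
  obtain ⟨A₀, -, hA₀, H⟩ := exists_barycenter (hS.insert A) (Set.insert_nonempty _ _)
    fun B hB => (hperf' B hB).mem_ryshkov
  refine ⟨contacts φ N A₀, hA₀ A (Set.mem_insert _ _), Set.ext fun x => ?_⟩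
  rw [Set.mem_ofPred_eq, ← H]
  constructor
  · intro hx
    exact Set.mem_iInter₂.2 fun B hB => (mem_sigma_iff (hperf B hB)).2
      (hx B (Set.mem_insert_of_mem _ hB))
  · intro hx B hB
    rw [← mem_sigma_iff (hperf' B hB)]
    rcases hB with rfl | hB
    · exact Set.mem_iInter₂.1 (hsub hx) B hAS
    · exact Set.mem_iInter₂.1 hx B hB

end Cells

/-! ### The weak topology and finite unions of cells -/

section WeakTopology

variable {F : Type*} [Field F] {φ : F →+* ℂ} {N : ℕ}

theorem cwTopology_le_usualTopology : cwTopology φ N ≤ usualTopology φ N :=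
  iSup_le fun _ => continuous_iff_coinduced_le.1 continuous_induced_dom

theorem isClosed_iff_forall_closedCells {Z : Set (XStar φ N)} :
    IsClosed Z ↔ ∀ τ ∈ closedCells φ N, ∃ C : Set (Matrix (Fin N) (Fin N) ℂ),
      IsClosed C ∧ Z ∩ τ = normRep ⁻¹' C ∩ τ := by
  have h1 : IsClosed Z ↔ ∀ τ : closedCells φ N, IsClosed[TopologicalSpace.induced
      (Subtype.val : τ.1 → XStar φ N) (usualTopology φ N)] (Subtype.val ⁻¹' Z) := by
    rw [instTopologicalSpaceXStar, isClosed_iSup_iff]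
    exact forall_congr' fun τ => isClosed_coinduced
  rw [h1, Subtype.forall]
  refine forall₂_congr fun τ hτ => ?_
  rw [usualTopology_eq, induced_compose, isClosed_induced_iff]
  refine exists_congr fun C => and_congr_right fun _ => ?_
  rw [Set.preimage_comp, Subtype.preimage_val_eq_preimage_val_iff, Set.inter_comm τ,
    Set.inter_comm τ, eq_comm]

theorem continuous_normRep : Continuous (normRep (φ := φ) (N := N)) := by
  rw [continuous_iff_le_induced, ← usualTopology_eq]
  exact cwTopology_le_usualTopology

instance t2Space_XStar : T2Space (XStar φ N) :=
  T2Space.of_injective_continuous normRep_injective continuous_normRep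

theorem isClosed_of_inter_closedCells {Z : Set (XStar φ N)}
    (hZ : ∀ τ ∈ closedCells φ N, IsClosed (Z ∩ τ)) : IsClosed Z := by
  rw [isClosed_iff_forall_closedCells]
  intro τ hτ
  obtain ⟨C, hC, h1⟩ := isClosed_iff_forall_closedCells.1 (hZ τ hτ) τ hτ
  exact ⟨C, hC, by rw [← h1, Set.inter_assoc, Set.inter_self]⟩

theorem isClosed_image_normRep_inter (h : IsImaginaryLattice φ) {Z τ : Set (XStar φ N)}
    (hZ : IsClosed Z) (hτ : τ ∈ closedCells φ N) : IsClosed (normRep '' (Z ∩ τ)) := by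
  obtain ⟨C, hC, h1⟩ := isClosed_iff_forall_closedCells.1 hZ τ hτ
  rw [h1, Set.inter_comm, Set.image_inter_preimage]
  exact (isCompact_image_normRep h hτ).isClosed.inter hC

/-- Maps into a finite union of closed cells are continuous for the weak topology as soon as they
are for the usual one. -/
theorem continuousOn_of_mapsTo_biUnion (h : IsImaginaryLattice φ) {Y : Type*} [TopologicalSpace Y]
    {f : Y → XStar φ N} {U : Set Y} (hf : ContinuousOn (fun y => normRep (f y)) U)
    {T : Set (Set (XStar φ N))} (hT : T.Finite) (hTc : T ⊆ closedCells φ N)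
    (hfT : ∀ y ∈ U, ∃ τ ∈ T, f y ∈ τ) : ContinuousOn f U := by
  rw [continuousOn_iff_continuous_domRestrict] at hf ⊢
  rw [continuous_iff_isClosed]
  intro Z hZ
  -- The preimage of Z is a finite union of preimages of sets Z ∩ τ, whose representatives form
  -- closed sets because each cell is compact.
  have h1 : U.domRestrict f ⁻¹' Z = ⋃ τ ∈ T,
      (U.domRestrict fun y => normRep (f y)) ⁻¹' (normRep '' (Z ∩ τ)) := by
    ext y
    simp only [Set.mem_preimage, Set.mem_iUnion, Set.domRestrict_apply, exists_prop,
      normRep_injective.mem_set_image]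
    constructor
    · intro hy
      obtain ⟨τ, hτ, hyτ⟩ := hfT y y.2
      exact ⟨τ, hτ, hy, hyτ⟩
    · rintro ⟨τ, hτ, hy, -⟩
      exact hy
  rw [h1]
  exact hT.isClosed_biUnion fun τ hτ =>
    (isClosed_image_normRep_inter h hZ (hTc hτ)).preimage hf

theorem continuous_of_forall_biUnion (h : IsImaginaryLattice φ) {Y : Type*} [TopologicalSpace Y]
    {f : Y → XStar φ N} (hf : Continuous fun y => normRep (f y))
    {T : Set (Set (XStar φ N))} (hT : T.Finite) (hTc : T ⊆ closedCells φ N)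
    (hfT : ∀ y, ∃ τ ∈ T, f y ∈ τ) : Continuous f :=
  continuousOn_univ.1
    (continuousOn_of_mapsTo_biUnion h hf.continuousOn hT hTc fun y _ => hfT y)

theorem sigma_mem_closedCells {A : Matrix (Fin N) (Fin N) ℂ} (hA : IsPerfect φ N A)
    (hne : (sigma φ N A).Nonempty) : sigma φ N A ∈ closedCells φ N :=
  ⟨hne, {A}, Set.finite_singleton A, Set.singleton_nonempty A, by simpa using hA, by simp⟩

/-- Classes of matrices in a rational polyhedral cone lie in finitely many closed cells. -/
theorem exists_finite_closedCells [NumberField F] (h : IsImaginaryLattice φ)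
    {M : Set (Fin N → 𝓞 F)} (hM : M.Finite) :
    ∃ T : Set (Set (XStar φ N)), T.Finite ∧ T ⊆ closedCells φ N ∧
      ∀ x : XStar φ N, normRep x ∈ coneHull φ N M → ∃ τ ∈ T, x ∈ τ := by
  obtain ⟨S, hS, hperf, H⟩ := exists_finite_cover h hM
  refine ⟨{τ | τ ∈ sigma φ N '' S ∧ τ.Nonempty}, (hS.image _).subset fun τ hτ => hτ.1, ?_, ?_⟩
  · rintro _ ⟨⟨A, hA, rfl⟩, hne⟩
    exact sigma_mem_closedCells (hperf A hA) hne
  · intro x hx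
    obtain ⟨A, hA, hxA⟩ := H _ hx (normRep_ne_zero x)
    have hmem := (mem_sigma_iff (hperf A hA)).2 hxA
    exact ⟨_, ⟨⟨A, hA, rfl⟩, ⟨x, hmem⟩⟩, hmem⟩

end WeakTopology

/-! ### The CW structure -/

section CWStructure

variable {F : Type*} [Field F] {φ : F →+* ℂ} {N : ℕ}

variable (φ N) in
/-- The cells of dimension `n`. -/
def Cell (n : ℕ) : Type := {τ : Set (XStar φ N) // τ ∈ closedCells φ N ∧ cellDim τ = n}

/-- The open cell of a closed cell: the points in its relative interior. -/
def openPart (τ : Set (XStar φ N)) : Set (XStar φ N) := {x | normRep x ∈ relint (normRep '' τ)}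

theorem exists_characteristicMap (h : IsImaginaryLattice φ) {n : ℕ} (e : Cell φ N n) :
    ∃ m : PartialEquiv (Fin n → ℝ) (XStar φ N), m.source = Metric.ball 0 1 ∧
      m.target = openPart e.1 ∧ ContinuousOn m (Metric.closedBall 0 1) ∧
      ContinuousOn m.symm m.target ∧ m '' Metric.closedBall 0 1 = e.1 ∧
      m '' Metric.ball 0 1 = openPart e.1 ∧ Set.InjOn m (Metric.closedBall 0 1) := by
  obtain ⟨τ, hτ, hdim⟩ := e
  obtain ⟨x₀, hx₀⟩ := hτ.1
  have : Nonempty (XStar φ N) := ⟨x₀⟩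
  obtain ⟨g, r, hg, hr, hrg, hgK, hgr⟩ := exists_ball_parametrization (convex_image_normRep h hτ)
    (isCompact_image_normRep h hτ) ⟨_, x₀, hx₀, rfl⟩ hdim
  -- Outside the closed ball, `g v` need not represent a class and `Function.invFun` may return an
  -- arbitrary point; only the closed ball matters.
  set f : (Fin n → ℝ) → XStar φ N := fun v => Function.invFun normRep (g v) with hf
  have hfg : ∀ v ∈ Metric.closedBall (0 : Fin n → ℝ) 1, normRep (f v) = g v := by
    intro v hv
    obtain ⟨x, -, hx⟩ : g v ∈ normRep '' τ := hgK ▸ ⟨v, hv, rfl⟩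
    exact Function.invFun_eq ⟨x, hx⟩
  have hball : ∀ v ∈ Metric.ball (0 : Fin n → ℝ) 1, normRep (f v) = g v :=
    fun v hv => hfg v (Metric.ball_subset_closedBall hv)
  have hsurj : ∀ x, normRep x ∈ g '' Metric.closedBall 0 1 →
      ∃ v ∈ Metric.closedBall (0 : Fin n → ℝ) 1, normRep x = g v ∧ f v = x := by
    rintro x ⟨v, hv, hvx⟩
    exact ⟨v, hv, hvx.symm, normRep_injective ((hfg v hv).trans hvx)⟩
  have himage : f '' Metric.closedBall 0 1 = τ := by
    ext x
    constructor
    · rintro ⟨v, hv, rfl⟩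
      rw [← normRep_injective.mem_set_image, hfg v hv, ← hgK]
      exact ⟨v, hv, rfl⟩
    · intro hx
      obtain ⟨v, hv, -, rfl⟩ := hsurj x (hgK ▸ ⟨x, hx, rfl⟩)
      exact ⟨v, hv, rfl⟩
  have himage' : f '' Metric.ball 0 1 = openPart τ := by
    ext x
    constructor
    · rintro ⟨v, hv, rfl⟩
      change normRep (f v) ∈ relint _
      rw [hball v hv, ← hgr]
      exact ⟨v, hv, rfl⟩
    · intro (hx : normRep x ∈ relint _)
      rw [← hgr] at hx
      obtain ⟨v, hv, hvx⟩ := hx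
      exact ⟨v, hv, normRep_injective ((hball v hv).trans hvx)⟩
  have hcont : ContinuousOn f (Metric.closedBall 0 1) := by
    refine continuousOn_of_mapsTo_biUnion h ((hg.continuousOn).congr hfg)
      (Set.finite_singleton τ) (by simpa using hτ) fun v hv => ⟨τ, rfl, ?_⟩
    rw [← himage]
    exact ⟨v, hv, rfl⟩
  have hinj : Set.InjOn f (Metric.closedBall 0 1) := by
    intro v hv w hw hvw
    have := congrArg (fun x => r (normRep x)) hvw
    simpa only [hfg v hv, hfg w hw, hrg] using this
  refine ⟨⟨f, fun x => r (normRep x), Metric.ball 0 1, openPart τ, ?_, ?_, ?_, ?_⟩, rfl, rfl,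
    hcont, ?_, himage, himage', hinj⟩
  · intro v hv
    rw [← himage']
    exact ⟨v, hv, rfl⟩
  · intro x hx
    rw [← himage'] at hx
    obtain ⟨v, hv, rfl⟩ := hx
    rwa [hball v hv, hrg]
  · intro v hv
    rw [hball v hv, hrg]
  · intro x hx
    rw [← himage'] at hx
    obtain ⟨v, hv, rfl⟩ := hx
    rw [hball v hv, hrg]
  · exact (hr.comp continuous_normRep).continuousOn

/-- A characteristic map of a cell. -/
def characteristicMap (h : IsImaginaryLattice φ) {n : ℕ} (e : Cell φ N n) :
    PartialEquiv (Fin n → ℝ) (XStar φ N) := (exists_characteristicMap h e).choose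

theorem characteristicMap_spec (h : IsImaginaryLattice φ) {n : ℕ} (e : Cell φ N n) :
    (characteristicMap h e).source = Metric.ball 0 1 ∧
      (characteristicMap h e).target = openPart e.1 ∧
      ContinuousOn (characteristicMap h e) (Metric.closedBall 0 1) ∧
      ContinuousOn (characteristicMap h e).symm (characteristicMap h e).target ∧
      characteristicMap h e '' Metric.closedBall 0 1 = e.1 ∧
      characteristicMap h e '' Metric.ball 0 1 = openPart e.1 ∧
      Set.InjOn (characteristicMap h e) (Metric.closedBall 0 1) :=
  (exists_characteristicMap h e).choose_spec

theorem image_characteristicMap_closedBall (h : IsImaginaryLattice φ) {n : ℕ} (e : Cell φ N n) :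
    characteristicMap h e '' Metric.closedBall 0 1 = e.1 :=
  (characteristicMap_spec h e).2.2.2.2.1

theorem image_characteristicMap_ball (h : IsImaginaryLattice φ) {n : ℕ} (e : Cell φ N n) :
    characteristicMap h e '' Metric.ball 0 1 = openPart e.1 :=
  (characteristicMap_spec h e).2.2.2.2.2.1

variable [NumberField F]

/-- The minimal cell of a point as a cell. -/
def minimalCellOf (h : IsImaginaryLattice φ) (x : XStar φ N) :
    Cell φ N (cellDim (minimalCell φ N x)) :=
  ⟨minimalCell φ N x, minimalCell_mem_closedCells h x, rfl⟩

/-- The cell structure of `X^*_N` given by perfect forms. -/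
@[reducible]
def cwComplex (h : IsImaginaryLattice φ) :
    Topology.CWComplex (Set.univ : Set (XStar φ N)) where
  cell := Cell φ N
  map _ e := characteristicMap h e
  source_eq _ e := (characteristicMap_spec h e).1
  continuousOn _ e := (characteristicMap_spec h e).2.2.1
  continuousOn_symm _ e := (characteristicMap_spec h e).2.2.2.1
  pairwiseDisjoint' := by
    rintro ⟨n, e⟩ - ⟨m, e'⟩ - hne
    rw [Function.onFun, image_characteristicMap_ball, image_characteristicMap_ball,
      Set.disjoint_left]
    intro x hx hx'
    apply hne
    -- A cell containing x in its relative interior is the minimal cell of x, so two open cells with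
    -- a common point coincide.
    have h1 : e.1 = e'.1 := (eq_minimalCell_of_mem_relint e.2.1 hx).trans
      (eq_minimalCell_of_mem_relint e'.2.1 hx').symm
    obtain ⟨τ, hτ, rfl⟩ := e
    obtain ⟨τ', hτ', rfl⟩ := e'
    obtain rfl : τ = τ' := h1
    rfl
  mapsTo' n e := by
    classical
    have hfin : ∀ m, Set.Finite {e' : Cell φ N m | e'.1 ⊆ e.1} := fun m =>
      Set.Finite.of_finite_image (f := Subtype.val)
        ((finite_closedCells_subset h e.2.1).subset (by
          rintro _ ⟨e', he', rfl⟩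
          exact ⟨e'.2.1, he'⟩)) Subtype.val_injective.injOn
    refine ⟨fun m => (hfin m).toFinset, fun v hv => ?_⟩
    have hmem : characteristicMap h e v ∈ e.1 := by
      rw [← image_characteristicMap_closedBall h e]
      exact ⟨v, Metric.sphere_subset_closedBall hv, rfl⟩
    set x := characteristicMap h e v with hx
    -- Otherwise x would also be the image of a point of the open ball, against injectivity on the
    -- closed ball. So the minimal cell of a boundary point has smaller dimension.
    have hnot : e.1 ≠ minimalCell φ N x := by
      intro heq
      have h1 : x ∈ openPart e.1 := by
        rw [heq]
        exact mem_relint_minimalCell h x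
      rw [← image_characteristicMap_ball h e] at h1
      obtain ⟨w, hw, hwx⟩ := h1
      have h2 := (characteristicMap_spec h e).2.2.2.2.2.2 (Metric.ball_subset_closedBall hw)
        (Metric.sphere_subset_closedBall hv) hwx
      rw [h2, Metric.mem_ball] at hw
      exact hw.ne hv
    have hlt := cellDim_minimalCell_lt e.2.1 hmem hnot
    rw [e.2.2] at hlt
    simp only [Set.mem_iUnion]
    refine ⟨_, hlt, minimalCellOf h x, ?_, ?_⟩
    · rw [Set.Finite.mem_toFinset]
      exact minimalCell_subset e.2.1 hmem
    · rw [image_characteristicMap_closedBall]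
      exact self_mem_minimalCell x
  closed' Z _ hZ := isClosed_of_inter_closedCells fun τ hτ => by
    have h1 : ∀ e : Cell φ N (cellDim τ), IsClosed (Z ∩ e.1) := fun e => by
      rw [← image_characteristicMap_closedBall h e]
      exact hZ _ e
    exact h1 ⟨τ, hτ, rfl⟩
  union' := by
    refine Set.eq_univ_of_forall fun x => Set.mem_iUnion₂.2 ⟨_, minimalCellOf h x, ?_⟩
    rw [image_characteristicMap_closedBall]
    exact self_mem_minimalCell x

theorem setOf_closedCell_eq (h : IsImaginaryLattice φ) :
    letI := cwComplex (N := N) h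
    {τ : Set (XStar φ N) | ∃ (n : ℕ)
      (e : Topology.RelCWComplex.cell (Set.univ : Set (XStar φ N)) n),
      τ = Topology.RelCWComplex.closedCell n e} = closedCells φ N := by
  ext τ
  constructor
  · rintro ⟨n, e, rfl⟩
    have h1 : characteristicMap h e '' Metric.closedBall 0 1 ∈ closedCells φ N := by
      rw [image_characteristicMap_closedBall]
      exact e.2.1
    exact h1
  · intro hτ
    exact ⟨_, (⟨τ, hτ, rfl⟩ : Cell φ N (cellDim τ)), (image_characteristicMap_closedBall h
      (⟨τ, hτ, rfl⟩ : Cell φ N (cellDim τ))).symm⟩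

end CWStructure

/-! ### Strata and their closures as subcomplexes -/

section Strata

variable {F : Type*} [Field F] {φ : F →+* ℂ} {N : ℕ} {V : Submodule F (Fin N → F)}

theorem mem_stratum_iff {x : XStar φ N} :
    x ∈ stratum φ V ↔ LinearMap.ker (normRep x).mulVecLin = complexSpan φ N V := by
  constructor
  · rintro ⟨B, hB, rfl⟩
    exact (ker_normRep_proj B).trans hB
  · intro hx
    obtain ⟨B, rfl, hB, -⟩ := exists_rep x
    exact ⟨B, by rwa [← hB] at hx, rfl⟩

theorem IsAdapted.posSemidef_proj {D P : Matrix (Fin N) (Fin N) ℂ} (hDP : IsAdapted φ V D P) :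
    P.PosSemidef := by
  have h1 := Matrix.posSemidef_conjTranspose_mul_self P
  rwa [hDP.isHermitian.eq, hDP.mul_self] at h1

theorem ker_add_of_posSemidef {A B : Matrix (Fin N) (Fin N) ℂ} (hA : A.PosSemidef)
    (hB : B.PosSemidef) : LinearMap.ker (A + B).mulVecLin =
      LinearMap.ker A.mulVecLin ⊓ LinearMap.ker B.mulVecLin := by
  ext x
  simp only [Submodule.mem_inf, LinearMap.mem_ker, Matrix.mulVecLin_apply]
  constructor
  · intro hx
    have h1 := val_eq_zero_of_mulVec_eq_zero hx
    rw [val_add] at h1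
    have h2 := (posSemidef_iff_val hA.1).1 hA x
    have h3 := (posSemidef_iff_val hB.1).1 hB x
    exact ⟨mulVec_eq_zero_of_val_eq_zero hA (by linarith),
      mulVec_eq_zero_of_val_eq_zero hB (by linarith)⟩
  · rintro ⟨hx, hx'⟩
    rw [Matrix.add_mulVec, hx, hx', add_zero]

theorem isClosed_setOf_le_ker (W : Submodule ℂ (Fin N → ℂ)) :
    IsClosed {B : Matrix (Fin N) (Fin N) ℂ | W ≤ LinearMap.ker B.mulVecLin} := by
  have h1 : {B : Matrix (Fin N) (Fin N) ℂ | W ≤ LinearMap.ker B.mulVecLin} =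
      ⋂ y ∈ W, {B | B *ᵥ y = 0} := by
    ext B
    simp [SetLike.le_def]
  rw [h1]
  exact isClosed_biInter fun y _ => isClosed_eq (by fun_prop) continuous_const

theorem complexSpan_ne_top (φ : F →+* ℂ) (hV : V ≠ ⊤) : complexSpan φ N V ≠ ⊤ := by
  classical
  obtain ⟨f, hf, hVf⟩ := V.exists_le_ker_of_lt_top hV.lt_top
  set g : (Fin N → ℂ) →ₗ[ℂ] ℂ := ∑ i, φ (f (Pi.single i 1)) • LinearMap.proj i with hg
  have hgemb : ∀ x, g (emb φ N x) = φ (f x) := by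
    intro x
    conv_rhs => rw [pi_eq_sum_univ' x]
    simp [hg, emb_apply, mul_comm, map_sum]
  have hle : complexSpan φ N V ≤ LinearMap.ker g := by
    refine Submodule.span_le.2 ?_
    rintro _ ⟨x, hx, rfl⟩
    change g (emb φ N x) = 0
    rw [hgemb, show f x = 0 from hVf hx, map_zero]
  intro htop
  rw [htop, top_le_iff, LinearMap.ker_eq_top] at hle
  refine hf (LinearMap.ext fun x => φ.injective ?_)
  rw [← hgemb, hle, LinearMap.zero_apply, LinearMap.zero_apply, map_zero]

variable [NumberField F]

/-- Containing V in the kernel is a closed condition. Conversely, adding εP, where P has kernel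
exactly V, approximates B by matrices with kernel exactly V. -/
theorem mem_closedStratum_iff (h : IsImaginaryLattice φ) {x : XStar φ N} :
    x ∈ closedStratum φ V ↔ complexSpan φ N V ≤ LinearMap.ker (normRep x).mulVecLin := by
  constructor
  · rintro ⟨B, hB, rfl⟩
    rw [ker_normRep_proj]
    exact closure_minimal (fun C (hC : _ = _) => hC.ge)
      ((isClosed_setOf_le_ker (complexSpan φ N V)).preimage continuous_subtype_val) hB
  · intro hx
    obtain ⟨B, rfl, hB, -⟩ := exists_rep x
    rw [← hB] at hx
    refine ⟨B, closure_subtype.2 ?_, rfl⟩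
    obtain ⟨D, P, hDP⟩ := exists_isAdapted h V
    have hcont : Continuous fun ε : ℝ => B.1 + ε • P := by fun_prop
    have hlim : Filter.Tendsto (fun ε : ℝ => B.1 + ε • P) (𝓝[>] 0) (𝓝 B.1) := by
      have := hcont.tendsto 0
      rw [zero_smul, add_zero] at this
      exact this.mono_left nhdsWithin_le_nhds
    refine mem_closure_of_tendsto hlim (Filter.eventually_of_mem self_mem_nhdsWithin
      fun ε (hε : 0 < ε) => ?_)
    have hP := hDP.posSemidef_proj.smul hε.le
    have hker : LinearMap.ker (B.1 + ε • P).mulVecLin = complexSpan φ N V := by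
      rw [ker_add_of_posSemidef B.2.1 hP, ker_real_smul hε.ne', hDP.ker, inf_eq_right.2 hx]
    have h0 : B.1 + ε • P ≠ 0 := by
      intro h0
      have h1 := trace_re_pos B.2.1 B.2.2.1
      have h2 := (Complex.le_def.1 hP.trace_nonneg).1
      have h3 := congrArg (fun M => (Matrix.trace M).re) h0
      simp only [Matrix.trace_add, Complex.add_re, Matrix.trace_zero, Complex.zero_re] at h2 h3
      linarith
    exact ⟨⟨_, B.2.1.add hP, h0, V, hker⟩, hker, rfl⟩

theorem isClosed_closedStratum (h : IsImaginaryLattice φ) (V : Submodule F (Fin N → F)) :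
    IsClosed (closedStratum φ V) := by
  have h1 : closedStratum φ V =
      normRep ⁻¹' {B | complexSpan φ N V ≤ LinearMap.ker B.mulVecLin} :=
    Set.ext fun x => mem_closedStratum_iff h
  rw [h1]
  exact (isClosed_setOf_le_ker _).preimage continuous_normRep

/-- For z in V, the functional B ↦ z* B z is nonnegative on the minimal cell and zero at x, which is
in its relative interior; so it vanishes on the whole cell. -/
theorem minimalCell_subset_closedStratum (h : IsImaginaryLattice φ) {x : XStar φ N}
    (hx : x ∈ closedStratum φ V) : minimalCell φ N x ⊆ closedStratum φ V := by
  rw [mem_closedStratum_iff h] at hx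
  intro y hy
  rw [mem_closedStratum_iff h]
  intro z hz
  have hxz := val_eq_zero_of_mulVec_eq_zero (hx hz)
  refine mulVec_eq_zero_of_val_eq_zero (posSemidef_normRep y) ?_
  have h1 := (mem_relint_minimalCell h x).2 (pairing (Matrix.vecMulVec z (star z))) (by
    rintro _ ⟨w, -, rfl⟩
    rw [pairing_comm, pairing_vecMulVec, hxz, pairing_comm, pairing_vecMulVec]
    exact (posSemidef_iff_val (posSemidef_normRep w).1).1 (posSemidef_normRep w) z) _ ⟨y, hy, rfl⟩
  rwa [pairing_comm, pairing_vecMulVec, pairing_comm, pairing_vecMulVec, hxz] at h1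

/-- The closure of a stratum as a subcomplex. -/
def subcomplex (h : IsImaginaryLattice φ) (V : Submodule F (Fin N → F)) :
    letI := cwComplex (N := N) h
    Topology.RelCWComplex.Subcomplex (Set.univ : Set (XStar φ N)) :=
  letI := cwComplex (N := N) h
  { carrier := closedStratum φ V
    I := fun n => {e : Cell φ N n | e.1 ⊆ closedStratum φ V}
    closed' := isClosed_closedStratum h V
    union' := by
      rw [Set.empty_union]
      ext x
      constructor
      · intro hx
        obtain ⟨n, ⟨e, he⟩, hx⟩ := Set.mem_iUnion₂.1 hx
        have h1 : x ∈ characteristicMap h e '' Metric.ball 0 1 := hx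
        rw [image_characteristicMap_ball] at h1
        exact he (normRep_injective.mem_set_image.1 h1.1)
      · intro hx
        refine Set.mem_iUnion₂.2
          ⟨_, ⟨minimalCellOf h x, minimalCell_subset_closedStratum h hx⟩, ?_⟩
        change x ∈ characteristicMap h (minimalCellOf h x) '' Metric.ball 0 1
        rw [image_characteristicMap_ball]
        exact mem_relint_minimalCell h x }

theorem nonempty_stratum (h : IsImaginaryLattice φ) (hV : V ≠ ⊤) :
    (stratum φ V).Nonempty := by
  obtain ⟨D, P, hDP⟩ := exists_isAdapted h V
  refine ⟨_, ⟨P, hDP.posSemidef_proj, ?_, V, hDP.ker⟩, hDP.ker, rfl⟩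
  rintro rfl
  apply complexSpan_ne_top φ hV
  rw [← hDP.ker, Matrix.mulVecLin_zero, LinearMap.ker_zero]

end Strata

/-! ### Contractibility of closed strata -/

section Contraction

variable {F : Type*} [Field F] {φ : F →+* ℂ} {N : ℕ}

/-- Continuity for the weak topology is checked on each cell, seen among matrices; `k` is g
expressed on representatives. -/
theorem continuous_of_forall_closedCells {Z : Type*} [TopologicalSpace Z] {g : XStar φ N → Z}
    {k : Matrix (Fin N) (Fin N) ℂ → Z} (hk : ∀ x, k (normRep x) = g x)
    (hg : ∀ τ ∈ closedCells φ N, ContinuousOn k (normRep '' τ)) : Continuous g := by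
  refine continuous_iff_isClosed.2 fun W hW => isClosed_iff_forall_closedCells.2 fun τ hτ => ?_
  obtain ⟨C, hC, h1⟩ := continuousOn_iff_isClosed.1 (hg τ hτ) W hW
  refine ⟨C, hC, Set.ext fun x => and_congr_left fun hx => ?_⟩
  have h2 := Set.ext_iff.1 h1 (normRep x)
  simp only [Set.mem_inter_iff, Set.mem_preimage, hk, Set.mem_image_of_mem normRep hx,
    and_true] at h2
  exact h2

variable [NumberField F]

/-- The straight line contraction to a point. -/
theorem exists_contraction (h : IsImaginaryLattice φ) (x₀ : XStar φ N) :
    ∃ H : unitInterval × XStar φ N → XStar φ N, Continuous H ∧ ∀ t x,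
      normRep (H (t, x)) = (1 - (t : ℝ)) • normRep x + (t : ℝ) • normRep x₀ := by
  have : Nonempty (XStar φ N) := ⟨x₀⟩
  obtain ⟨A₀, hA₀, hx₀⟩ := exists_mem_sigma h x₀
  rw [mem_sigma_iff hA₀] at hx₀
  have hmem : ∀ (M : Set (Fin N → 𝓞 F)) (x : XStar φ N) (t : unitInterval),
      normRep x ∈ coneHull φ N M → (1 - (t : ℝ)) • normRep x + (t : ℝ) • normRep x₀ ∈
        coneHull φ N (M ∪ contacts φ N A₀) := fun M x t hx =>
    convex_coneHull _ (coneHull_mono Set.subset_union_left hx)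
      (coneHull_mono Set.subset_union_right hx₀) (sub_nonneg.2 t.2.2) t.2.1 (by ring)
  have hex : ∀ (x : XStar φ N) (t : unitInterval), ∃ y : XStar φ N,
      normRep y = (1 - (t : ℝ)) • normRep x + (t : ℝ) • normRep x₀ := by
    intro x t
    obtain ⟨A, hA, hx⟩ := exists_mem_sigma h x
    rw [mem_sigma_iff hA] at hx
    refine exists_normRep_eq h (hmem _ x t hx) ?_
    rw [Matrix.trace_add, Complex.add_re, trace_re_smul, trace_re_smul, trace_normRep,
      trace_normRep]
    ring
  choose f hf using hex
  -- Segments from τ to x₀ lie in the cone on two finite contact sets, which meets only a part of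
  -- the space covered by finitely many cells.
  have hcell : ∀ τ ∈ closedCells φ N, ∃ T : Set (Set (XStar φ N)), T.Finite ∧
      T ⊆ closedCells φ N ∧ ∀ x ∈ τ, ∀ t, ∃ τ' ∈ T, f x t ∈ τ' := by
    intro τ hτ
    obtain ⟨A, hA, hx⟩ := exists_form_of_mem_closedCells hτ
    obtain ⟨T, hT, hTc, hcov⟩ := exists_finite_closedCells h
      ((finite_contacts h hA).union (finite_contacts h hA₀.mem_ryshkov))
    refine ⟨T, hT, hTc, fun x hxτ t => hcov _ ?_⟩
    rw [hf]
    exact hmem _ x t ((hx x).1 hxτ)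
  have hfx : ∀ x, Continuous (f x) := by
    intro x
    obtain ⟨T, hT, hTc, hcov⟩ := hcell _ (minimalCell_mem_closedCells h x)
    refine continuous_of_forall_biUnion h ?_ hT hTc (hcov x (self_mem_minimalCell x))
    simp_rw [hf]
    fun_prop
  -- The weak topology controls maps out of the space, not directly out of its product with the
  -- interval. Currying reduces to such maps, and local compactness of the interval allows
  -- uncurrying at the end.
  set G : XStar φ N → C(unitInterval, XStar φ N) := fun x => ⟨f x, hfx x⟩ with hG
  have hinv : ∀ x : XStar φ N, Function.invFun normRep (normRep x) = x :=
    Function.leftInverse_invFun normRep_injective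
  have hGc : Continuous G := by
    refine continuous_of_forall_closedCells (k := fun B => G (Function.invFun normRep B))
      (fun x => by rw [hinv]) fun τ hτ => ?_
    rw [continuousOn_iff_continuous_domRestrict]
    refine ContinuousMap.continuous_of_continuous_uncurry _ ?_
    obtain ⟨T, hT, hTc, hcov⟩ := hcell τ hτ
    refine continuous_of_forall_biUnion h ?_ hT hTc ?_
    · have h1 : ∀ p : (normRep '' τ) × unitInterval,
          normRep (f (Function.invFun normRep p.1.1) p.2) =
            (1 - (p.2 : ℝ)) • p.1.1 + (p.2 : ℝ) • normRep x₀ := by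
        rintro ⟨⟨_, x, hx, rfl⟩, t⟩
        rw [hf, hinv]
      refine Continuous.congr ?_ fun p => (h1 p).symm
      fun_prop
    · rintro ⟨⟨_, x, hx, rfl⟩, t⟩
      change ∃ τ' ∈ T, f (Function.invFun normRep (normRep x)) t ∈ τ'
      rw [hinv]
      exact hcov x hx t
  refine ⟨fun p => G p.2 p.1, ?_, fun t x => hf x t⟩
  exact (ContinuousMap.continuous_uncurry_of_continuous ⟨G, hGc⟩).comp continuous_swap

theorem contractibleSpace_closedStratum (h : IsImaginaryLattice φ)
    {V : Submodule F (Fin N → F)} (hV : V ≠ ⊤) : ContractibleSpace (closedStratum φ V) := by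
  obtain ⟨x₀, hx₀⟩ := nonempty_stratum h hV
  rw [mem_stratum_iff] at hx₀
  obtain ⟨H, hH, hHn⟩ := exists_contraction h x₀
  have hmem : ∀ p : unitInterval × closedStratum φ V, H (p.1, p.2.1) ∈ closedStratum φ V := by
    rintro ⟨t, x, hx⟩
    rw [mem_closedStratum_iff h] at hx ⊢
    intro z hz
    have h1 : normRep x *ᵥ z = 0 := hx hz
    have h2 : normRep x₀ *ᵥ z = 0 := hx₀.ge hz
    rw [LinearMap.mem_ker, Matrix.mulVecLin_apply, hHn, Matrix.add_mulVec, Matrix.smul_mulVec,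
      Matrix.smul_mulVec, h1, h2, smul_zero, smul_zero, add_zero]
  refine contractible_iff_id_nullhomotopic _ |>.2
    ⟨⟨x₀, (mem_closedStratum_iff h).2 hx₀.ge⟩, ⟨⟨⟨fun p => ⟨H (p.1, p.2.1), hmem p⟩, ?_⟩, ?_, ?_⟩⟩⟩
  · exact (hH.comp (by fun_prop)).subtype_mk _
  · intro x
    refine Subtype.ext (normRep_injective ?_)
    change normRep (H (0, x.1)) = normRep x.1
    rw [hHn]
    simp
  · intro x
    refine Subtype.ext (normRep_injective ?_)
    change normRep (H (1, x.1)) = normRep x₀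
    rw [hHn]
    simp

end Contraction

/-! ### Comparison of the two topologies on a stratum -/

section StratumTopology

variable {F : Type*} [Field F] [NumberField F] {φ : F →+* ℂ} {N : ℕ} {V : Submodule F (Fin N → F)}

/-- The perfect cones meeting a stratum near one of its points involve finitely many lattice
vectors. -/
theorem eventually_mem_coneHull (h : IsImaginaryLattice φ) {x₀ : XStar φ N}
    (hx₀ : x₀ ∈ stratum φ V) : ∃ T : Set (Fin N → 𝓞 F), T.Finite ∧
      ∀ᶠ B in 𝓝 (normRep x₀), ∀ x ∈ stratum φ V, normRep x = B → B ∈ coneHull φ N T := by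
  rw [mem_stratum_iff] at hx₀
  obtain ⟨D, P, hDP⟩ := exists_isAdapted h V
  obtain ⟨α, hα, hαM⟩ := exists_le_val (hDP.posDef_add (posSemidef_normRep x₀) hx₀)
  -- Moving all entries by less than δ changes a form by at most half of the lower bound α.
  set δ : ℝ := α / (2 * ((N : ℝ) ^ 2 + 1)) with hδ
  have hδ0 : 0 < δ := by positivity
  have hδα : (N : ℝ) ^ 2 * δ ≤ α / 2 := by
    have h1 : ((N : ℝ) ^ 2 + 1) * δ = α / 2 := by
      rw [hδ]
      field_simp
    linarith
  -- This is the trace bound for PAP + D given by `IsAdapted.mul_trace_le` with constant α/2: for a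
  -- perfect A whose cell contains x, the pairing is at most that of the identity, the trace 1. The
  -- trace of A itself is not controlled.
  obtain ⟨β, hβ, hβR⟩ := exists_le_val_of_trace_le h N ((N + α / 2 * D.trace.re) / (α / 2))
  refine ⟨{v | ‖embInt φ N v‖ ≤ 1 + β⁻¹}, finite_norm_embInt_le h _, ?_⟩
  have hnhds : ∀ᶠ B in 𝓝 (normRep x₀), ∀ i j, ‖(B - normRep x₀) i j‖ < δ := by
    refine Filter.eventually_all.2 fun i => Filter.eventually_all.2 fun j => ?_
    have hc : Continuous fun B : Matrix (Fin N) (Fin N) ℂ => ‖(B - normRep x₀) i j‖ := by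
      simp only [Matrix.sub_apply]
      fun_prop
    refine (hc.tendsto _).eventually (gt_mem_nhds ?_)
    simpa using hδ0
  filter_upwards [hnhds] with B hB x hx hxB
  subst hxB
  rw [mem_stratum_iff] at hx
  have hlow : ∀ z, α / 2 * ‖z‖ ^ 2 ≤ val (normRep x + D) z := by
    intro z
    have h1 := abs_le.1 (abs_val_le (fun i j => (hB i j).le) z)
    have h2 := hαM z
    have h3 := mul_le_mul_of_nonneg_right hδα (sq_nonneg ‖z‖)
    rw [val_sub] at h1
    rw [val_add] at h2 ⊢
    linarith [h1.1]
  obtain ⟨A, hA, hxA⟩ := exists_mem_sigma h x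
  rw [mem_sigma_iff hA] at hxA
  have hpair := pairing_le_of_mem_coneHull (one_mem_ryshkov h) hxA
  rw [pairing_one, trace_normRep] at hpair
  have htr := hDP.mul_trace_le h hA.mem_ryshkov (posSemidef_normRep x).1 hx.ge (half_pos hα).le hlow
  have hval := hβR _ (hDP.mul_mul_add_mem_ryshkov h hA.mem_ryshkov) (by
    rw [le_div_iff₀' (half_pos hα)]
    have := mul_le_mul_of_nonneg_left hpair (Nat.cast_nonneg (α := ℝ) N)
    linarith)
  obtain ⟨c, hc, hs, hcx⟩ := hxA
  refine ⟨c, hc, fun v hv => ?_, hcx⟩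
  -- Vectors occurring in x are orthogonal to V, so PAP + D takes on them the same value 1 as A,
  -- which bounds their norm through β.
  have hDv : D *ᵥ embInt φ N v = 0 := by
    rw [hDP.orthogonal]
    intro y hy
    have h1 : normRep x *ᵥ y = 0 := hx.ge hy
    rw [hcx, finsupp_sum_mulVec_eq_zero_iff hc] at h1
    have h2 := congrArg star (h1 v hv)
    rwa [Matrix.star_dotProduct, star_star, star_zero] at h2
  have hPv := hDP.mulVec_eq _ hDv
  have h1 := hval (embInt φ N v)
  have h2 : val (P * A * P) (embInt φ N v) = 1 := by
    have h3 := val_conj A P (embInt φ N v)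
    rwa [hDP.isHermitian.eq, hPv, ← formValue_eq_val A, (hs hv).2] at h3
  rw [val_add, h2, val_eq_zero_of_mulVec_eq_zero hDv, add_zero] at h1
  rw [Set.mem_ofPred_eq]
  have h4 : ‖embInt φ N v‖ ^ 2 ≤ β⁻¹ := by
    rw [← one_div, le_div_iff₀' hβ]
    exact h1
  nlinarith [sq_nonneg (‖embInt φ N v‖ - 1), inv_pos.2 hβ]

/-- This is the nontrivial half of the comparison: passing from representatives back to classes is
continuous into the weak topology, since near each point of the stratum only finitely many cells are
needed. -/
theorem continuousOn_invFun_normRep [Nonempty (XStar φ N)] (h : IsImaginaryLattice φ) :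
    ContinuousOn (Function.invFun (normRep (φ := φ) (N := N))) (normRep '' stratum φ V) := by
  have hinv : ∀ x : XStar φ N, Function.invFun normRep (normRep x) = x :=
    Function.leftInverse_invFun normRep_injective
  rintro _ ⟨x₀, hx₀, rfl⟩
  obtain ⟨M, hM, hev⟩ := eventually_mem_coneHull h hx₀
  obtain ⟨T, hT, hTc, hcov⟩ := exists_finite_closedCells h hM
  refine (continuousWithinAt_inter hev).1 (continuousOn_of_mapsTo_biUnion h ?_ hT hTc ?_ _
    ⟨⟨x₀, hx₀, rfl⟩, mem_of_mem_nhds hev⟩)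
  · refine continuousOn_id.congr ?_
    rintro _ ⟨⟨x, -, rfl⟩, -⟩
    exact congrArg normRep (hinv x)
  · rintro _ ⟨⟨x, hx, rfl⟩, hx'⟩
    rw [hinv]
    exact hcov x (hx' x hx rfl)

theorem induced_cwTopology_eq (h : IsImaginaryLattice φ) (V : Submodule F (Fin N → F)) :
    TopologicalSpace.induced (Subtype.val : stratum φ V → XStar φ N)
        (instTopologicalSpaceXStar φ N) =
      TopologicalSpace.induced (Subtype.val : stratum φ V → XStar φ N) (usualTopology φ N) := by
  refine le_antisymm (induced_mono cwTopology_le_usualTopology) fun s hs => ?_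
  obtain ⟨U, hU, rfl⟩ := hs
  rcases isEmpty_or_nonempty (XStar φ N) with hempty | hne
  · rw [Set.eq_empty_of_isEmpty (Subtype.val ⁻¹' U : Set (stratum φ V))]
    exact @isOpen_empty _ (_)
  have hinv : ∀ x : XStar φ N, Function.invFun normRep (normRep x) = x :=
    Function.leftInverse_invFun normRep_injective
  obtain ⟨W, hW, hWU⟩ := continuousOn_iff'.1 (continuousOn_invFun_normRep (V := V) h) U hU
  rw [usualTopology_eq, induced_compose]
  refine ⟨W, hW, Set.ext fun x => ?_⟩
  have h1 := Set.ext_iff.1 hWU (normRep x.1)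
  simp only [Set.mem_inter_iff, Set.mem_preimage, hinv, Set.mem_image_of_mem normRep x.2,
    and_true] at h1
  exact h1.symm

end StratumTopology

end

end VoronoiHermitian

theorem mainTheorem12 {F : Type*} [Field F] [NumberField F]
    (hdeg : Module.finrank ℚ F = 2) (himag : NumberField.IsTotallyComplex F)
    (φ : F →+* ℂ) (N : ℕ) :
    T2Space (VoronoiHermitian.XStar φ N) ∧
    ∃ _ : Topology.CWComplex (Set.univ : Set (VoronoiHermitian.XStar φ N)),
      {τ : Set (VoronoiHermitian.XStar φ N) | ∃ (n : ℕ)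
          (e : Topology.RelCWComplex.cell (Set.univ : Set (VoronoiHermitian.XStar φ N)) n),
          τ = Topology.RelCWComplex.closedCell n e} = VoronoiHermitian.closedCells φ N ∧
      ∀ V : Submodule F (Fin N → F), V ≠ ⊤ →
        (∃ E : Topology.RelCWComplex.Subcomplex
            (Set.univ : Set (VoronoiHermitian.XStar φ N)),
          (E : Set (VoronoiHermitian.XStar φ N)) = VoronoiHermitian.closedStratum φ V) ∧
        ContractibleSpace (VoronoiHermitian.closedStratum φ V) ∧
        TopologicalSpace.induced
            (Subtype.val : VoronoiHermitian.stratum φ V → VoronoiHermitian.XStar φ N)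
            (VoronoiHermitian.instTopologicalSpaceXStar φ N) =
          TopologicalSpace.induced
            (Subtype.val : VoronoiHermitian.stratum φ V → VoronoiHermitian.XStar φ N)
            (VoronoiHermitian.usualTopology φ N) := by
  have h := VoronoiHermitian.isImaginaryLattice hdeg himag φ
  exact ⟨VoronoiHermitian.t2Space_XStar, VoronoiHermitian.cwComplex h,
    VoronoiHermitian.setOf_closedCell_eq h, fun V hV =>
      ⟨⟨VoronoiHermitian.subcomplex h V, rfl⟩,
        VoronoiHermitian.contractibleSpace_closedStratum h hV,
        VoronoiHermitian.induced_cwTopology_eq h V⟩⟩
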